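/- **Setting.** Fix integers $K\ge 1$, $M\ge 0$ and constants $\alpha>0$ with $\alpha^2<3/2$, $d>0$, $c_g\in(0,1]$, $C_N,c_0\in\mathbb R$. In slots $t=1,2,\dots$ arm $i\in[K]$ yields a reward in $[0,\alpha]$ whose expectation given the past is $\mu_{i,t}$ (the means may depend on the history). Let $T\ge 2$ be the horizon, $b=T^{-d}$, $\delta=T^{-3}$, and let $N\ge 1$ be an integer with $N\le C_N (bK)^{-2/3}$. **Algorithm (ABAR).** Count slots $\tau=1,2,\dots$ from the last reset (initially from time $0$). Block $l\ge1$ consists of the slots $(2^{l-1}-1)KN<\tau\le(2^l-1)KN$. In block $l\ge2$, pull the monitoring arm $i^{(l-1)}$ if $\tau\equiv0 \pmod K$, and the monitoring arm $i^{(l)}$ if $\tau\equiv1\pmod K$, $\tau\not\equiv 0\pmod K$ and $\tau\ge(2^l-2)KN+1$; in every other slot pull an arm maximizing the UCB index $\hat\mu_k+\sqrt{2\log \tau/n_k}$, where $n_k$ is the number of pulls of arm $k$ since the last reset and $\hat\mu_k$ the corresponding empirical mean (index $+\infty$ if $n_k=0$). The arm $i^{(l)}$ is one with the most non-monitoring pulls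 since the last reset, chosen at $\tau=KN$ if $l=1$ and at $\tau=(2^l-2)KN$ if $l\ge2$. Ties are broken arbitrarily, without anticipating the future. A change is detected at the end of slot $t$ if, for some arm and some split of the slots since the last reset into two consecutive windows containing $n_1,n_2\ge1$ observations of that arm, the two empirical means of the arm differ by at least $\sqrt{\log(1/\delta)/(2n_1)}+\sqrt{\log(1/\delta)/(2n_2)}$; then all statistics are discarded and the algorithm restarts (a reset at time $t$). **Changes and resets.** A slot $1\le t<T$ is a change point if $|\mu_{i,t+1}-\mu_{i,t}|>b$ for some $i$. The change points are $T_1<T_2<\cdots$; almost surely there are at most $M$ of them. Write $T_{M+1}=T$, where $M$ now also denotes the actual number of change points. A reset is abrupt if it is the first reset at or after some change point, and gradual otherwise. $X_t$ and $Y_t$ are the times of the last gradual and the last abrupt reset strictly before $t$ ($0$ if none). With $\mathrm{Reg}(t)=\max_i\mu_{i,t}-\mu_{I(t),t}$, where $I(t)$ is the arm pulled, the regret over the gradual reset intervals is $$\mathrm{Reg}(T_{\rm gradual})=\sum_{m=1}^{M+1}\ \sum_{t=Y_{T_m}}^{X_{T_m}}\mathrm{Reg}(t)+\sum_{t=\max(X_{T_{M+1}},Y_{T_{M+1}})}^{T}\mathrm{Reg}(t),$$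 where only slots $t\ge1$ are counted and a sum whose lower limit exceeds its upper limit is zero. **Assumptions.** 1. *(Monitoring arms.)* With probability at least $1-c_0/T$: at each change point, lying in block $l$ since the last reset, at least one of the monitoring arms $i^{(l)},i^{(l-1)}$ (only $i^{(1)}$ if $l=1$) has a mean that changes by more than $b$. 2. *(Detection.)* With probability at least $1-c_0/T$, each change point is followed by a reset, at or after it and before $T$. (Assumptions 1 and 2 hold in particular if these events are almost sure.) 3. *(Globally gradual.)* Almost surely, $|\mu_{i,t}-\mu_{i,s}|\ge c_g|\mu_{j,t}-\mu_{j,s}|$ for all arms $i,j$ and all slots $1\le s\le t<T$ such that none of $s,\dots,t$ is a change point. 4. *(Base bandit.)* UCB with $K$ arms and rewards in $[0,\alpha]$ has logarithmic drift-tolerant regret: there is a constant $c>0$ such that, for every environment with deterministic means and every horizon $T\ge 2$, $$\mathbb E\Big[\sum_{t=1}^T(\mathrm{Reg}(t)-c\,\epsilon(t))^+\Big]\le c\sum_{\Delta_i>0}\frac{\log T}{\Delta_i},\qquad \Delta_i=\max_j\mu_{j,1}-\mu_{i,1},\quad \epsilon(t)=\max_{s\le t}\max_i|\mu_{i,s}-\mu_{i,1}|.$$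 **Theorem.** Under these assumptions there is a constant $C>0$, depending only on $K,M,\alpha,d,c_g,C_N,c_0$ (and the constant in Assumption 4), such that for all $T$, $N$ and environments as above $$\mathbb E[\mathrm{Reg}(T_{\rm gradual})]\le C\sqrt{(\log T)^{2/3}\,T^{2-\frac23 d}+T\log T}+C\,T^{1-\frac d3}(\log T)^{3/2}.$$ -/

import Mathlib

open MeasureTheory Filter
open scoped ENNReal

universe u

namespace ABAR

noncomputable section

/-! ### Trajectories

Time slots are `1, 2, 3, …`.  For one realisation, `a t` is the arm pulled in slot `t`, `x t` is the
reward observed in slot `t`, and `m t k` is the expected reward of arm `k` in slot `t`. -/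

open Classical in
/-- Number of pulls of arm `k` in the slots `s < u ≤ t`. -/
def pulls {K : ℕ} (a : ℕ → Fin K) (k : Fin K) (s t : ℕ) : ℕ :=
  ((Finset.Ioc s t).filter (fun u => a u = k)).card

open Classical in
/-- Empirical mean reward of arm `k` over the slots `s < u ≤ t` in which it was pulled. -/
def empMean {K : ℕ} (a : ℕ → Fin K) (x : ℕ → ℝ) (k : Fin K) (s t : ℕ) : ℝ :=
  (∑ u ∈ (Finset.Ioc s t).filter (fun u => a u = k), x u) / (pulls a k s t : ℝ)

/-! ### Adaptive windowing and resets -/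

/-- The detection threshold for two sub-windows with `n₁` and `n₂` observations. -/
def cut (δ : ℝ) (n₁ n₂ : ℕ) : ℝ :=
  Real.sqrt (1 / (2 * (n₁ : ℝ)) * Real.log (1 / δ)) +
    Real.sqrt (1 / (2 * (n₂ : ℝ)) * Real.log (1 / δ))

/-- ADWIN detects a change at the end of slot `t` in the window of slots `s < u ≤ t`: for some arm
`k` and some split into `(s, u]` and `(u, t]`, each containing an observation of `k`, the empirical
means of `k` differ by at least the threshold. -/
def Detects {K : ℕ} (δ : ℝ) (a : ℕ → Fin K) (x : ℕ → ℝ) (s t : ℕ) : Prop :=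
  ∃ (k : Fin K) (u : ℕ), s < u ∧ u < t ∧ 0 < pulls a k s u ∧ 0 < pulls a k u t ∧
    cut δ (pulls a k s u) (pulls a k u t) ≤ |empMean a x k s u - empMean a x k u t|

open Classical in
/-- Time of the most recent reset strictly before slot `t` (`0` if there is none).  The window kept
by the algorithm at the end of slot `t` consists of the slots `lastReset t < u ≤ t`; if a change is
detected in it, everything is discarded and the algorithm restarts after slot `t`. -/
def lastReset {K : ℕ} (δ : ℝ) (a : ℕ → Fin K) (x : ℕ → ℝ) : ℕ → ℕ
  | 0 => 0
  | t + 1 => if Detects δ a x (lastReset δ a x t) t then t else lastReset δ a x t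

/-- A reset takes place at the end of slot `t`. -/
def IsReset {K : ℕ} (δ : ℝ) (a : ℕ → Fin K) (x : ℕ → ℝ) (t : ℕ) : Prop :=
  Detects δ a x (lastReset δ a x t) t

/-! ### The base bandit (UCB) -/

/-- The UCB index, in slot `t`, of arm `k`, for UCB started after slot `s`. -/
def ucbIndex {K : ℕ} (a : ℕ → Fin K) (x : ℕ → ℝ) (s t : ℕ) (k : Fin K) : ℝ :=
  empMean a x k s (t - 1) +
    Real.sqrt (2 * Real.log ((t - s : ℕ) : ℝ) / (pulls a k s (t - 1) : ℝ))

/-- The arm pulled in slot `t` maximises the UCB index (ties broken arbitrarily), where an arm that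
has not been pulled since slot `s` has index `+∞`. -/
def IsUCBChoice {K : ℕ} (a : ℕ → Fin K) (x : ℕ → ℝ) (s t : ℕ) : Prop :=
  pulls a (a t) s (t - 1) = 0 ∨
    ∀ k, 0 < pulls a k s (t - 1) ∧ ucbIndex a x s t k ≤ ucbIndex a x s t (a t)

/-! ### Blocks, monitoring, and the ABAR algorithm -/

/-- The `τ`-th slot after a reset lies in block `l`. -/
def InBlock (K N l τ : ℕ) : Prop :=
  1 ≤ l ∧ (2 ^ (l - 1) - 1) * (K * N) < τ ∧ τ ≤ (2 ^ l - 1) * (K * N)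

/-- In the `τ`-th slot after a reset, block `l`, the monitoring arm of block `l - 1` is pulled. -/
def MonitorsPrev (K N l τ : ℕ) : Prop :=
  InBlock K N l τ ∧ 2 ≤ l ∧ τ % K = 0

/-- In the `τ`-th slot after a reset, which is in the last subblock of block `l`, the newly selected
monitoring arm of block `l` is pulled. -/
def MonitorsNew (K N l τ : ℕ) : Prop :=
  InBlock K N l τ ∧ 2 ≤ l ∧ τ % K = 1 ∧ (2 ^ l - 2) * (K * N) + 1 ≤ τ

/-- The `τ`-th slot after a reset is a monitoring round. -/
def IsMonitoring (K N τ : ℕ) : Prop :=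
  ∃ l, MonitorsPrev K N l τ ∨ MonitorsNew K N l τ

/-- Number of slots after a reset at which the monitoring arm of block `l` is selected. -/
def selTime (K N l : ℕ) : ℕ :=
  if l = 1 then K * N else (2 ^ l - 2) * (K * N)

open Classical in
/-- Number of non-monitoring pulls of arm `k` in the first `τ` slots after a reset at time `ρ`. -/
def exploreCount {K : ℕ} (N : ℕ) (a : ℕ → Fin K) (ρ τ : ℕ) (k : Fin K) : ℕ :=
  ((Finset.Ioc ρ (ρ + τ)).filter (fun u => ¬ IsMonitoring K N (u - ρ) ∧ a u = k)).card

/-- The pulls `a` on the observed rewards `x` are those of ABAR with monitoring parameter `N` and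
confidence level `δ`, with any way of breaking ties; `i ρ l` is the monitoring arm selected in block
`l` after the (re)start at time `ρ`. -/
structure IsRun {K : ℕ} (N : ℕ) (δ : ℝ) (a : ℕ → Fin K) (x : ℕ → ℝ) (i : ℕ → ℕ → Fin K) :
    Prop where
  select : ∀ ρ l, 1 ≤ l → ∀ k,
    exploreCount N a ρ (selTime K N l) k ≤ exploreCount N a ρ (selTime K N l) (i ρ l)
  monitor_prev : ∀ t l, 1 ≤ t → MonitorsPrev K N l (t - lastReset δ a x t) →
    a t = i (lastReset δ a x t) (l - 1)
  monitor_new : ∀ t l, 1 ≤ t → MonitorsNew K N l (t - lastReset δ a x t) →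
    a t = i (lastReset δ a x t) l
  explore : ∀ t, 1 ≤ t → ¬ IsMonitoring K N (t - lastReset δ a x t) →
    IsUCBChoice a x (lastReset δ a x t) t

/-! ### Change points, gradual segments, reset times -/

open Classical in
/-- Change points within the horizon: slots after which the mean of some arm moves by more than
`b`. -/
def changePoints {K : ℕ} (b : ℝ) (T : ℕ) (m : ℕ → Fin K → ℝ) : Finset ℕ :=
  (Finset.Ico 1 T).filter (fun t => ∃ k, b < |m (t + 1) k - m t k|)

/-- The environment is globally gradual with constant `c`: for any two slots of the horizon that
belong to a common gradual segment, the movements of all arms are comparable. -/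
def GloballyGradual {K : ℕ} (b : ℝ) (T : ℕ) (c : ℝ) (m : ℕ → Fin K → ℝ) : Prop :=
  ∀ s t, 1 ≤ s → s ≤ t → t < T →
    (∀ u, s ≤ u → u ≤ t → ∀ k, |m (u + 1) k - m u k| ≤ b) →
    ∀ i j, c * |m t j - m s j| ≤ |m t i - m s i|

/-- At every change point one of the monitoring arms of the current and of the previous block (there
is no previous one in block `1`) undergoes an abrupt change. -/
def MonitoredChanges {K : ℕ} (N : ℕ) (δ b : ℝ) (T : ℕ) (m : ℕ → Fin K → ℝ) (a : ℕ → Fin K)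
    (x : ℕ → ℝ) (i : ℕ → ℕ → Fin K) : Prop :=
  ∀ c ∈ changePoints b T m, ∀ l, InBlock K N l (c - lastReset δ a x c) →
    ∃ j, (j = i (lastReset δ a x c) l ∨ (2 ≤ l ∧ j = i (lastReset δ a x c) (l - 1))) ∧
      b < |m (c + 1) j - m c j|

/-- Every abrupt change is followed by a detection, hence by a reset, within the horizon. -/
def DetectedChanges {K : ℕ} (δ b : ℝ) (T : ℕ) (m : ℕ → Fin K → ℝ) (a : ℕ → Fin K)
    (x : ℕ → ℝ) : Prop :=
  ∀ c ∈ changePoints b T m, ∃ r, c ≤ r ∧ r < T ∧ IsReset δ a x r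

/-- An abrupt reset: the first reset that follows some change point. -/
def IsAbruptReset {K : ℕ} (δ b : ℝ) (T : ℕ) (m : ℕ → Fin K → ℝ) (a : ℕ → Fin K)
    (x : ℕ → ℝ) (r : ℕ) : Prop :=
  IsReset δ a x r ∧ ∃ c ∈ changePoints b T m, lastReset δ a x r < c ∧ c ≤ r

/-- A gradual reset: any other reset. -/
def IsGradualReset {K : ℕ} (δ b : ℝ) (T : ℕ) (m : ℕ → Fin K → ℝ) (a : ℕ → Fin K)
    (x : ℕ → ℝ) (r : ℕ) : Prop :=
  IsReset δ a x r ∧ ¬ IsAbruptReset δ b T m a x r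

open Classical in
/-- Time `X_t` of the most recent gradual reset strictly before `t`, `0` if there is none. -/
def lastGradual {K : ℕ} (δ b : ℝ) (T : ℕ) (m : ℕ → Fin K → ℝ) (a : ℕ → Fin K)
    (x : ℕ → ℝ) (t : ℕ) : ℕ :=
  ((Finset.range t).filter (IsGradualReset δ b T m a x)).sup id

open Classical in
/-- Time `Y_t` of the most recent abrupt reset strictly before `t`, `0` if there is none. -/
def lastAbrupt {K : ℕ} (δ b : ℝ) (T : ℕ) (m : ℕ → Fin K → ℝ) (a : ℕ → Fin K)
    (x : ℕ → ℝ) (t : ℕ) : ℕ :=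
  ((Finset.range t).filter (IsAbruptReset δ b T m a x)).sup id

/-! ### Regret -/

/-- Instantaneous regret in slot `t`. -/
def reg {K : ℕ} (m : ℕ → Fin K → ℝ) (a : ℕ → Fin K) (t : ℕ) : ℝ :=
  (⨆ j, m t j) - m t (a t)

/-- Regret over the gradual reset intervals: the sum over `c = T₁, …, T_M, T_{M+1} = T` of the
regret over `[Y_c, X_c]`, plus the regret from the last reset before `T` until `T`.  That last reset
is `X_T` when the final reset is gradual; when it is abrupt, the slots up to `Y_T` belong to the
abrupt reset intervals and are not counted here. -/
def gradualRegret {K : ℕ} (δ b : ℝ) (T : ℕ) (m : ℕ → Fin K → ℝ) (a : ℕ → Fin K)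
    (x : ℕ → ℝ) : ℝ :=
  (∑ c ∈ insert T (changePoints b T m),
      ∑ t ∈ Finset.Icc (max 1 (lastAbrupt δ b T m a x c)) (lastGradual δ b T m a x c),
        reg m a t) +
    ∑ t ∈ Finset.Icc
        (max 1 (max (lastGradual δ b T m a x T) (lastAbrupt δ b T m a x T))) T,
      reg m a t

/-- Gap of arm `i` in slot `1`. -/
def gap {K : ℕ} (m : ℕ → Fin K → ℝ) (i : Fin K) : ℝ :=
  (⨆ j, m 1 j) - m 1 i

/-- Maximal drift of the arms from slot `1` until slot `t`. -/
def drift {K : ℕ} (m : ℕ → Fin K → ℝ) (t : ℕ) : ℝ :=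
  ⨆ p : Set.Icc 1 t × Fin K, |m p.1 p.2 - m 1 p.2|

/-- Drift-tolerant regret until slot `T` with factor `c`. -/
def driftTolerantRegret {K : ℕ} (m : ℕ → Fin K → ℝ) (a : ℕ → Fin K) (T : ℕ) (c : ℝ) : ℝ :=
  ∑ t ∈ Finset.Icc 1 T, max (reg m a t - c * drift m t) 0

/-! ### The stochastic environment -/

/-- A non-stationary, possibly history-dependent, bandit environment: `X t k` is the reward, in
`[0, α]`, that arm `k` yields in slot `t`, and `μ t k` is its expectation given the past. -/
structure IsEnv {Ω : Type*} {mΩ : MeasurableSpace Ω} {K : ℕ} (P : Measure Ω)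
    (ℱ : Filtration ℕ mΩ) (α : ℝ) (μ X : ℕ → Fin K → Ω → ℝ) : Prop where
  reward_measurable : ∀ t k, Measurable[ℱ (t + 1)] (X (t + 1) k)
  mean_measurable : ∀ t k, Measurable[ℱ t] (μ (t + 1) k)
  reward_mem : ∀ t k ω, X (t + 1) k ω ∈ Set.Icc 0 α
  mean_mem : ∀ t k ω, μ (t + 1) k ω ∈ Set.Icc 0 α
  mean_eq : ∀ t k, P[X (t + 1) k | ℱ t] =ᵐ[P] μ (t + 1) k

open Classical in
/-- UCB with `K` arms has logarithmic drift-tolerant regret: there is a constant `c` such that, in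
every environment with deterministic means `m`, and for every horizon `T`, the expected
drift-tolerant regret of UCB with factor `c` is at most `c * ∑ log T / Δ_i`. -/
def UCBLogDriftTolerant (K : ℕ) (α : ℝ) : Prop :=
  ∃ c : ℝ, 0 < c ∧ ∀ T : ℕ, 2 ≤ T →
    ∀ (Ω : Type u) (mΩ : MeasurableSpace Ω) (P : Measure Ω) (_ : IsProbabilityMeasure P)
      (ℱ : Filtration ℕ mΩ) (m : ℕ → Fin K → ℝ) (X : ℕ → Fin K → Ω → ℝ) (I : ℕ → Ω → Fin K),
      IsEnv P ℱ α (fun t k _ => m t k) X →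
      (∀ t, Measurable[ℱ t] (I (t + 1))) →
      (∀ ω t, 1 ≤ t → IsUCBChoice (fun s => I s ω) (fun s => X s (I s ω) ω) 0 t) →
      ∫⁻ ω, ENNReal.ofReal (driftTolerantRegret m (fun s => I s ω) T c) ∂P ≤
        ENNReal.ofReal
          (c * ∑ i ∈ Finset.univ.filter (fun i => 0 < gap m i), Real.log T / gap m i)

end

end ABAR

/-! Put `B = b^(1/3) = T^(-d/3)`. Apart from boundary slots, the gradual reset intervals consist of
slots with no change point since the last reset, once every change point is followed by a reset
before `T` (`gradualRegret_le`). On such slots three facts bound the regret.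

Drift. While nothing is detected, the monitoring arm of the previous block, pulled every `K` slots,
can move within a block by only `O(√(log T / w) + b K w)`, for any window parameter `w`. The
globally gradual assumption transfers this to all arms, and `w ≈ B⁻²` balances the two terms at `B
√(log T)`. Over logarithmically many blocks the means move by `O(B (log T)^(3/2))` between two
resets (`abs_mean_sub_mean_le_maxDrift`, `maxDrift_le`), which over `T` slots gives the last term of
the bound.

Regret of one slot. An exploratory slot has the usual UCB regret plus the drift
(`reg_le_of_explore`). A monitoring arm was selected as the most explored one. UCB does not explore
a bad arm often, so this arm had small regret at some late exploratory pull, hence, up to drift,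
still has (`reg_le_of_isMonitoring`). Both bounds allow for slots in which a UCB index fails to be
optimistic.

Number of resets. The noise stays below a fraction `γ < 1` of the detection threshold, so a reset
without a change point needs real drift, and hence at least `(1 - γ) / B²` slots
(`le_length_of_isReset`). There are thus `O(1 + B² T)` restarts, each paying for learning afresh.
Summing the confidence radii gives `√(log T) (y T + R / y)` for `R` restarts and any `y > 0`
(`calmRegret_le`); `y = B + 1/√T` yields `√(T log T)` plus a term dominated by the drift.

The probabilistic input is an exponential supermartingale for the noise of an arm. With Ville's
inequality, a geometric grid of scales and a union bound it gives the concentration with probability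
`1 - O(1/T)` (`measure_not_concentrated_le`); the condition `α² < 3/2` is what makes `γ < 1`
possible. Failures of optimism are bounded in expectation only: the index uses `log τ`, so early
failures are not rare. After a restart they have probability `O(τ^(-5/3))`, which is summable
(`measure_inter_fails_le`, `lintegral_sum_failCount_le`). Off the good event the trivial bound
`O(T)` costs a constant. -/

namespace ABAR

/-! ### Deterministic analysis of a single trajectory -/

section Trajectory

variable {K : ℕ} {δ : ℝ} {a : ℕ → Fin K} {x : ℕ → ℝ}

/-! ### The last reset -/

open Classical in
lemma lastReset_succ (t : ℕ) : lastReset δ a x (t + 1) =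
    if IsReset δ a x t then t else lastReset δ a x t := by
  rw [lastReset]; rfl

lemma lastReset_lt {t : ℕ} (ht : 1 ≤ t) : lastReset δ a x t < t := by
  induction t, ht using Nat.le_induction with
  | base => rw [lastReset_succ]; split_ifs <;> simp [lastReset]
  | succ t ht ih => rw [lastReset_succ]; split_ifs <;> omega

lemma lastReset_eq_zero_or (t : ℕ) :
    lastReset δ a x t = 0 ∨ IsReset δ a x (lastReset δ a x t) := by
  induction t with
  | zero => left; rfl
  | succ t ih =>
    rw [lastReset_succ]
    split_ifs with h
    · exact Or.inr h
    · exact ih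

lemma lastReset_mono : Monotone (lastReset δ a x) := by
  refine monotone_nat_of_le_succ fun t => ?_
  rw [lastReset_succ]
  split_ifs with h
  · rcases Nat.eq_zero_or_pos t with rfl | ht
    · exact le_rfl
    · exact (lastReset_lt ht).le
  · exact le_rfl

lemma le_lastReset {r t : ℕ} (hr : IsReset δ a x r) (h : r < t) : r ≤ lastReset δ a x t := by
  have h1 : lastReset δ a x (r + 1) = r := by rw [lastReset_succ, if_pos hr]
  calc r = lastReset δ a x (r + 1) := h1.symm
    _ ≤ _ := lastReset_mono h

lemma lastReset_eq_of_lt {s t : ℕ} (h : lastReset δ a x t < s) (hst : s ≤ t) :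
    lastReset δ a x s = lastReset δ a x t := by
  refine le_antisymm (lastReset_mono hst) ?_
  rcases lastReset_eq_zero_or (δ := δ) (a := a) (x := x) t with h0 | h0
  · omega
  · exact le_lastReset h0 h

lemma not_detects_of_lt {s t : ℕ} (h : lastReset δ a x t < s) (hst : s < t) :
    ¬ Detects δ a x (lastReset δ a x t) s := by
  intro hd
  rw [← lastReset_eq_of_lt h hst.le] at hd
  have := le_lastReset (δ := δ) (a := a) (x := x) hd hst
  omega

/-! ### Pulls and empirical means -/

lemma pulls_add {k : Fin K} {s u t : ℕ} (hsu : s ≤ u) (hut : u ≤ t) :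
    pulls a k s t = pulls a k s u + pulls a k u t := by
  unfold pulls
  rw [← Finset.Ioc_union_Ioc_eq_Ioc hsu hut, Finset.filter_union, Finset.card_union_of_disjoint]
  apply Finset.disjoint_filter_filter
  rw [Finset.disjoint_left]
  intro v hv hv'
  simp only [Finset.mem_Ioc] at hv hv'
  omega

lemma pulls_le {k : Fin K} {s t : ℕ} : pulls a k s t ≤ t - s := by
  unfold pulls
  exact (Finset.card_filter_le _ _).trans (by simp)

lemma pulls_mono {k : Fin K} {s s' t t' : ℕ} (hs : s ≤ s') (ht : t' ≤ t) :
    pulls a k s' t' ≤ pulls a k s t :=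
  Finset.card_le_card (Finset.filter_subset_filter _ (Finset.Ioc_subset_Ioc hs ht))

lemma pulls_lt_pulls {k : Fin K} {s u v : ℕ} (hsu : s < u) (huv : u < v) (hu : a u = k) :
    pulls a k s (u - 1) < pulls a k s (v - 1) := by
  refine Finset.card_lt_card ?_
  rw [Finset.ssubset_iff_of_subset
    (Finset.filter_subset_filter _ (Finset.Ioc_subset_Ioc le_rfl (by omega)))]
  refine ⟨u, ?_, ?_⟩
  · simp only [Finset.mem_filter, Finset.mem_Ioc]
    exact ⟨⟨hsu, by omega⟩, hu⟩
  · simp only [Finset.mem_filter, Finset.mem_Ioc, not_and]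
    intro h; omega

/-- The count of earlier pulls grows strictly along the pulls of one arm. Sums of functions of the
count over slots thereby become sums over distinct integers. -/
lemma pulls_injOn (k : Fin K) (s : ℕ) :
    Set.InjOn (fun u => pulls a k s (u - 1)) {u | s < u ∧ a u = k} := by
  intro u hu v hv h
  rcases lt_trichotomy u v with h1 | h1 | h1
  · exact absurd h (pulls_lt_pulls hu.1 h1 hu.2).ne
  · exact h1
  · exact absurd h (pulls_lt_pulls hv.1 h1 hv.2).ne'

/-- Accumulated deviation of the observed rewards of arm `k` from their means. -/
noncomputable def noise (a : ℕ → Fin K) (x : ℕ → ℝ) (m : ℕ → Fin K → ℝ) (k : Fin K) (s t : ℕ) : ℝ :=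
  ∑ u ∈ (Finset.Ioc s t).filter (fun u => a u = k), (x u - m u k)

lemma pulls_mul_empMean {k : Fin K} {s t : ℕ} :
    (pulls a k s t : ℝ) * empMean a x k s t =
      ∑ u ∈ (Finset.Ioc s t).filter (fun u => a u = k), x u := by
  unfold empMean
  rcases Nat.eq_zero_or_pos (pulls a k s t) with h | h
  · have : (Finset.Ioc s t).filter (fun u => a u = k) = ∅ := Finset.card_eq_zero.mp h
    simp [h, this]
  · have : (pulls a k s t : ℝ) ≠ 0 := by positivity
    field_simp

/-- An empirical mean is the average of the true means plus the average noise, and only the former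
depends on the drift around the reference value `y`. -/
lemma abs_empMean_sub_sub_le {m : ℕ → Fin K → ℝ} {k : Fin K} {s t : ℕ} {y D : ℝ}
    (hn : 0 < pulls a k s t) (h : ∀ u, s < u → u ≤ t → |m u k - y| ≤ D) :
    |empMean a x k s t - y - noise a x m k s t / pulls a k s t| ≤ D := by
  have hn' : (0 : ℝ) < pulls a k s t := by exact_mod_cast hn
  have e : empMean a x k s t - y - noise a x m k s t / pulls a k s t =
      (∑ u ∈ (Finset.Ioc s t).filter (fun u => a u = k), (m u k - y)) / pulls a k s t := by
    rw [eq_div_iff hn'.ne']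
    have h1 := pulls_mul_empMean (a := a) (x := x) (k := k) (s := s) (t := t)
    have h2 : noise a x m k s t / pulls a k s t * pulls a k s t = noise a x m k s t :=
      div_mul_cancel₀ _ hn'.ne'
    have h3 : (∑ u ∈ (Finset.Ioc s t).filter (fun u => a u = k), y) = pulls a k s t * y := by
      simp [pulls]
    simp only [sub_mul, h2]
    rw [Finset.sum_sub_distrib, h3, noise, Finset.sum_sub_distrib]
    linarith
  rw [e, abs_div, abs_of_pos hn', div_le_iff₀ hn']
  refine (Finset.abs_sum_le_sum_abs _ _).trans ?_
  calc _ ≤ ∑ u ∈ (Finset.Ioc s t).filter (fun u => a u = k), D := by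
        refine Finset.sum_le_sum fun u hu => ?_
        simp only [Finset.mem_filter, Finset.mem_Ioc] at hu
        exact h u hu.1.1 hu.1.2
    _ = D * pulls a k s t := by simp [pulls, mul_comm]

/-- The mean over the whole window is a convex combination of the means over its two parts. -/
lemma abs_empMean_sub_le_of_split {k : Fin K} {s v t : ℕ} (hsv : s ≤ v) (hvt : v ≤ t)
    (hn : 0 < pulls a k s v) :
    |empMean a x k s t - empMean a x k s v| ≤ |empMean a x k s v - empMean a x k v t| := by
  have h1 := pulls_mul_empMean (a := a) (x := x) (k := k) (s := s) (t := t)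
  have h2 := pulls_mul_empMean (a := a) (x := x) (k := k) (s := s) (t := v)
  have h3 := pulls_mul_empMean (a := a) (x := x) (k := k) (s := v) (t := t)
  have h4 : (∑ u ∈ (Finset.Ioc s t).filter (fun u => a u = k), x u) =
      (∑ u ∈ (Finset.Ioc s v).filter (fun u => a u = k), x u) +
        ∑ u ∈ (Finset.Ioc v t).filter (fun u => a u = k), x u := by
    rw [← Finset.Ioc_union_Ioc_eq_Ioc hsv hvt, Finset.filter_union, Finset.sum_union]
    apply Finset.disjoint_filter_filter
    rw [Finset.disjoint_left]
    intro w hw hw'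
    simp only [Finset.mem_Ioc] at hw hw'
    omega
  have h5 : (pulls a k s t : ℝ) = pulls a k s v + pulls a k v t := by
    exact_mod_cast pulls_add (a := a) (k := k) hsv hvt
  have hp : (0 : ℝ) < pulls a k s v := by exact_mod_cast hn
  have hq : (0 : ℝ) ≤ pulls a k v t := by positivity
  have h6 : empMean a x k s t - empMean a x k s v =
      -(pulls a k v t / (pulls a k s v + pulls a k v t) *
        (empMean a x k s v - empMean a x k v t)) := by
    rw [← h1, ← h2, ← h3, h5] at h4
    field_simp
    linarith
  rw [h6, abs_neg, abs_mul, abs_of_nonneg (by positivity)]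
  refine mul_le_of_le_one_left (abs_nonneg _) ?_
  rw [div_le_one (by positivity)]
  linarith

end Trajectory

section Drift

variable {K : ℕ} {δ b : ℝ} {a : ℕ → Fin K} {x : ℕ → ℝ} {m : ℕ → Fin K → ℝ} {N T : ℕ}
  {i : ℕ → ℕ → Fin K}

/-! ### Drift of the means between two resets -/

/-- No slot of `(s, t]` is a change point. -/
def NoChange (b : ℝ) (m : ℕ → Fin K → ℝ) (s t : ℕ) : Prop :=
  ∀ u, s < u → u ≤ t → ∀ k, |m (u + 1) k - m u k| ≤ b

lemma NoChange.mono {s t s' t' : ℕ} (h : NoChange b m s t) (hs : s ≤ s') (ht : t' ≤ t) :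
    NoChange b m s' t' :=
  fun u h1 h2 k => h u (by omega) (by omega) k

lemma NoChange.abs_sub_le {s t u v : ℕ} (h : NoChange b m s t) (hu : s < u) (huv : u ≤ v)
    (hv : v ≤ t + 1) (k : Fin K) : |m v k - m u k| ≤ b * (v - u) := by
  induction v, huv using Nat.le_induction with
  | base => simp
  | succ v huv ih =>
    have h1 := ih (by omega)
    have h2 := h v (by omega) (by omega) k
    have h3 : m (v + 1) k - m u k = (m (v + 1) k - m v k) + (m v k - m u k) := by ring
    rw [h3]
    refine (abs_add_le _ _).trans ?_
    push_cast
    linarith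

/-- The accumulated noise is uniformly below the detection threshold. -/
def Concentrated (γ : ℝ) (T : ℕ) (a : ℕ → Fin K) (x : ℕ → ℝ) (m : ℕ → Fin K → ℝ) : Prop :=
  ∀ k s t, t ≤ T → |noise a x m k s t| ≤ γ * Real.sqrt (3 / 2 * Real.log T * pulls a k s t)

lemma Concentrated.abs_noise_div_le {γ : ℝ} (h : Concentrated γ T a x m) {k : Fin K} {s t : ℕ}
    (ht : t ≤ T) (hn : 0 < pulls a k s t) :
    |noise a x m k s t / pulls a k s t| ≤
      γ * Real.sqrt (3 / 2 * Real.log T / pulls a k s t) := by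
  have hn' : (0 : ℝ) < pulls a k s t := by exact_mod_cast hn
  rw [abs_div, abs_of_pos hn', div_le_iff₀ hn']
  refine (h k s t ht).trans (le_of_eq ?_)
  have h0 : (0:ℝ) ≤ 3 / 2 * Real.log T := by positivity
  rw [Real.sqrt_mul h0, Real.sqrt_div h0]
  have h2 : Real.sqrt (pulls a k s t : ℝ) ≠ 0 := (Real.sqrt_pos.mpr hn').ne'
  field_simp
  rw [Real.sq_sqrt hn'.le]

/-- Half of `log (1 / δ)` is `3 / 2 * log T`, the constant in `Concentrated`; there `γ` measures the
noise as a fraction of the cut. -/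
lemma cut_eq (hδ : δ = 1 / (T : ℝ) ^ 3) (n₁ n₂ : ℕ) :
    cut δ n₁ n₂ = Real.sqrt (3 / 2 * Real.log T / n₁) + Real.sqrt (3 / 2 * Real.log T / n₂) := by
  have : Real.log (1 / δ) = 3 * Real.log T := by
    rw [hδ, one_div_one_div, Real.log_pow]; norm_num
  unfold cut
  rw [this]
  congr 2 <;> ring

lemma sqrt_div_le_sqrt_div {c : ℝ} (hc : 0 ≤ c) {w n : ℕ} (hw : 0 < w) (h : w ≤ n) :
    Real.sqrt (c / n) ≤ Real.sqrt (c / w) := by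
  apply Real.sqrt_le_sqrt
  apply div_le_div_of_nonneg_left hc
  · exact_mod_cast hw
  · exact_mod_cast h

lemma cut_le (hδ : δ = 1 / (T : ℝ) ^ 3) {w n₁ n₂ : ℕ} (hw : 0 < w) (h₁ : w ≤ n₁) (h₂ : w ≤ n₂) :
    cut δ n₁ n₂ ≤ 2 * Real.sqrt (3 / 2 * Real.log T / w) := by
  rw [cut_eq hδ]
  have h0 : (0:ℝ) ≤ 3 / 2 * Real.log T := by positivity
  linarith [sqrt_div_le_sqrt_div h0 hw h₁, sqrt_div_le_sqrt_div h0 hw h₂]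

/-- In a window of `K * w` slots inside block `l`, the monitoring arm of the previous block is pulled
at least `w` times. -/
lemma le_pulls_of_inBlock (hK : 1 ≤ K) (hrun : IsRun N δ a x i) {ρ l p q w : ℕ} (hl : 2 ≤ l)
    (hp : ρ + (2 ^ (l - 1) - 1) * (K * N) ≤ p) (hpq : p + K * w ≤ q)
    (hq : q ≤ ρ + (2 ^ l - 1) * (K * N)) (hρ : ∀ s, ρ < s → s ≤ q → lastReset δ a x s = ρ) :
    w ≤ pulls a (i ρ (l - 1)) p q := by
  -- The slots at multiples of `K` after `ρ`, beginning with the first one beyond `p`.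
  have hinj : Set.InjOn (fun j => ρ + ((p - ρ) / K + 1 + j) * K) (Finset.range w) := by
    intro j _ j' _ h
    have := Nat.eq_of_mul_eq_mul_right (by omega : 0 < K) (Nat.add_left_cancel h)
    omega
  have hmaps : Set.MapsTo (fun j => ρ + ((p - ρ) / K + 1 + j) * K) (Finset.range w)
      ((Finset.Ioc p q).filter (fun u => a u = i ρ (l - 1)) : Finset ℕ) := by
    intro j hj
    have hj : j < w := by simpa using hj
    have h1 := Nat.div_add_mod (p - ρ) K
    have h2 := Nat.mod_lt (p - ρ) (by omega : K > 0)
    have h3 : (j + 1) * K ≤ w * K := Nat.mul_le_mul_right _ hj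
    have e : ((p - ρ) / K + 1 + j) * K = K * ((p - ρ) / K) + (j + 1) * K := by ring
    have e2 : (j + 1) * K = j * K + K := by ring
    have e3 : w * K = K * w := mul_comm _ _
    have hpρ : ρ ≤ p := by omega
    have hm1 : p < ρ + ((p - ρ) / K + 1 + j) * K := by rw [e]; omega
    have hm2 : ρ + ((p - ρ) / K + 1 + j) * K ≤ q := by rw [e]; omega
    simp only [Finset.coe_filter, Finset.mem_Ioc, Set.mem_ofPred_eq]
    refine ⟨⟨hm1, hm2⟩, ?_⟩
    have hr := hρ _ (lt_of_le_of_lt hpρ hm1) hm2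
    have h4 := hrun.monitor_prev (ρ + ((p - ρ) / K + 1 + j) * K) l (by omega)
    rw [hr] at h4
    apply h4
    rw [Nat.add_sub_cancel_left]
    exact ⟨⟨by omega, by omega, by omega⟩, hl, Nat.mul_mod_left _ _⟩
  have := Finset.card_le_card_of_injOn _ hmaps hinj
  simpa [pulls] using this

/-- Without a detection, the mean of the monitoring arm stays, late in the block, close to its
empirical mean at an early time. -/
lemma abs_mean_sub_empMean_le (hK : 1 ≤ K) (hδ : δ = 1 / (T : ℝ) ^ 3) {γ : ℝ} (hγ : γ ≤ 1)
    (hrun : IsRun N δ a x i) (hconc : Concentrated γ T a x m)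
    {ρ l t w : ℕ} (hw : 0 < w) (hl : 2 ≤ l) (hb : 0 ≤ b)
    (ht : ρ + (2 ^ (l - 1) - 1) * (K * N) + 3 * (K * w) ≤ t)
    (ht' : t ≤ ρ + (2 ^ l - 1) * (K * N)) (htT : t ≤ T)
    (hρ : ∀ s, ρ < s → s ≤ t → lastReset δ a x s = ρ)
    (hdet : ∀ s, ρ < s → s ≤ t → ¬ Detects δ a x ρ s) (hnc : NoChange b m ρ t) :
    |m t (i ρ (l - 1)) - empMean a x (i ρ (l - 1)) ρ (ρ + (2 ^ (l - 1) - 1) * (K * N) + K * w)| ≤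
      5 * Real.sqrt (3 / 2 * Real.log T / w) + b * (K * w) := by
  set k := i ρ (l - 1)
  set σ := ρ + (2 ^ (l - 1) - 1) * (K * N) with hσ
  set c := Real.sqrt (3 / 2 * Real.log T / w) with hc
  have h0 : (0:ℝ) ≤ 3 / 2 * Real.log T := by positivity
  have hKw : 0 < K * w := Nat.mul_pos hK hw
  -- Three windows with at least `w` pulls each: up to `σ + K * w`, from there to `y`, and the last
  -- `K * w` slots. No detection at `y` and none at `t` give `2 * c` each; `d3` replaces the mean
  -- over all slots up to `y` by the reference mean. The fifth `c` is the noise of the last window.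
  set y := t - K * w with hy
  have hρ' : ∀ q, q ≤ t → ∀ s, ρ < s → s ≤ q → lastReset δ a x s = ρ :=
    fun q hq s h1 h2 => hρ s h1 (h2.trans hq)
  have n1 : w ≤ pulls a k ρ (σ + K * w) :=
    (le_pulls_of_inBlock hK hrun (p := σ) hl hσ.ge le_rfl (by omega) (hρ' _ (by omega))).trans
      (pulls_mono (by omega) le_rfl)
  have n2 : w ≤ pulls a k (σ + K * w) y :=
    le_pulls_of_inBlock hK hrun hl (by omega) (by omega) (by omega) (hρ' _ (by omega))
  have n3 : w ≤ pulls a k y t :=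
    le_pulls_of_inBlock hK hrun hl (by omega) (by omega) (by omega) (hρ' _ (by omega))
  have n4 : w ≤ pulls a k ρ y := n2.trans (pulls_mono (by omega) le_rfl)
  have d1 : |empMean a x k ρ (σ + K * w) - empMean a x k (σ + K * w) y| ≤ 2 * c := by
    by_contra hcon
    push Not at hcon
    exact hdet y (by omega) (by omega) ⟨k, σ + K * w, by omega, by omega, by omega, by omega,
      (cut_le hδ hw n1 n2).trans hcon.le⟩
  have d2 : |empMean a x k ρ y - empMean a x k y t| ≤ 2 * c := by
    by_contra hcon
    push Not at hcon
    exact hdet t (by omega) (by omega) ⟨k, y, by omega, by omega, by omega, by omega,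
      (cut_le hδ hw n4 n3).trans hcon.le⟩
  have d3 := (abs_empMean_sub_le_of_split (a := a) (x := x) (k := k) (s := ρ) (v := σ + K * w)
    (t := y) (by omega) (by omega) (by omega)).trans d1
  have d4 : |noise a x m k y t / pulls a k y t| ≤ c := by
    refine (hconc.abs_noise_div_le htT (by omega)).trans ?_
    refine (mul_le_of_le_one_left (Real.sqrt_nonneg _) hγ).trans ?_
    exact sqrt_div_le_sqrt_div h0 hw n3
  have d5 : |empMean a x k y t - m t k - noise a x m k y t / pulls a k y t| ≤ b * (K * w) := by
    refine abs_empMean_sub_sub_le (by omega) fun u hu hu' => ?_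
    rw [abs_sub_comm]
    refine (hnc.abs_sub_le (by omega) hu' (by omega) k).trans ?_
    refine mul_le_mul_of_nonneg_left ?_ hb
    have : (t : ℝ) ≤ K * w + u := by exact_mod_cast (by omega : t ≤ K * w + u)
    linarith
  rw [abs_le] at *
  constructor <;> linarith [d2.1, d2.2, d3.1, d3.2, d4.1, d4.2, d5.1, d5.2]

/-- Variation of the means within one block. -/
noncomputable def blockVar (b c : ℝ) (K T w : ℕ) : ℝ :=
  3 * (b * (K * w)) + 2 / c * (5 * Real.sqrt (3 / 2 * Real.log T / w) + b * (K * w)) + b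

/-- The monitoring arm stays close to one fixed empirical mean, so it moves little; the globally
gradual assumption extends this to every arm at the price `1 / c`. The first `3 * (K * w)` slots of
the block are too few for this comparison and pay the drift `b` per slot. The parameter `w` is free
and not tied to `N`. -/
lemma abs_mean_sub_blockStart_le (hK : 1 ≤ K) (hδ : δ = 1 / (T : ℝ) ^ 3) {γ c : ℝ} (hγ : γ ≤ 1)
    (hc : 0 < c) (hrun : IsRun N δ a x i) (hconc : Concentrated γ T a x m)
    (hgg : GloballyGradual b T c m)
    {ρ l t w : ℕ} (hw : 0 < w) (hl : 2 ≤ l) (hb : 0 ≤ b)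
    (ht : ρ + (2 ^ (l - 1) - 1) * (K * N) < t)
    (ht' : t ≤ ρ + (2 ^ l - 1) * (K * N)) (htT : t < T)
    (hρ : ∀ s, ρ < s → s ≤ t → lastReset δ a x s = ρ)
    (hdet : ∀ s, ρ < s → s ≤ t → ¬ Detects δ a x ρ s) (hnc : NoChange b m ρ t) (k : Fin K)
    (hpos : 0 < (2 ^ (l - 1) - 1) * (K * N)) :
    |m t k - m (ρ + (2 ^ (l - 1) - 1) * (K * N)) k| ≤ blockVar b c K T w := by
  set σ := ρ + (2 ^ (l - 1) - 1) * (K * N) with hσ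
  set θ := 5 * Real.sqrt (3 / 2 * Real.log T / w) + b * (K * w) with hθ
  have hθ0 : 0 ≤ θ := by positivity
  unfold blockVar
  rw [← hθ]
  rcases le_total t (σ + 3 * (K * w)) with h | h
  · have h1 := hnc.abs_sub_le (u := σ) (v := t) (by omega) (by omega) (by omega) k
    refine h1.trans ?_
    have h2 : (t : ℝ) ≤ σ + 3 * (K * w) := by exact_mod_cast h
    have h3 : b * (t - σ) ≤ b * (3 * (K * w)) := mul_le_mul_of_nonneg_left (by linarith) hb
    have h4 : 0 ≤ 2 / c * θ := by positivity
    linarith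
  · set t₀ := σ + 3 * (K * w) with ht₀
    have e1 := abs_mean_sub_empMean_le hK hδ hγ hrun hconc hw hl hb h ht' htT.le hρ hdet hnc
    have e2 := abs_mean_sub_empMean_le (t := t₀) hK hδ hγ hrun hconc hw hl hb le_rfl (by omega)
      (by omega) (fun s h1 h2 => hρ s h1 (by omega)) (fun s h1 h2 => hdet s h1 (by omega))
      (hnc.mono le_rfl h)
    have e3 := hgg t₀ t (by omega) h htT (fun u h1 h2 k => hnc u (by omega) h2 k)
      (i ρ (l - 1)) k
    have e4 : |m t (i ρ (l - 1)) - m t₀ (i ρ (l - 1))| ≤ 2 * θ := by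
      rw [← hθ] at e1 e2
      rw [abs_le] at *
      constructor <;> linarith [e1.1, e1.2, e2.1, e2.2]
    have e5 : |m t k - m t₀ k| ≤ 2 / c * θ := by
      rw [div_mul_eq_mul_div, le_div_iff₀ hc]
      linarith
    have e6 := hnc.abs_sub_le (u := σ) (v := t₀) (by omega) (by omega) (by omega) k
    have e7 : ((t₀ : ℕ) : ℝ) = σ + 3 * (K * w) := by rw [ht₀]; push_cast; ring
    rw [e7] at e6
    have e8 : m t k - m σ k = (m t k - m t₀ k) + (m t₀ k - m σ k) := by ring
    rw [e8]
    refine (abs_add_le _ _).trans ?_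
    nlinarith

lemma exists_inBlock (hK : 1 ≤ K) (hN : 1 ≤ N) {τ : ℕ} (hτ : 1 ≤ τ) :
    ∃ l, InBlock K N l τ := by
  have hKN : 1 ≤ K * N := Nat.mul_pos hK hN
  have hex : ∃ l, τ ≤ (2 ^ l - 1) * (K * N) := by
    refine ⟨τ, ?_⟩
    have : τ < 2 ^ τ := Nat.lt_two_pow_self
    calc τ ≤ 2 ^ τ - 1 := by omega
      _ ≤ _ := Nat.le_mul_of_pos_right _ hKN
  classical
  refine ⟨Nat.find hex, ?_, ?_, Nat.find_spec hex⟩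
  · by_contra h
    have h0 : Nat.find hex = 0 := by omega
    have := Nat.find_spec hex
    rw [h0] at this
    simp at this
    omega
  · have hne : Nat.find hex ≠ 0 := by
      intro h0
      have := Nat.find_spec hex
      rw [h0] at this
      simp at this
      omega
    have := Nat.find_min hex (m := Nat.find hex - 1) (by omega)
    omega

/-- Induction over blocks, each adding one block variation. The first block has no monitoring and
pays `b` in each of its `K * N` slots. -/
lemma abs_mean_sub_firstSlot_le (hK : 1 ≤ K) (hN : 1 ≤ N) (hδ : δ = 1 / (T : ℝ) ^ 3) {γ c : ℝ}
    (hγ : γ ≤ 1) (hc : 0 < c) (hrun : IsRun N δ a x i) (hconc : Concentrated γ T a x m)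
    (hgg : GloballyGradual b T c m) {ρ w : ℕ} (hw : 0 < w) (hb : 0 ≤ b) (l : ℕ) (hl : 1 ≤ l) :
    ∀ t, InBlock K N l (t - ρ) → t < T →
    (∀ s, ρ < s → s ≤ t → lastReset δ a x s = ρ) →
    (∀ s, ρ < s → s ≤ t → ¬ Detects δ a x ρ s) → NoChange b m ρ t → ∀ k,
    |m t k - m (ρ + 1) k| ≤ b * (K * N) + (l - 1) * blockVar b c K T w := by
  have hKN : 1 ≤ K * N := Nat.mul_pos hK hN
  induction l, hl using Nat.le_induction with
  | base =>
    rintro t ⟨_, h1, h2⟩ htT hρ hdet hnc k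
    simp at h1 h2
    refine (hnc.abs_sub_le (u := ρ + 1) (v := t) (by omega) (by omega) (by omega) k).trans ?_
    have : (t : ℝ) ≤ ρ + K * N := by exact_mod_cast (by omega : t ≤ ρ + K * N)
    push_cast
    have h3 := mul_le_mul_of_nonneg_left (by linarith : (t:ℝ) - (ρ + 1) ≤ K * N) hb
    linarith
  | succ l hl ih =>
    rintro t ⟨_, h1, h2⟩ htT hρ hdet hnc k
    rw [Nat.add_sub_cancel] at h1
    have hp : 2 ≤ 2 ^ l := by
      calc 2 = 2 ^ 1 := rfl
        _ ≤ 2 ^ l := Nat.pow_le_pow_right (by norm_num) hl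
    have hp2 : 2 ^ (l - 1) < 2 ^ l := Nat.pow_lt_pow_right (by norm_num) (by omega)
    have hpos : 0 < (2 ^ l - 1) * (K * N) := Nat.mul_pos (by omega) hKN
    have hblock : InBlock K N l (ρ + (2 ^ l - 1) * (K * N) - ρ) := by
      refine ⟨hl, ?_, by omega⟩
      rw [Nat.add_sub_cancel_left]
      have := Nat.one_le_two_pow (n := l - 1)
      exact Nat.mul_lt_mul_of_pos_right (by omega) hKN
    have e1 := ih (ρ + (2 ^ l - 1) * (K * N)) hblock (by omega)
      (fun s h3 h4 => hρ s h3 (by omega)) (fun s h3 h4 => hdet s h3 (by omega))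
      (hnc.mono le_rfl (by omega)) k
    have e2 := abs_mean_sub_blockStart_le hK hδ hγ hc hrun hconc hgg (ρ := ρ) (l := l + 1) (t := t)
      hw (by omega) hb (by rw [Nat.add_sub_cancel]; omega) (by omega) htT hρ hdet hnc k
      (by simpa using hpos)
    rw [Nat.add_sub_cancel] at e2
    have e3 : m t k - m (ρ + 1) k = (m t k - m (ρ + (2 ^ l - 1) * (K * N)) k) +
      (m (ρ + (2 ^ l - 1) * (K * N)) k - m (ρ + 1) k) := by ring
    rw [e3]
    refine (abs_add_le _ _).trans ?_
    push_cast
    linarith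

/-- Bound on the variation of the means between two resets. -/
noncomputable def maxDrift (b c : ℝ) (K N T w : ℕ) : ℝ :=
  2 * (b * (K * N) + Real.log T / Real.log 2 * blockVar b c K T w + b)

lemma blockVar_nonneg {c : ℝ} {w : ℕ} (hb : 0 ≤ b) (hc : 0 < c) : 0 ≤ blockVar b c K T w := by
  unfold blockVar
  positivity

/-- Block lengths double, so only logarithmically many blocks fit into the horizon. -/
lemma InBlock.le_log {l τ : ℕ} (hK : 1 ≤ K) (hN : 1 ≤ N) (h : InBlock K N l τ) (hτ : τ ≤ T) :
    (l : ℝ) - 1 ≤ Real.log T / Real.log 2 := by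
  obtain ⟨h1, h2, -⟩ := h
  have hKN : 1 ≤ K * N := Nat.mul_pos hK hN
  have h3 : 2 ^ (l - 1) - 1 < T := by
    calc 2 ^ (l - 1) - 1 ≤ (2 ^ (l - 1) - 1) * (K * N) := Nat.le_mul_of_pos_right _ hKN
      _ < T := by omega
  have h4 : 2 ^ (l - 1) ≤ T := by omega
  rw [le_div_iff₀ (Real.log_pos (by norm_num))]
  have h5 : ((l : ℝ) - 1) * Real.log 2 = Real.log ((2 : ℝ) ^ (l - 1)) := by
    rw [Real.log_pow, Nat.cast_sub h1]; simp
  rw [h5]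
  exact Real.log_le_log (by positivity) (by exact_mod_cast h4)

/-- Two slots between which there is neither a reset nor a change point have similar means. -/
lemma abs_mean_sub_mean_le_maxDrift (hK : 1 ≤ K) (hN : 1 ≤ N) (hδ : δ = 1 / (T : ℝ) ^ 3) {γ c : ℝ}
    (hγ : γ ≤ 1) (hc : 0 < c) (hrun : IsRun N δ a x i) (hconc : Concentrated γ T a x m)
    (hgg : GloballyGradual b T c m) {w t : ℕ} (hw : 0 < w) (hb : 0 ≤ b) (htT : t ≤ T)
    (hnc : NoChange b m (lastReset δ a x t) (t - 1)) {u v : ℕ} (hu : lastReset δ a x t < u)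
    (hut : u ≤ t) (hv : lastReset δ a x t < v) (hvt : v ≤ t) (k : Fin K) :
    |m u k - m v k| ≤ maxDrift b c K N T w := by
  set ρ := lastReset δ a x t with hρ
  have hbv := blockVar_nonneg (K := K) (T := T) (w := w) hb hc
  have key : ∀ u, ρ < u → u ≤ t → |m u k - m (ρ + 1) k| ≤
      b * (K * N) + Real.log T / Real.log 2 * blockVar b c K T w + b := by
    -- Absence of detection is known only strictly before `t`, and the globally gradual property
    -- only before `T`; the slot `t` itself is reached by one more step of size `b`.
    have key' : ∀ u, ρ < u → u < t → |m u k - m (ρ + 1) k| ≤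
        b * (K * N) + Real.log T / Real.log 2 * blockVar b c K T w := by
      intro u hu hut
      obtain ⟨l, hl⟩ := exists_inBlock (K := K) (N := N) hK hN (τ := u - ρ) (by omega)
      have h1 := abs_mean_sub_firstSlot_le hK hN hδ hγ hc hrun hconc hgg hw hb l hl.1 u hl
        (by omega) (fun s h1 h2 => by rw [hρ]; exact lastReset_eq_of_lt h1 (by omega))
        (fun s h1 h2 => not_detects_of_lt h1 (by omega)) (hnc.mono le_rfl (by omega)) k
      have h2 := mul_le_mul_of_nonneg_right (hl.le_log hK hN (by omega : u - ρ ≤ T)) hbv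
      linarith
    intro u hu hut
    rcases Nat.eq_or_lt_of_le hu with h | h
    · rw [← h]
      simp only [Nat.succ_eq_add_one, sub_self, abs_zero]
      positivity
    · have h1 := key' (u - 1) (by omega) (by omega)
      have h2 := hnc (u - 1) (by omega) (by omega) k
      rw [show u - 1 + 1 = u by omega] at h2
      rw [abs_le] at *
      constructor <;> linarith [h1.1, h1.2, h2.1, h2.2]
  have h1 := key u hu hut
  have h2 := key v hv hvt
  unfold maxDrift
  rw [abs_le] at *
  constructor <;> linarith [h1.1, h1.2, h2.1, h2.2]

end Drift

section SlotRegret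

variable {K : ℕ} {δ b : ℝ} {a : ℕ → Fin K} {x : ℕ → ℝ} {m : ℕ → Fin K → ℝ} {N T : ℕ}
  {i : ℕ → ℕ → Fin K}

/-! ### Regret in a single slot -/

/-- The UCB index, in the `τ`-th slot after `ρ`, underestimates the mean of some arm. -/
def Fails (a : ℕ → Fin K) (x : ℕ → ℝ) (m : ℕ → Fin K → ℝ) (ρ τ : ℕ) : Prop :=
  ∃ k, 0 < pulls a k ρ (ρ + τ - 1) ∧
    noise a x m k ρ (ρ + τ - 1) < -Real.sqrt (2 * Real.log τ * pulls a k ρ (ρ + τ - 1))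

open Classical in
/-- Number of slots after `ρ`, up to the `T`-th one, in which some UCB index underestimates. -/
noncomputable def failCount (a : ℕ → Fin K) (x : ℕ → ℝ) (m : ℕ → Fin K → ℝ) (T ρ : ℕ) : ℕ :=
  ((Finset.Icc 1 T).filter (fun τ => Fails a x m ρ τ)).card

lemma reg_le_iff {t : ℕ} {y : ℝ} : reg m a t ≤ y ↔ ∀ j, m t j - m t (a t) ≤ y := by
  have : Nonempty (Fin K) := ⟨a t⟩
  unfold reg
  rw [sub_le_iff_le_add, ciSup_le_iff (Set.finite_range _).bddAbove]
  exact forall_congr' fun j => by rw [sub_le_iff_le_add]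

lemma sqrt_mul_div_self {c n : ℝ} (hc : 0 ≤ c) (hn : 0 < n) :
    Real.sqrt (c * n) / n = Real.sqrt (c / n) := by
  rw [Real.sqrt_mul hc, Real.sqrt_div hc]
  have h2 : Real.sqrt n ≠ 0 := (Real.sqrt_pos.mpr hn).ne'
  field_simp
  rw [Real.sq_sqrt hn.le]

/-- The UCB argument with drift. Optimism for the competitor `j` comes from the absence of failure:
its bonus involves `log τ`, so `Concentrated`, which is at the scale `log T`, would not give it.
`Concentrated` bounds the overestimation of the pulled arm, where `log T` is affordable. -/
lemma reg_le_of_explore {γ : ℝ} (hγ : γ ≤ 1) (hrun : IsRun N δ a x i)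
    (hconc : Concentrated γ T a x m) {t : ℕ} (ht : 1 ≤ t) (htT : t ≤ T) {D : ℝ}
    (hD : ∀ u, lastReset δ a x t < u → u ≤ t → ∀ k, |m u k - m t k| ≤ D)
    (hmon : ¬ IsMonitoring K N (t - lastReset δ a x t))
    (hfail : ¬ Fails a x m (lastReset δ a x t) (t - lastReset δ a x t))
    (hn : 0 < pulls a (a t) (lastReset δ a x t) (t - 1)) :
    reg m a t ≤
      2 * D + 2 * Real.sqrt (2 * Real.log T / pulls a (a t) (lastReset δ a x t) (t - 1)) := by
  have hlt := lastReset_lt (δ := δ) (a := a) (x := x) ht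
  set ρ := lastReset δ a x t with hρ
  rw [reg_le_iff]
  intro j
  have hch := (hrun.explore t ht hmon).resolve_left hn.ne' j
  obtain ⟨hj, hidx⟩ := hch
  unfold ucbIndex at hidx
  have h1 : ρ + (t - ρ) - 1 = t - 1 := by omega
  have hnf : -Real.sqrt (2 * Real.log (t - ρ : ℕ) * pulls a j ρ (t - 1)) ≤
      noise a x m j ρ (t - 1) := by
    by_contra hcon
    push Not at hcon
    exact hfail ⟨j, by rw [h1]; exact hj, by rw [h1]; exact hcon⟩
  have hj' : (0 : ℝ) < pulls a j ρ (t - 1) := by exact_mod_cast hj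
  have hn' : (0 : ℝ) < pulls a (a t) ρ (t - 1) := by exact_mod_cast hn
  have hlog : (0 : ℝ) ≤ 2 * Real.log (t - ρ : ℕ) := by positivity
  have e1 : -Real.sqrt (2 * Real.log (t - ρ : ℕ) / pulls a j ρ (t - 1)) ≤
      noise a x m j ρ (t - 1) / pulls a j ρ (t - 1) := by
    rw [← sqrt_mul_div_self hlog hj', ← neg_div]
    exact div_le_div_of_nonneg_right hnf hj'.le
  have e2 := abs_empMean_sub_sub_le (x := x) hj
    (fun u h2 h3 => hD u h2 (by omega) j)
  have e3 := abs_empMean_sub_sub_le (x := x) hn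
    (fun u h2 h3 => hD u h2 (by omega) (a t))
  have hlogT : (0 : ℝ) ≤ Real.log T := by positivity
  have e4 : |noise a x m (a t) ρ (t - 1) / pulls a (a t) ρ (t - 1)| ≤
      Real.sqrt (2 * Real.log T / pulls a (a t) ρ (t - 1)) := by
    refine (hconc.abs_noise_div_le (by omega) hn).trans ?_
    refine (mul_le_of_le_one_left (Real.sqrt_nonneg _) hγ).trans ?_
    apply Real.sqrt_le_sqrt
    apply div_le_div_of_nonneg_right _ hn'.le
    linarith
  have e5 : Real.sqrt (2 * Real.log (t - ρ : ℕ) / pulls a (a t) ρ (t - 1)) ≤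
      Real.sqrt (2 * Real.log T / pulls a (a t) ρ (t - 1)) := by
    apply Real.sqrt_le_sqrt
    apply div_le_div_of_nonneg_right _ hn'.le
    have : Real.log (t - ρ : ℕ) ≤ Real.log T :=
      Real.log_le_log (by exact_mod_cast (by omega : 0 < t - ρ)) (by exact_mod_cast (by omega))
    linarith
  rw [abs_le] at e2 e3 e4
  linarith [e2.1, e2.2, e3.1, e3.2, e4.1, e4.2]

/-- If few slots fail, then among the exploratory pulls of an arm there is one that does not fail
and that comes after many other pulls. -/
lemma exists_explore_not_fails {ρ S : ℕ} {k : Fin K} (hS : S ≤ T)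
    (h : 2 * failCount a x m T ρ + 2 ≤ exploreCount N a ρ S k) :
    ∃ u, ρ < u ∧ u ≤ ρ + S ∧ ¬ IsMonitoring K N (u - ρ) ∧ a u = k ∧ ¬ Fails a x m ρ (u - ρ) ∧
      exploreCount N a ρ S k ≤ 2 * pulls a k ρ (u - 1) := by
  classical
  by_contra hcon
  push Not at hcon
  set e := exploreCount N a ρ S k with he
  set U := (Finset.Ioc ρ (ρ + S)).filter (fun u => ¬ IsMonitoring K N (u - ρ) ∧ a u = k) with hU
  have heU : U.card = e := by rw [he, exploreCount, hU]
  have hmem : ∀ u ∈ U, (ρ < u ∧ u ≤ ρ + S) ∧ ¬ IsMonitoring K N (u - ρ) ∧ a u = k := by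
    intro u hu; simpa [hU] using hu
  have h1 : (U.filter (fun u => Fails a x m ρ (u - ρ))).card ≤ failCount a x m T ρ := by
    unfold failCount
    refine Finset.card_le_card_of_injOn (fun u => u - ρ) ?_ ?_
    · intro u hu
      have hu' := Finset.mem_filter.mp (Finset.mem_coe.mp hu)
      have := hmem u hu'.1
      simp only [Finset.coe_filter, Finset.mem_Icc, Set.mem_ofPred_eq]
      exact ⟨⟨by omega, by omega⟩, hu'.2⟩
    · intro u hu v hv huv
      have hu' := hmem u (Finset.mem_filter.mp (Finset.mem_coe.mp hu)).1
      have hv' := hmem v (Finset.mem_filter.mp (Finset.mem_coe.mp hv)).1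
      simp only at huv
      omega
  -- Earlier-pull counts are distinct, so at most half of the pulls, rounded up, come early.
  -- Together with the failing ones they cannot exhaust all `e` pulls once `e` is at least twice the
  -- number of failures plus 2.
  have h2 : (U.filter (fun u => 2 * pulls a k ρ (u - 1) < e)).card ≤ (e + 1) / 2 := by
    rw [← Finset.card_range ((e + 1) / 2)]
    refine Finset.card_le_card_of_injOn (fun u => pulls a k ρ (u - 1)) ?_ ?_
    · intro u hu
      have hu' := Finset.mem_filter.mp (Finset.mem_coe.mp hu)
      simp only [Finset.coe_range, Set.mem_Iio]
      have := hu'.2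
      omega
    · intro u hu v hv huv
      have hu' := hmem u (Finset.mem_filter.mp (Finset.mem_coe.mp hu)).1
      have hv' := hmem v (Finset.mem_filter.mp (Finset.mem_coe.mp hv)).1
      exact pulls_injOn k ρ ⟨hu'.1.1, hu'.2.2⟩ ⟨hv'.1.1, hv'.2.2⟩ huv
  have h3 : U ⊆ U.filter (fun u => Fails a x m ρ (u - ρ)) ∪
      U.filter (fun u => 2 * pulls a k ρ (u - 1) < e) := by
    intro u hu
    rw [Finset.mem_union]
    by_cases hf : Fails a x m ρ (u - ρ)
    · exact Or.inl (Finset.mem_filter.mpr ⟨hu, hf⟩)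
    · have := hmem u hu
      exact Or.inr (Finset.mem_filter.mpr
        ⟨hu, hcon u this.1.1 this.1.2 this.2.1 this.2.2 hf⟩)
  have h4 := (Finset.card_le_card h3).trans (Finset.card_union_le _ _)
  omega

lemma selTime_one : selTime K N 1 = K * N := by simp [selTime]

/-- Slots in the first subblocks of block `l` that follow a multiple of `K` are not monitoring. -/
lemma not_isMonitoring_of_mod {l τ : ℕ}
    (h1 : (2 ^ (l - 1) - 1) * (K * N) < τ) (h2 : τ ≤ selTime K N l) (hτ : τ % K = 1) :
    ¬ IsMonitoring K N τ := by
  rintro ⟨l', ⟨-, -, h⟩ | ⟨⟨h3, h4, h5⟩, hl', -, h6⟩⟩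
  · omega
  · rcases Nat.lt_or_ge l' l with h | h
    · have : 2 ^ l' ≤ 2 ^ (l - 1) := Nat.pow_le_pow_right (by norm_num) (by omega)
      have : (2 ^ l' - 1) * (K * N) ≤ (2 ^ (l - 1) - 1) * (K * N) :=
        Nat.mul_le_mul_right _ (by omega)
      omega
    · have h7 : selTime K N l ≤ (2 ^ l' - 2) * (K * N) := by
        unfold selTime
        have h8 : 2 ^ 2 ≤ 2 ^ l' := Nat.pow_le_pow_right (by norm_num) hl'
        have h9 : 2 ^ l ≤ 2 ^ l' := Nat.pow_le_pow_right (by norm_num) h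
        split_ifs with h0
        · exact Nat.le_mul_of_pos_left _ (by omega)
        · exact Nat.mul_le_mul_right _ (by omega)
      omega

/-- In the current block before the selection, every slot of residue 1 modulo `K` is exploratory.
This stretch makes up at least half of the time since the reset. -/
lemma selTime_le_card_explore (hK : 2 ≤ K) {l ρ : ℕ} (hl : 1 ≤ l) :
    selTime K N l ≤ 2 * K * ∑ k, exploreCount N a ρ (selTime K N l) k := by
  classical
  have hsum : ∑ k, exploreCount N a ρ (selTime K N l) k =
      ((Finset.Ioc ρ (ρ + selTime K N l)).filter (fun u => ¬ IsMonitoring K N (u - ρ))).card := by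
    rw [Finset.card_eq_sum_card_fiberwise (f := a) (t := Finset.univ) (fun _ _ => by simp)]
    refine Finset.sum_congr rfl fun k _ => ?_
    rw [exploreCount, Finset.filter_filter]
  -- In units of `K * N`: `A` is the time before block `l`, and `B` the part of block `l` before the
  -- selection.
  obtain ⟨A, B, hA, hAB, hS⟩ : ∃ A B, A * (K * N) = (2 ^ (l - 1) - 1) * (K * N) ∧
      (A + B) * (K * N) = selTime K N l ∧ A + B ≤ 2 * B := by
    rcases Nat.eq_or_lt_of_le hl with rfl | h
    · exact ⟨0, 1, by simp, by simp [selTime_one], by norm_num⟩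
    · refine ⟨2 ^ (l - 1) - 1, 2 ^ (l - 1) - 1, rfl, ?_, by omega⟩
      rw [selTime, if_neg (by omega)]
      congr 1
      have : 2 ^ l = 2 * 2 ^ (l - 1) := by rw [← pow_succ']; congr 1; omega
      omega
  have hcard : B * N ≤ ∑ k, exploreCount N a ρ (selTime K N l) k := by
    rw [hsum, ← Finset.card_range (B * N)]
    refine Finset.card_le_card_of_injOn (fun j => ρ + ((A * N + j) * K + 1)) ?_ ?_
    · intro j hj
      have hj : j < B * N := by simpa using hj
      have h1 : A * (K * N) < (A * N + j) * K + 1 := by nlinarith [Nat.zero_le (j * K)]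
      have h2 : (A * N + j) * K + 1 ≤ (A + B) * (K * N) := by nlinarith
      simp only [Finset.coe_filter, Finset.mem_Ioc, Set.mem_ofPred_eq]
      refine ⟨⟨by omega, by omega⟩, ?_⟩
      rw [Nat.add_sub_cancel_left]
      refine not_isMonitoring_of_mod (l := l) (by omega) (by omega) ?_
      rw [Nat.mul_add_mod_self_right]
      exact Nat.mod_eq_of_lt (by omega)
    · intro j _ j' _ h
      simp only [Nat.add_right_cancel_iff, Nat.add_left_cancel_iff] at h
      have := Nat.eq_of_mul_eq_mul_right (by omega : 0 < K) h
      omega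
  calc selTime K N l = (A + B) * (K * N) := hAB.symm
    _ ≤ 2 * B * (K * N) := Nat.mul_le_mul_right _ hS
    _ = 2 * K * (B * N) := by ring
    _ ≤ _ := Nat.mul_le_mul_left _ hcard

/-- Pigeonhole: the most explored of `K` arms has at least a `1 / K` share of the exploratory pulls.
-/
lemma selTime_le_exploreCount (hK : 2 ≤ K) (hrun : IsRun N δ a x i) {l ρ : ℕ} (hl : 1 ≤ l) :
    selTime K N l ≤ 2 * K ^ 2 * exploreCount N a ρ (selTime K N l) (i ρ l) := by
  refine (selTime_le_card_explore (a := a) (ρ := ρ) hK hl).trans ?_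
  have : ∑ k, exploreCount N a ρ (selTime K N l) k ≤
      ∑ _k : Fin K, exploreCount N a ρ (selTime K N l) (i ρ l) :=
    Finset.sum_le_sum fun k _ => hrun.select ρ l hl k
  rw [Finset.sum_const, Finset.card_univ, Fintype.card_fin, smul_eq_mul] at this
  calc _ ≤ 2 * K * (K * exploreCount N a ρ (selTime K N l) (i ρ l)) := Nat.mul_le_mul_left _ this
    _ = _ := by ring

/-- A monitoring slot pulls an arm that was selected not long before. -/
lemma exists_selTime_of_isMonitoring (hK : 1 ≤ K) (hN : 1 ≤ N) (hrun : IsRun N δ a x i) {t : ℕ}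
    (ht : 1 ≤ t) (hmon : IsMonitoring K N (t - lastReset δ a x t)) :
    ∃ l, 1 ≤ l ∧ a t = i (lastReset δ a x t) l ∧ selTime K N l < t - lastReset δ a x t ∧
      t - lastReset δ a x t ≤ 4 * selTime K N l := by
  have hKN : 1 ≤ K * N := Nat.mul_pos hK hN
  obtain ⟨l, h | h⟩ := hmon
  · have ha := hrun.monitor_prev t l ht h
    obtain ⟨⟨h1, h2, h3⟩, hl, -⟩ := h
    refine ⟨l - 1, by omega, ha, ?_, ?_⟩
    · refine lt_of_le_of_lt ?_ h2
      unfold selTime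
      split_ifs with h0
      · have : l = 2 := by omega
        subst this
        simp
      · exact Nat.mul_le_mul_right _ (by omega)
    · refine h3.trans ?_
      unfold selTime
      split_ifs with h0
      · have : l = 2 := by omega
        subst this
        omega
      -- The tightest case is `l = 3`: the block ends at `7 * (K * N)`, while the arm of block 2 was
      -- selected at `2 * (K * N)`.
      · rw [← mul_assoc 4]
        refine Nat.mul_le_mul_right _ ?_
        have h4 : 2 ^ 2 ≤ 2 ^ (l - 1) := Nat.pow_le_pow_right (by norm_num) (by omega)
        have : 2 ^ l = 2 * 2 ^ (l - 1) := by rw [← pow_succ']; congr 1; omega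
        omega
  · have ha := hrun.monitor_new t l ht h
    obtain ⟨⟨h1, h2, h3⟩, hl, -, h5⟩ := h
    refine ⟨l, h1, ha, ?_, ?_⟩
    · rw [selTime, if_neg (by omega)]
      omega
    · refine h3.trans ?_
      rw [selTime, if_neg (by omega), ← mul_assoc 4]
      refine Nat.mul_le_mul_right _ ?_
      have h4 : 2 ^ 2 ≤ 2 ^ l := Nat.pow_le_pow_right (by norm_num) (by omega)
      omega

/-- The selected arm has a number of exploratory pulls proportional to the elapsed time. If failures
are few in comparison, some late pull of it was a sound UCB choice, and its small regret there is
carried to `t` by the drift bound. Otherwise the elapsed time is of the order of the number of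
failures, and the trivial bound `α` is absorbed by the last term. -/
lemma reg_le_of_isMonitoring {γ α : ℝ} (hγ : γ ≤ 1) (hK : 1 ≤ K) (hN : 1 ≤ N)
    (hrun : IsRun N δ a x i) (hconc : Concentrated γ T a x m) {t : ℕ} (ht : 1 ≤ t) (htT : t ≤ T)
    {D : ℝ} (hD0 : 0 ≤ D) (hα : ∀ k, m t k ∈ Set.Icc 0 α)
    (hD : ∀ u v, lastReset δ a x t < u → u ≤ t → lastReset δ a x t < v → v ≤ t →
      ∀ k, |m u k - m v k| ≤ D)
    (hmon : IsMonitoring K N (t - lastReset δ a x t)) :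
    reg m a t ≤ 4 * D + 12 * K * Real.sqrt (Real.log T / (t - lastReset δ a x t : ℕ)) +
      8 * K ^ 2 * α * (2 * failCount a x m T (lastReset δ a x t) + 1) /
        (t - lastReset δ a x t : ℕ) := by
  have hlt := lastReset_lt (δ := δ) (a := a) (x := x) ht
  have hα0 : 0 ≤ α := (hα (a t)).1.trans (hα (a t)).2
  have hlogT : (0 : ℝ) ≤ Real.log T := by positivity
  rcases Nat.lt_or_ge K 2 with hK2 | hK2
  · refine le_trans ?_ (by positivity : (0:ℝ) ≤ _)
    rw [reg_le_iff]
    intro j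
    have : j = a t := Fin.ext (by omega)
    rw [this, sub_self]
  obtain ⟨l, hl, hal, hS1, hS2⟩ := exists_selTime_of_isMonitoring hK hN hrun ht hmon
  set ρ := lastReset δ a x t with hρ
  set τ := t - ρ with hτ
  set S := selTime K N l with hS
  set e := exploreCount N a ρ S (i ρ l) with he
  set F := failCount a x m T ρ with hF
  have hτe : τ ≤ 8 * K ^ 2 * e := by
    have := selTime_le_exploreCount (N := N) (a := a) hK2 hrun (ρ := ρ) hl
    calc τ ≤ 4 * S := hS2
      _ ≤ 4 * (2 * K ^ 2 * e) := Nat.mul_le_mul_left _ this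
      _ = _ := by ring
  have hτ0 : (0 : ℝ) < τ := by exact_mod_cast (by omega : 0 < τ)
  have hτe' : (τ : ℝ) ≤ 8 * K ^ 2 * e := by exact_mod_cast hτe
  rcases Nat.lt_or_ge e (2 * F + 2) with hcase | hcase
  · have h1 : reg m a t ≤ α := by
      rw [reg_le_iff]
      intro j
      linarith [(hα j).2, (hα (a t)).1]
    have h2 : α ≤ 8 * K ^ 2 * α * (2 * F + 1) / τ := by
      rw [le_div_iff₀ hτ0]
      have h3 : (e : ℝ) ≤ 2 * F + 1 := by exact_mod_cast (by omega : e ≤ 2 * F + 1)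
      calc α * τ ≤ α * (8 * K ^ 2 * e) := mul_le_mul_of_nonneg_left hτe' hα0
        _ ≤ α * (8 * K ^ 2 * (2 * F + 1)) := by gcongr
        _ = _ := by ring
    have h3 : 0 ≤ 4 * D + 12 * K * Real.sqrt (Real.log T / τ) := by positivity
    linarith
  · obtain ⟨u, hu1, hu2, hu3, hu4, hu5, hu6⟩ :=
      exists_explore_not_fails (T := T) (x := x) (m := m) (by omega : S ≤ T) hcase
    have hut : u ≤ t := by omega
    have hru : lastReset δ a x u = ρ := by rw [hρ]; exact lastReset_eq_of_lt hu1 hut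
    have h1 := reg_le_of_explore (t := u) (D := D) hγ hrun hconc (by omega) (by omega)
      (by rw [hru]; exact fun v h1 h2 k => hD v u h1 (by omega) hu1 hut k)
      (by rw [hru]; exact hu3) (by rw [hru]; exact hu5) (by rw [hru, hu4]; omega)
    rw [hru, hu4] at h1
    rw [reg_le_iff] at h1
    -- The arm has at least `τ / (16 * K ^ 2)` earlier pulls, and `2 * 16 ≤ 6 ^ 2`.
    have h2 : Real.sqrt (2 * Real.log T / pulls a (i ρ l) ρ (u - 1)) ≤
        6 * K * Real.sqrt (Real.log T / τ) := by
      have h3 : (6 * K * Real.sqrt (Real.log T / τ)) =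
          Real.sqrt ((6 * K) ^ 2 * (Real.log T / τ)) := by
        rw [Real.sqrt_mul (by positivity), Real.sqrt_sq (by positivity)]
      rw [h3]
      apply Real.sqrt_le_sqrt
      have hp : (0 : ℝ) < pulls a (i ρ l) ρ (u - 1) := by exact_mod_cast (by omega)
      have h4 : (e : ℝ) ≤ 2 * pulls a (i ρ l) ρ (u - 1) := by exact_mod_cast hu6
      rw [← mul_div_assoc, div_le_div_iff₀ hp hτ0]
      have h5 : (τ : ℝ) ≤ 16 * K ^ 2 * pulls a (i ρ l) ρ (u - 1) := by nlinarith [sq_nonneg (K : ℝ)]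
      nlinarith [mul_nonneg hlogT (mul_nonneg (sq_nonneg (K : ℝ)) hp.le)]
    have h3 : 0 ≤ 8 * K ^ 2 * α * (2 * F + 1) / (τ : ℝ) := by positivity
    rw [reg_le_iff]
    intro j
    have h4 := h1 j
    have h5 := hD t u (by omega) le_rfl hu1 hut j
    have h6 := hD t u (by omega) le_rfl hu1 hut (a t)
    rw [hu4] at h4
    rw [hal] at h6 ⊢
    rw [abs_le] at h5 h6
    linarith [h5.1, h5.2, h6.1, h6.2]

/-- Bound on the regret in a slot that no change point separates from the last reset. -/
lemma reg_le {γ α : ℝ} (hγ : γ ≤ 1) (hK : 1 ≤ K) (hN : 1 ≤ N)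
    (hrun : IsRun N δ a x i) (hconc : Concentrated γ T a x m) {t : ℕ} (ht : 1 ≤ t) (htT : t ≤ T)
    {D : ℝ} (hD0 : 0 ≤ D) (hα : ∀ k, m t k ∈ Set.Icc 0 α)
    (hD : ∀ u v, lastReset δ a x t < u → u ≤ t → lastReset δ a x t < v → v ≤ t →
      ∀ k, |m u k - m v k| ≤ D) :
    reg m a t ≤ 4 * D + 12 * K * Real.sqrt (Real.log T / (t - lastReset δ a x t : ℕ)) +
      8 * K ^ 2 * α * (2 * failCount a x m T (lastReset δ a x t) + 1) /
        (t - lastReset δ a x t : ℕ) +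
      3 * Real.sqrt (Real.log T / pulls a (a t) (lastReset δ a x t) (t - 1)) +
      α * (Set.indicator {τ | Fails a x m (lastReset δ a x t) τ} 1 (t - lastReset δ a x t)) +
      α * (Set.indicator {n | n = 0} 1 (pulls a (a t) (lastReset δ a x t) (t - 1))) := by
  have hlt := lastReset_lt (δ := δ) (a := a) (x := x) ht
  have hα0 : 0 ≤ α := (hα (a t)).1.trans (hα (a t)).2
  have hlogT : (0 : ℝ) ≤ Real.log T := by positivity
  have hreg : reg m a t ≤ α := by
    rw [reg_le_iff]
    intro j
    linarith [(hα j).2, (hα (a t)).1]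
  set ρ := lastReset δ a x t with hρ
  have p1 : 0 ≤ 12 * K * Real.sqrt (Real.log T / (t - ρ : ℕ)) := by positivity
  have p2 : 0 ≤ 8 * K ^ 2 * α * (2 * failCount a x m T ρ + 1) / (t - ρ : ℕ) := by positivity
  have p3 : 0 ≤ 3 * Real.sqrt (Real.log T / pulls a (a t) ρ (t - 1)) := by positivity
  have p4 : 0 ≤ α * (Set.indicator {τ | Fails a x m ρ τ} 1 (t - ρ)) :=
    mul_nonneg hα0 (Set.indicator_nonneg (fun _ _ => zero_le_one) _)
  have p5 : 0 ≤ α * (Set.indicator {n | n = 0} 1 (pulls a (a t) ρ (t - 1))) :=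
    mul_nonneg hα0 (Set.indicator_nonneg (fun _ _ => zero_le_one) _)
  by_cases hmon : IsMonitoring K N (t - ρ)
  · have := reg_le_of_isMonitoring hγ hK hN hrun hconc ht htT hD0 hα hD hmon
    rw [← hρ] at this
    linarith
  by_cases hf : Fails a x m ρ (t - ρ)
  · have : Set.indicator {τ | Fails a x m ρ τ} (1 : ℕ → ℝ) (t - ρ) = 1 := by
      rw [Set.indicator_of_mem (by exact hf)]; rfl
    rw [this]
    linarith
  rcases Nat.eq_zero_or_pos (pulls a (a t) ρ (t - 1)) with h0 | h0
  · have : Set.indicator {n | n = 0} (1 : ℕ → ℝ) (pulls a (a t) ρ (t - 1)) = 1 := by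
      rw [Set.indicator_of_mem (by exact h0)]; rfl
    rw [this]
    linarith
  · have h1 := reg_le_of_explore (t := t) (D := D) hγ hrun hconc ht htT
      (fun u h1 h2 k => hD u t h1 h2 hlt le_rfl k) hmon hf h0
    have h2 : 2 * Real.sqrt (2 * Real.log T / pulls a (a t) ρ (t - 1)) ≤
        3 * Real.sqrt (Real.log T / pulls a (a t) ρ (t - 1)) := by
      rw [mul_div_assoc, Real.sqrt_mul (by norm_num)]
      have : Real.sqrt 2 ≤ 3 / 2 := by
        rw [Real.sqrt_le_left (by norm_num)]; norm_num
      nlinarith [Real.sqrt_nonneg (Real.log T / pulls a (a t) ρ (t - 1))]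
    rw [← hρ] at h1
    linarith

end SlotRegret

section Sums

/-! ### Elementary sums -/

/-- The term `j = 0` vanishes because `1 / 0 = 0`; the others are dominated by the telescoping
increments of `2 * √j`. -/
lemma sum_range_one_div_sqrt_le (n : ℕ) :
    ∑ j ∈ Finset.range (n + 1), Real.sqrt (1 / j) ≤ 2 * Real.sqrt n := by
  induction n with
  | zero => simp
  | succ n ih =>
    rw [Finset.sum_range_succ]
    have h1 : (0 : ℝ) ≤ n := by positivity
    have h2 : Real.sqrt n ^ 2 = n := Real.sq_sqrt h1
    have h3 : Real.sqrt (n + 1) ^ 2 = n + 1 := Real.sq_sqrt (by positivity)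
    have h4 : Real.sqrt n ≤ Real.sqrt (n + 1) := Real.sqrt_le_sqrt (by linarith)
    have h5 : 0 < Real.sqrt ((n : ℝ) + 1) := Real.sqrt_pos.mpr (by positivity)
    push_cast
    rw [Real.sqrt_div zero_le_one, Real.sqrt_one]
    have h6 : 1 / Real.sqrt ((n : ℝ) + 1) ≤ 2 * (Real.sqrt (n + 1) - Real.sqrt n) := by
      rw [div_le_iff₀ h5]
      nlinarith
    linarith

lemma sum_union_le_of_nonneg {ι : Type*} [DecidableEq ι] {U V : Finset ι} {f : ι → ℝ}
    (hf : ∀ t, 0 ≤ f t) : ∑ t ∈ U ∪ V, f t ≤ ∑ t ∈ U, f t + ∑ t ∈ V, f t := by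
  rw [← Finset.sum_union_inter]
  exact le_add_of_nonneg_right (Finset.sum_nonneg fun t _ => hf t)

/-- Values beyond `1 / y ^ 2` contribute at most `y` each (up to the factor `√c`), and the smaller,
distinct values at most `2 / y` in total. With `y` free the bound is affine in the cardinality, so
it can be added up over stretches of unknown lengths. -/
lemma sum_sqrt_div_le {ι : Type*} (U : Finset ι) (f : ι → ℕ) (hf : Set.InjOn f U) {c y : ℝ}
    (hc : 0 ≤ c) (hy : 0 < y) :
    ∑ t ∈ U, Real.sqrt (c / f t) ≤ Real.sqrt c * (y * U.card + 2 / y) := by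
  classical
  have e1 : ∑ t ∈ U, Real.sqrt (c / f t) = Real.sqrt c * ∑ j ∈ U.image f, Real.sqrt (1 / j) := by
    rw [Finset.sum_image hf, Finset.mul_sum]
    refine Finset.sum_congr rfl fun t _ => ?_
    rw [← Real.sqrt_mul hc, mul_one_div]
  rw [e1]
  refine mul_le_mul_of_nonneg_left ?_ (Real.sqrt_nonneg _)
  set n := ⌊1 / y ^ 2⌋₊ with hn
  have h1 : ∀ j ∈ U.image f, Real.sqrt (1 / (j : ℝ)) ≤
      y + if j ∈ Finset.range (n + 1) then Real.sqrt (1 / (j : ℝ)) else 0 := by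
    intro j _
    split_ifs with h
    · linarith
    · rw [add_zero, Real.sqrt_le_left hy.le]
      have h2 : n < j := by simpa using h
      have h3 : 1 / y ^ 2 < j := (Nat.floor_lt (by positivity)).mp h2
      have h4 : (0 : ℝ) < j := lt_of_le_of_lt (by positivity) h3
      rw [div_lt_iff₀ (by positivity)] at h3
      rw [div_le_iff₀ h4]
      linarith
  refine (Finset.sum_le_sum h1).trans ?_
  rw [Finset.sum_add_distrib, Finset.sum_const, nsmul_eq_mul, ← Finset.sum_filter]
  have h2 : ((U.image f).card : ℝ) ≤ U.card := by exact_mod_cast Finset.card_image_le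
  have h3 : ∑ j ∈ (U.image f).filter (· ∈ Finset.range (n + 1)), Real.sqrt (1 / (j : ℝ)) ≤
      ∑ j ∈ Finset.range (n + 1), Real.sqrt (1 / (j : ℝ)) :=
    Finset.sum_le_sum_of_subset_of_nonneg (fun j hj => (Finset.mem_filter.mp hj).2)
      fun _ _ _ => Real.sqrt_nonneg _
  have h4 := sum_range_one_div_sqrt_le n
  have h5 : Real.sqrt n ≤ 1 / y := by
    rw [Real.sqrt_le_left (by positivity)]
    refine (Nat.floor_le (by positivity)).trans (le_of_eq ?_)
    field_simp
  have h6 : ((U.image f).card : ℝ) * y ≤ y * U.card := by nlinarith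
  have h7 : 2 / y = 2 * (1 / y) := by ring
  linarith

lemma sum_one_div_le {ι : Type*} (U : Finset ι) (f : ι → ℕ) (hf : Set.InjOn f U) {T : ℕ}
    (hU : ∀ t ∈ U, 1 ≤ f t ∧ f t ≤ T) :
    ∑ t ∈ U, (1 : ℝ) / f t ≤ 1 + Real.log T := by
  classical
  have e1 : ∑ t ∈ U, (1 : ℝ) / f t = ∑ j ∈ U.image f, (1 : ℝ) / j := by
    rw [Finset.sum_image hf]
  rw [e1]
  refine le_trans ?_ (harmonic_le_one_add_log T)
  rw [harmonic_eq_sum_Icc]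
  push_cast
  simp only [one_div]
  refine Finset.sum_le_sum_of_subset_of_nonneg ?_ fun _ _ _ => by positivity
  intro j hj
  obtain ⟨t, ht, rfl⟩ := Finset.mem_image.mp hj
  exact Finset.mem_Icc.mpr (hU t ht)

end Sums

section ResetCount

variable {K : ℕ} {δ b : ℝ} {a : ℕ → Fin K} {x : ℕ → ℝ} {m : ℕ → Fin K → ℝ} {N T : ℕ}
  {i : ℕ → ℕ → Fin K}

/-! ### The number of resets -/

open Classical in
/-- Resets before the horizon. -/
noncomputable def resets (δ : ℝ) (a : ℕ → Fin K) (x : ℕ → ℝ) (T : ℕ) : Finset ℕ :=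
  (Finset.range T).filter (IsReset δ a x)

lemma mem_resets {r : ℕ} : r ∈ resets δ a x T ↔ r < T ∧ IsReset δ a x r := by
  simp [resets]

/-- The stretches that end with different resets are disjoint, so each reset can be charged to the
weight of its own stretch. -/
lemma card_resets_le {w : ℕ → ℝ} (hw : ∀ u, 0 ≤ w u)
    (h : ∀ r, r < T → IsReset δ a x r → 1 ≤ ∑ u ∈ Finset.Ioc (lastReset δ a x r) r, w u) :
    ((resets δ a x T).card : ℝ) ≤ ∑ u ∈ Finset.Ico 1 T, w u := by
  classical
  have hdisj : Set.PairwiseDisjoint (↑(resets δ a x T))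
      (fun r => Finset.Ioc (lastReset δ a x r) r) := by
    have key : ∀ r r', IsReset δ a x r → r < r' →
        Disjoint (Finset.Ioc (lastReset δ a x r) r) (Finset.Ioc (lastReset δ a x r') r') := by
      intro r r' hr hrr'
      rw [Finset.disjoint_left]
      intro u hu hu'
      simp only [Finset.mem_Ioc] at hu hu'
      have := le_lastReset hr hrr'
      omega
    intro r hr r' hr' hne
    have hr := (mem_resets.mp hr).2
    have hr' := (mem_resets.mp hr').2
    rcases lt_or_gt_of_ne hne with h1 | h1
    · exact key r r' hr h1
    · exact (key r' r hr' h1).symm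
  calc ((resets δ a x T).card : ℝ) = ∑ r ∈ resets δ a x T, (1 : ℝ) := by simp
    _ ≤ ∑ r ∈ resets δ a x T, ∑ u ∈ Finset.Ioc (lastReset δ a x r) r, w u := by
        refine Finset.sum_le_sum fun r hr => ?_
        exact h r (mem_resets.mp hr).1 (mem_resets.mp hr).2
    _ = ∑ u ∈ (resets δ a x T).biUnion (fun r => Finset.Ioc (lastReset δ a x r) r), w u :=
        (Finset.sum_biUnion hdisj).symm
    _ ≤ _ := by
        refine Finset.sum_le_sum_of_subset_of_nonneg ?_ fun _ _ _ => hw _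
        intro u hu
        obtain ⟨r, hr, hu⟩ := Finset.mem_biUnion.mp hu
        have := (mem_resets.mp hr).1
        simp only [Finset.mem_Ioc, Finset.mem_Ico] at hu ⊢
        omega

/-- A stretch without change points that ends with a reset is long. -/
lemma le_length_of_isReset {γ B : ℝ} (hγ0 : 0 ≤ γ) (hγ : γ < 1) (hB : 0 < B) (hb : b = B ^ 3)
    (hT : 2 ≤ T) (hδ : δ = 1 / (T : ℝ) ^ 3) (hconc : Concentrated γ T a x m) {r : ℕ}
    (hrT : r ≤ T) (hr : IsReset δ a x r) (hnc : NoChange b m (lastReset δ a x r) r) :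
    1 - γ ≤ B ^ 2 * (r - lastReset δ a x r : ℕ) := by
  set ρ := lastReset δ a x r with hρ
  have hr' := hr
  obtain ⟨k, u, h1, h2, h3, h4, h5⟩ := hr'
  rw [← hρ] at h1 h3 h5
  have hb0 : 0 ≤ b := by rw [hb]; positivity
  set L := r - ρ with hL
  have hL0 : 0 < L := by omega
  have hL0' : (0 : ℝ) < L := by exact_mod_cast hL0
  have h0 : (0:ℝ) ≤ 3 / 2 * Real.log T := by positivity
  set σ₁ := Real.sqrt (3 / 2 * Real.log T / pulls a k ρ u)
  set σ₂ := Real.sqrt (3 / 2 * Real.log T / pulls a k u r)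
  set σ := Real.sqrt (3 / 2 * Real.log T / L) with hσ
  have s1 : σ ≤ σ₁ := sqrt_div_le_sqrt_div h0 h3 (pulls_le.trans (by omega))
  have s2 : σ ≤ σ₂ := sqrt_div_le_sqrt_div h0 h4 (pulls_le.trans (by omega))
  rw [cut_eq hδ] at h5
  have d1 : |empMean a x k ρ u - m (u + 1) k - noise a x m k ρ u / pulls a k ρ u| ≤
      b * (u - ρ : ℕ) := by
    refine abs_empMean_sub_sub_le h3 fun v hv hv' => ?_
    rw [abs_sub_comm]
    refine (hnc.abs_sub_le (u := v) (v := u + 1) hv (by omega) (by omega) k).trans ?_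
    refine mul_le_mul_of_nonneg_left ?_ hb0
    have : (u + 1 : ℝ) ≤ (u - ρ : ℕ) + v := by exact_mod_cast (by omega : u + 1 ≤ u - ρ + v)
    push_cast
    linarith
  have d2 : |empMean a x k u r - m (u + 1) k - noise a x m k u r / pulls a k u r| ≤
      b * (r - u : ℕ) := by
    refine abs_empMean_sub_sub_le h4 fun v hv hv' => ?_
    refine (hnc.abs_sub_le (u := u + 1) (v := v) (by omega) (by omega) (by omega) k).trans ?_
    refine mul_le_mul_of_nonneg_left ?_ hb0
    have : (v : ℝ) ≤ (r - u : ℕ) + u := by exact_mod_cast (by omega : v ≤ r - u + u)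
    push_cast
    linarith
  have d3 := hconc.abs_noise_div_le (by omega) h3
  have d4 := hconc.abs_noise_div_le hrT h4
  have d5 : ((u - ρ : ℕ) : ℝ) + (r - u : ℕ) = L := by
    exact_mod_cast (by omega : u - ρ + (r - u) = L)
  have d6 : |empMean a x k ρ u - empMean a x k u r| ≤ γ * σ₁ + γ * σ₂ + b * L := by
    rw [← d5]
    rw [abs_le] at *
    constructor <;> linarith [d1.1, d1.2, d2.1, d2.2, d3.1, d3.2, d4.1, d4.2]
  -- Detection needs a difference of `σ₁ + σ₂`; noise supplies at most the fraction `γ`, so drift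
  -- supplies the rest. Both thresholds are at least `σ`.
  have d7 : 2 * (1 - γ) * σ ≤ b * L := by nlinarith
  have d8 : σ ^ 2 = 3 / 2 * Real.log T / L := Real.sq_sqrt (by positivity)
  -- This makes `3 / 2 * log T ≥ 1`, so the logarithm can be dropped from the lower bound on the
  -- length; `log 2` is just large enough.
  have hlog : 2 / 3 ≤ Real.log T := by
    have := Real.log_two_gt_d9
    have h2 : Real.log 2 ≤ Real.log T := Real.log_le_log (by norm_num) (by exact_mod_cast hT)
    linarith
  have d9 : 1 ≤ σ ^ 2 * L := by
    rw [d8, div_mul_cancel₀ _ hL0'.ne']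
    linarith
  have hσ0 : 0 ≤ σ := Real.sqrt_nonneg _
  have d10 : (2 * (1 - γ) * σ) ^ 2 ≤ (b * L) ^ 2 :=
    pow_le_pow_left₀ (by have : 0 ≤ 1 - γ := by linarith
                         positivity) d7 2
  set g := 1 - γ with hg
  have hg0 : 0 < g := by linarith
  set z := B ^ 2 * (L : ℝ) with hz
  have hz0 : 0 < z := by positivity
  -- Since `b = B ^ 3`, squaring `d7` and multiplying by `L` gives a cube of `z = B ^ 2 * L`. If `z
  -- < g ≤ 1`, then `z ^ 3 ≤ g ^ 2`, a contradiction.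
  have d11 : 4 * g ^ 2 ≤ z ^ 3 := by
    have e : z ^ 3 = (b * L) ^ 2 * L := by rw [hz, hb]; ring
    rw [e]
    calc 4 * g ^ 2 ≤ 4 * g ^ 2 * (σ ^ 2 * L) := le_mul_of_one_le_right (by positivity) d9
      _ = (2 * g * σ) ^ 2 * L := by ring
      _ ≤ _ := mul_le_mul_of_nonneg_right d10 hL0'.le
  by_contra hcon
  push Not at hcon
  have d12 : z ^ 3 ≤ g ^ 3 := pow_le_pow_left₀ hz0.le hcon.le 3
  have d13 : g ^ 3 ≤ g ^ 2 := pow_le_pow_of_le_one hg0.le (by linarith) (by norm_num)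
  nlinarith [pow_pos hg0 2]

lemma mem_changePoints {t : ℕ} :
    t ∈ changePoints b T m ↔ (1 ≤ t ∧ t < T) ∧ ∃ k, b < |m (t + 1) k - m t k| := by
  simp [changePoints]

lemma noChange_of_forall_notMem {s t : ℕ} (ht : t < T)
    (h : ∀ u, s < u → u ≤ t → u ∉ changePoints b T m) : NoChange b m s t := by
  intro u h1 h2 k
  by_contra hcon
  push Not at hcon
  exact h u h1 h2 (mem_changePoints.mpr ⟨⟨by omega, by omega⟩, k, hcon⟩)

/-- A stretch ending with a reset contains a change point or is long: give weight 1 to each change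
point and `B ^ 2 / (1 - γ)` to each slot. -/
lemma card_resets_le_of_concentrated {γ B : ℝ} (hγ0 : 0 ≤ γ) (hγ : γ < 1) (hB : 0 < B)
    (hb : b = B ^ 3) (hT : 2 ≤ T) (hδ : δ = 1 / (T : ℝ) ^ 3) (hconc : Concentrated γ T a x m) :
    ((resets δ a x T).card : ℝ) ≤ (changePoints b T m).card + B ^ 2 * T / (1 - γ) := by
  classical
  have hg : 0 < 1 - γ := by linarith
  refine (card_resets_le (w := fun u => (if u ∈ changePoints b T m then 1 else 0) +
    B ^ 2 / (1 - γ)) (fun u => by positivity) ?_).trans ?_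
  · intro r hrT hr
    rw [Finset.sum_add_distrib, Finset.sum_const, Nat.card_Ioc, nsmul_eq_mul]
    by_cases hnc : ∀ u, lastReset δ a x r < u → u ≤ r → u ∉ changePoints b T m
    · have h1 := le_length_of_isReset hγ0 hγ hB hb hT hδ hconc hrT.le hr
        (noChange_of_forall_notMem hrT hnc)
      have h2 : 1 ≤ ((r - lastReset δ a x r : ℕ) : ℝ) * (B ^ 2 / (1 - γ)) := by
        rw [mul_div_assoc', le_div_iff₀ hg]
        linarith
      have h3 : (0 : ℝ) ≤ ∑ u ∈ Finset.Ioc (lastReset δ a x r) r,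
          if u ∈ changePoints b T m then 1 else 0 := Finset.sum_nonneg fun _ _ => by positivity
      linarith
    · push Not at hnc
      obtain ⟨u, h1, h2, h3⟩ := hnc
      have h4 : (1 : ℝ) ≤ ∑ u ∈ Finset.Ioc (lastReset δ a x r) r,
          if u ∈ changePoints b T m then 1 else 0 := by
        refine le_trans (by rw [if_pos h3]) (Finset.single_le_sum (f := fun u =>
          if u ∈ changePoints b T m then (1 : ℝ) else 0) (fun _ _ => by positivity)
          (Finset.mem_Ioc.mpr ⟨h1, h2⟩))
      have h5 : 0 ≤ ((r - lastReset δ a x r : ℕ) : ℝ) * (B ^ 2 / (1 - γ)) := by positivity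
      linarith
  · rw [Finset.sum_add_distrib, Finset.sum_const, Nat.card_Ico, nsmul_eq_mul, Finset.sum_boole]
    refine add_le_add ?_ ?_
    · exact_mod_cast Finset.card_le_card fun u hu => (Finset.mem_filter.mp hu).2
    · rw [mul_div_right_comm, mul_comm]
      refine mul_le_mul_of_nonneg_left ?_ (by positivity)
      exact_mod_cast Nat.sub_le T 1

end ResetCount

section CalmRegret

variable {K : ℕ} {δ b : ℝ} {a : ℕ → Fin K} {x : ℕ → ℝ} {m : ℕ → Fin K → ℝ} {N T : ℕ}
  {i : ℕ → ℕ → Fin K}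

/-! ### Reduction to slots without a change point since the last reset -/

open Classical in
/-- Regret in the slots that no change point separates from the last reset. -/
noncomputable def calmRegret (δ b : ℝ) (T : ℕ) (m : ℕ → Fin K → ℝ) (a : ℕ → Fin K) (x : ℕ → ℝ) :
    ℝ :=
  ∑ t ∈ Finset.Ico 1 T, if NoChange b m (lastReset δ a x t) t then reg m a t else 0

lemma reg_nonneg (t : ℕ) : 0 ≤ reg m a t := by
  unfold reg
  have := le_ciSup (Set.finite_range (m t)).bddAbove (a t)
  linarith

lemma sum_reg_le_calmRegret (U : Finset ℕ)
    (hU : ∀ t ∈ U, (1 ≤ t ∧ t < T) ∧ NoChange b m (lastReset δ a x t) t) :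
    ∑ t ∈ U, reg m a t ≤ calmRegret δ b T m a x := by
  classical
  unfold calmRegret
  rw [← Finset.sum_filter]
  refine Finset.sum_le_sum_of_subset_of_nonneg (fun t ht => ?_) fun t _ _ => reg_nonneg t
  rw [Finset.mem_filter, Finset.mem_Ico]
  exact hU t ht

/-- The first reset at or after `t` lies after the last abrupt reset before `c` and no later than
the last gradual one, so it is gradual. Its stretch, which contains `t`, has no change point. -/
lemma noChange_of_lastAbrupt_lt {c t : ℕ} (hcT : c ≤ T) (h1 : lastAbrupt δ b T m a x c < t)
    (h2 : t ≤ lastGradual δ b T m a x c) : NoChange b m (lastReset δ a x t) t := by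
  classical
  have hX : lastGradual δ b T m a x c < c ∧
      IsGradualReset δ b T m a x (lastGradual δ b T m a x c) := by
    have hne : ((Finset.range c).filter (IsGradualReset δ b T m a x)).Nonempty := by
      by_contra hcon
      rw [Finset.not_nonempty_iff_eq_empty] at hcon
      unfold lastGradual at h2
      rw [hcon] at h2
      simp at h2
      omega
    obtain ⟨r, hr, hr'⟩ := Finset.exists_mem_eq_sup _ hne id
    have : lastGradual δ b T m a x c = r := hr'
    rw [this]
    simpa using hr
  have hex : ∃ r, t ≤ r ∧ IsReset δ a x r := ⟨_, h2, hX.2.1⟩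
  obtain ⟨hr1, hr2⟩ := Nat.find_spec hex
  set r := Nat.find hex with hr
  have hrX : r ≤ lastGradual δ b T m a x c := Nat.find_min' hex ⟨h2, hX.2.1⟩
  have hna : ¬ IsAbruptReset δ b T m a x r := by
    intro hab
    have : r ≤ lastAbrupt δ b T m a x c :=
      Finset.le_sup (f := id)
        (Finset.mem_filter.mpr ⟨Finset.mem_range.mpr (hrX.trans_lt hX.1), hab⟩)
    omega
  have hlr : lastReset δ a x r < t := by
    by_contra hcon
    push Not at hcon
    have h3 : IsReset δ a x (lastReset δ a x r) := by
      rcases lastReset_eq_zero_or (δ := δ) (a := a) (x := x) r with h | h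
      · omega
      · exact h
    have h4 := Nat.find_min' hex ⟨hcon, h3⟩
    have h5 := lastReset_lt (δ := δ) (a := a) (x := x) (t := r) (by omega)
    omega
  rw [lastReset_eq_of_lt hlr hr1]
  refine noChange_of_forall_notMem (T := T) (by omega) fun u hu hu' hmem => ?_
  exact hna ⟨hr2, u, hmem, hu, by omega⟩

/-- Each summand runs over calm slots apart from endpoints, which cost `α` each. In the final piece,
a change point after the last reset would by detection be followed by another reset before `T`. The
summands are bounded separately by the full calm regret, since overlaps cost only a factor depending
on the number of change points. -/
lemma gradualRegret_le {α : ℝ} (hT : 1 ≤ T) (hreg : ∀ t, 1 ≤ t → reg m a t ≤ α)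
    (hdet : DetectedChanges δ b T m a x) :
    gradualRegret δ b T m a x ≤
      ((changePoints b T m).card + 2) * calmRegret δ b T m a x +
        ((changePoints b T m).card + 3) * α := by
  classical
  have hα : 0 ≤ α := (reg_nonneg 1).trans (hreg 1 le_rfl)
  have hcalm : 0 ≤ calmRegret δ b T m a x :=
    Finset.sum_nonneg fun t _ => by split_ifs; exacts [reg_nonneg t, le_rfl]
  have hsingle : ∀ t, ∑ s ∈ (Finset.Icc 1 t).filter (· = t), reg m a s ≤ α := by
    intro t
    rcases Nat.eq_zero_or_pos t with rfl | ht
    · simpa using hα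
    · rw [Finset.sum_filter, Finset.sum_ite_eq' , if_pos (by simp; omega)]
      exact hreg t ht
  have h1 : ∀ c ∈ insert T (changePoints b T m),
      ∑ t ∈ Finset.Icc (max 1 (lastAbrupt δ b T m a x c)) (lastGradual δ b T m a x c),
        reg m a t ≤ calmRegret δ b T m a x + α := by
    intro c hc
    have hcT : c ≤ T := by
      rcases Finset.mem_insert.mp hc with rfl | hc
      · exact le_rfl
      · exact (mem_changePoints.mp hc).1.2.le
    set Y := lastAbrupt δ b T m a x c with hY
    set Z := lastGradual δ b T m a x c with hZ
    have hZc : Z ≤ c - 1 := by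
      refine Finset.sup_le fun r hr => ?_
      have := Finset.mem_range.mp (Finset.mem_filter.mp hr).1
      simp only [id]
      omega
    have hsub : Finset.Icc (max 1 Y) Z ⊆
        (Finset.Icc 1 Z).filter (fun t => Y < t) ∪ (Finset.Icc 1 Y).filter (· = Y) := by
      intro t ht
      simp only [Finset.mem_Icc, Finset.mem_union, Finset.mem_filter, max_le_iff] at ht ⊢
      omega
    refine (Finset.sum_le_sum_of_subset_of_nonneg hsub fun t _ _ => reg_nonneg t).trans ?_
    refine (sum_union_le_of_nonneg fun t => reg_nonneg t).trans ?_
    refine add_le_add ?_ (hsingle Y)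
    refine sum_reg_le_calmRegret _ fun t ht => ?_
    simp only [Finset.mem_Icc, Finset.mem_filter] at ht
    exact ⟨by omega, noChange_of_lastAbrupt_lt hcT ht.2 ht.1.2⟩
  have h2 : ∑ t ∈ Finset.Icc
      (max 1 (max (lastGradual δ b T m a x T) (lastAbrupt δ b T m a x T))) T, reg m a t ≤
      calmRegret δ b T m a x + α + α := by
    set W := max (lastGradual δ b T m a x T) (lastAbrupt δ b T m a x T) with hW
    have hlW : lastReset δ a x T ≤ W := by
      rcases lastReset_eq_zero_or (δ := δ) (a := a) (x := x) T with h | h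
      · omega
      · have hlt := lastReset_lt (δ := δ) (a := a) (x := x) hT
        by_cases hab : IsAbruptReset δ b T m a x (lastReset δ a x T)
        · exact le_max_of_le_right (Finset.le_sup (f := id)
            (Finset.mem_filter.mpr ⟨Finset.mem_range.mpr hlt, hab⟩))
        · exact le_max_of_le_left (Finset.le_sup (f := id)
            (Finset.mem_filter.mpr ⟨Finset.mem_range.mpr hlt, h, hab⟩))
    have hsub : Finset.Icc (max 1 W) T ⊆
        ((Finset.Ico 1 T).filter (fun t => W < t) ∪ (Finset.Icc 1 W).filter (· = W)) ∪
          (Finset.Icc 1 T).filter (· = T) := by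
      intro t ht
      simp only [Finset.mem_Icc, Finset.mem_Ico, Finset.mem_union, Finset.mem_filter,
        max_le_iff] at ht ⊢
      omega
    refine (Finset.sum_le_sum_of_subset_of_nonneg hsub fun t _ _ => reg_nonneg t).trans ?_
    refine (sum_union_le_of_nonneg fun t => reg_nonneg t).trans ?_
    refine add_le_add ?_ (hsingle T)
    refine (sum_union_le_of_nonneg fun t => reg_nonneg t).trans ?_
    refine add_le_add ?_ (hsingle W)
    refine sum_reg_le_calmRegret _ fun t ht => ?_
    simp only [Finset.mem_Ico, Finset.mem_filter] at ht
    refine ⟨by omega, ?_⟩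
    rw [lastReset_eq_of_lt (t := T) (by omega) ht.1.2.le]
    refine noChange_of_forall_notMem ht.1.2 fun u hu hu' hmem => ?_
    obtain ⟨r, hr1, hr2, hr3⟩ := hdet u hmem
    have := le_lastReset hr3 hr2
    omega
  unfold gradualRegret
  have h3 := Finset.sum_le_sum h1
  rw [Finset.sum_const, nsmul_eq_mul] at h3
  have h4 : ((insert T (changePoints b T m)).card : ℝ) ≤ (changePoints b T m).card + 1 := by
    exact_mod_cast Finset.card_insert_le _ _
  have h5 := mul_le_mul_of_nonneg_right h4 (add_nonneg hcalm hα)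
  linarith

end CalmRegret

section TrajectoryRegret

variable {K : ℕ} {δ b : ℝ} {a : ℕ → Fin K} {x : ℕ → ℝ} {m : ℕ → Fin K → ℝ} {N T : ℕ}
  {i : ℕ → ℕ → Fin K}

/-! ### Summing the regret over a trajectory -/

/-- The times, before the horizon, after which the algorithm (re)starts. -/
noncomputable def starts (δ : ℝ) (a : ℕ → Fin K) (x : ℕ → ℝ) (T : ℕ) : Finset ℕ :=
  insert 0 (resets δ a x T)

lemma lastReset_mem_starts {t : ℕ} (h1 : 1 ≤ t) (h2 : t ≤ T) :
    lastReset δ a x t ∈ starts δ a x T := by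
  have := lastReset_lt (δ := δ) (a := a) (x := x) h1
  rcases lastReset_eq_zero_or (δ := δ) (a := a) (x := x) t with h | h
  · rw [h]; exact Finset.mem_insert_self _ _
  · exact Finset.mem_insert_of_mem (mem_resets.mpr ⟨by omega, h⟩)

/-- Regret over the slots that follow a (re)start at `ρ`, summing the bounds of `reg_le`. -/
lemma sum_slotBound_le {α y : ℝ} (hα : 0 ≤ α) (hy : 0 < y) (hK : 1 ≤ K) {ρ : ℕ} (U : Finset ℕ)
    (hU : ∀ t ∈ U, ρ < t ∧ t ≤ T) :
    ∑ t ∈ U, (12 * K * Real.sqrt (Real.log T / (t - ρ : ℕ)) +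
      8 * K ^ 2 * α * (2 * failCount a x m T ρ + 1) / (t - ρ : ℕ) +
      3 * Real.sqrt (Real.log T / pulls a (a t) ρ (t - 1)) +
      α * (Set.indicator {τ | Fails a x m ρ τ} 1 (t - ρ)) +
      α * (Set.indicator {n | n = 0} 1 (pulls a (a t) ρ (t - 1)))) ≤
    15 * K * Real.sqrt (Real.log T) * (y * U.card + 2 / y) +
      17 * K ^ 2 * α * (1 + Real.log T) * (failCount a x m T ρ + 1) := by
  classical
  have hlogT : (0 : ℝ) ≤ Real.log T := by positivity
  have hK' : (1 : ℝ) ≤ K := by exact_mod_cast hK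
  set F : ℝ := ((failCount a x m T ρ : ℕ) : ℝ) with hF
  have hF0 : 0 ≤ F := by positivity
  have hinj : Set.InjOn (fun t => t - ρ) U := by
    intro t ht s hs h
    have := hU t ht
    have := hU s hs
    simp only at h
    omega
  have hmem : ∀ t ∈ U, 1 ≤ t - ρ ∧ t - ρ ≤ T := by
    intro t ht
    have := hU t ht
    omega
  simp only [Finset.sum_add_distrib]
  have s1 : ∑ t ∈ U, 12 * K * Real.sqrt (Real.log T / (t - ρ : ℕ)) ≤
      12 * K * (Real.sqrt (Real.log T) * (y * U.card + 2 / y)) := by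
    rw [← Finset.mul_sum]
    exact mul_le_mul_of_nonneg_left (sum_sqrt_div_le U _ hinj hlogT hy) (by positivity)
  have s2 : ∑ t ∈ U, 8 * K ^ 2 * α * (2 * F + 1) / (t - ρ : ℕ) ≤
      8 * K ^ 2 * α * (2 * F + 1) * (1 + Real.log T) := by
    have : ∀ t ∈ U, 8 * K ^ 2 * α * (2 * F + 1) / (t - ρ : ℕ) =
        8 * K ^ 2 * α * (2 * F + 1) * (1 / (t - ρ : ℕ)) := fun t _ => by ring
    rw [Finset.sum_congr rfl this, ← Finset.mul_sum]
    exact mul_le_mul_of_nonneg_left (sum_one_div_le U _ hinj hmem) (by positivity)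
  -- Counts of different arms may coincide, so the sum of confidence radii is split by arm.
  have hfib : ∀ k, Set.InjOn (fun t => pulls a k ρ (t - 1)) (U.filter (fun t => a t = k)) := by
    intro k t ht s hs h
    have ht := Finset.mem_filter.mp (Finset.mem_coe.mp ht)
    have hs := Finset.mem_filter.mp (Finset.mem_coe.mp hs)
    exact pulls_injOn k ρ ⟨(hU t ht.1).1, ht.2⟩ ⟨(hU s hs.1).1, hs.2⟩ h
  have s3 : ∑ t ∈ U, 3 * Real.sqrt (Real.log T / pulls a (a t) ρ (t - 1)) ≤
      3 * (Real.sqrt (Real.log T) * (y * U.card + K * (2 / y))) := by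
    rw [← Finset.mul_sum]
    refine mul_le_mul_of_nonneg_left ?_ (by norm_num)
    rw [← Finset.sum_fiberwise_of_maps_to (g := a) (t := Finset.univ) (fun _ _ => by simp)]
    have h1 : ∀ k ∈ (Finset.univ : Finset (Fin K)),
        ∑ t ∈ U.filter (fun t => a t = k), Real.sqrt (Real.log T / pulls a (a t) ρ (t - 1)) ≤
        Real.sqrt (Real.log T) * (y * (U.filter (fun t => a t = k)).card + 2 / y) := by
      intro k _
      refine le_trans (le_of_eq ?_) (sum_sqrt_div_le _ _ (hfib k) hlogT hy)
      refine Finset.sum_congr rfl fun t ht => ?_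
      rw [(Finset.mem_filter.mp ht).2]
    refine (Finset.sum_le_sum h1).trans (le_of_eq ?_)
    rw [← Finset.mul_sum, Finset.sum_add_distrib, ← Finset.mul_sum]
    have h2 := Finset.card_eq_sum_card_fiberwise (f := a) (s := U) (t := Finset.univ)
      (fun _ _ => by simp)
    rw [h2]
    push_cast
    simp
  have s4 : ∑ t ∈ U, α * (Set.indicator {τ | Fails a x m ρ τ} 1 (t - ρ)) ≤ α * F := by
    rw [← Finset.mul_sum]
    refine mul_le_mul_of_nonneg_left ?_ hα
    simp only [Set.indicator_apply, Pi.one_apply]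
    rw [Finset.sum_boole, hF]
    norm_cast
    refine Finset.card_le_card_of_injOn (fun t => t - ρ) ?_ ?_
    · intro t ht
      have ht := Finset.mem_filter.mp (Finset.mem_coe.mp ht)
      exact Finset.mem_coe.mpr (Finset.mem_filter.mpr ⟨Finset.mem_Icc.mpr (hmem t ht.1), ht.2⟩)
    · exact hinj.mono fun t ht => (Finset.mem_filter.mp (Finset.mem_coe.mp ht)).1
  have s5 : ∑ t ∈ U, α * (Set.indicator {n | n = 0} 1 (pulls a (a t) ρ (t - 1))) ≤ α * K := by
    rw [← Finset.mul_sum]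
    refine mul_le_mul_of_nonneg_left ?_ hα
    simp only [Set.indicator_apply, Pi.one_apply]
    rw [Finset.sum_boole]
    norm_cast
    have h1 := Finset.card_le_card_of_injOn (s := U.filter
      (fun t => pulls a (a t) ρ (t - 1) ∈ ({n | n = 0} : Set ℕ))) (t := (Finset.univ : Finset (Fin K)))
      a (fun _ _ => by simp) ?_
    · simpa using h1
    · intro t ht s hs h
      have ht := Finset.mem_filter.mp (Finset.mem_coe.mp ht)
      have hs := Finset.mem_filter.mp (Finset.mem_coe.mp hs)
      have e1 : pulls a (a t) ρ (t - 1) = 0 := ht.2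
      have e2 : pulls a (a s) ρ (s - 1) = 0 := hs.2
      refine pulls_injOn (a t) ρ ⟨(hU t ht.1).1, rfl⟩ ⟨(hU s hs.1).1, h.symm⟩ ?_
      simp only [e1]
      rw [h, e2]
  have hs0 := Real.sqrt_nonneg (Real.log T)
  have hU0 : (0 : ℝ) ≤ U.card := by positivity
  have e3 : 3 * (Real.sqrt (Real.log T) * (y * U.card + K * (2 / y))) ≤
      3 * K * (Real.sqrt (Real.log T) * (y * U.card + 2 / y)) := by
    have : y * U.card ≤ K * (y * U.card) := le_mul_of_one_le_left (by positivity) hK'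
    calc _ ≤ 3 * (Real.sqrt (Real.log T) * (K * (y * U.card) + K * (2 / y))) := by gcongr
      _ = _ := by ring
  have e5 : α * K + α * F ≤ K ^ 2 * α * (1 + Real.log T) * (F + 1) := by
    have h1 : (K : ℝ) ≤ K ^ 2 := by nlinarith
    have h2 : (1 : ℝ) ≤ K ^ 2 := by nlinarith
    have h3 : (K : ℝ) + F ≤ K ^ 2 * (F + 1) := by nlinarith
    calc α * K + α * F = α * 1 * (K + F) := by ring
      _ ≤ α * (1 + Real.log T) * (K ^ 2 * (F + 1)) := by gcongr; linarith
      _ = _ := by ring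
  have e6 : 8 * K ^ 2 * α * (2 * F + 1) * (1 + Real.log T) ≤
      16 * (K ^ 2 * α * (1 + Real.log T) * (F + 1)) := by
    have : 0 ≤ 8 * K ^ 2 * α * (1 + Real.log T) := by positivity
    nlinarith
  calc _ ≤ 12 * K * (Real.sqrt (Real.log T) * (y * U.card + 2 / y)) +
        8 * K ^ 2 * α * (2 * F + 1) * (1 + Real.log T) +
        3 * (Real.sqrt (Real.log T) * (y * U.card + K * (2 / y))) + α * F + α * K := by
        gcongr
    _ ≤ 12 * K * (Real.sqrt (Real.log T) * (y * U.card + 2 / y)) +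
        16 * (K ^ 2 * α * (1 + Real.log T) * (F + 1)) +
        3 * K * (Real.sqrt (Real.log T) * (y * U.card + 2 / y)) +
        K ^ 2 * α * (1 + Real.log T) * (F + 1) := by linarith
    _ = _ := by ring

lemma maxDrift_nonneg {c : ℝ} {w : ℕ} (hb : 0 ≤ b) (hc : 0 < c) : 0 ≤ maxDrift b c K N T w := by
  have := blockVar_nonneg (K := K) (T := T) (w := w) hb hc
  unfold maxDrift
  positivity

/-- Slots are grouped by their last reset. The lengths of the groups add up to at most `T`, and the
cost of a restart is paid once per element of `starts`. -/
lemma calmRegret_le {γ c α y : ℝ} (hγ : γ ≤ 1) (hK : 1 ≤ K) (hN : 1 ≤ N) (hc : 0 < c)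
    (hδ : δ = 1 / (T : ℝ) ^ 3)
    (hrun : IsRun N δ a x i) (hconc : Concentrated γ T a x m) (hgg : GloballyGradual b T c m)
    {w : ℕ} (hw : 0 < w) (hb : 0 ≤ b) (hα : 0 ≤ α) (hmα : ∀ t k, m (t + 1) k ∈ Set.Icc 0 α)
    (hy : 0 < y) :
    calmRegret δ b T m a x ≤ 4 * maxDrift b c K N T w * T +
      15 * K * Real.sqrt (Real.log T) * (y * T + 2 * (starts δ a x T).card / y) +
      17 * K ^ 2 * α * (1 + Real.log T) *
        ((starts δ a x T).card + ∑ ρ ∈ starts δ a x T, (failCount a x m T ρ : ℝ)) := by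
  classical
  set D := maxDrift b c K N T w with hD
  have hD0 : 0 ≤ D := maxDrift_nonneg hb hc
  set G : ℕ → ℕ → ℝ := fun ρ t => 12 * K * Real.sqrt (Real.log T / (t - ρ : ℕ)) +
      8 * K ^ 2 * α * (2 * failCount a x m T ρ + 1) / (t - ρ : ℕ) +
      3 * Real.sqrt (Real.log T / pulls a (a t) ρ (t - 1)) +
      α * (Set.indicator {τ | Fails a x m ρ τ} 1 (t - ρ)) +
      α * (Set.indicator {n | n = 0} 1 (pulls a (a t) ρ (t - 1))) with hG
  have hG0 : ∀ ρ t, 0 ≤ G ρ t := by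
    intro ρ t
    have p4 : 0 ≤ α * (Set.indicator {τ | Fails a x m ρ τ} 1 (t - ρ)) :=
      mul_nonneg hα (Set.indicator_nonneg (fun _ _ => zero_le_one) _)
    have p5 : 0 ≤ α * (Set.indicator {n | n = 0} 1 (pulls a (a t) ρ (t - 1))) :=
      mul_nonneg hα (Set.indicator_nonneg (fun _ _ => zero_le_one) _)
    have p1 : 0 ≤ 12 * K * Real.sqrt (Real.log T / (t - ρ : ℕ)) := by positivity
    have p2 : 0 ≤ 8 * K ^ 2 * α * (2 * failCount a x m T ρ + 1) / (t - ρ : ℕ) := by positivity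
    have p3 : 0 ≤ 3 * Real.sqrt (Real.log T / pulls a (a t) ρ (t - 1)) := by positivity
    simp only [hG]
    linarith
  have h1 : calmRegret δ b T m a x ≤
      ∑ t ∈ Finset.Ico 1 T, (4 * D + G (lastReset δ a x t) t) := by
    unfold calmRegret
    refine Finset.sum_le_sum fun t ht => ?_
    have ht := Finset.mem_Ico.mp ht
    split_ifs with hnc
    · have := reg_le (t := t) (α := α) (D := D) hγ hK hN hrun hconc ht.1 ht.2.le hD0
        (fun k => by rw [show t = t - 1 + 1 by omega]; exact hmα _ k)
        (fun u v h1 h2 h3 h4 k => abs_mean_sub_mean_le_maxDrift hK hN hδ hγ hc hrun hconc hgg hw hb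
          ht.2.le (hnc.mono le_rfl (by omega)) h1 h2 h3 h4 k)
      simp only [hG]
      linarith
    · have := hG0 (lastReset δ a x t) t
      linarith
  have h2 : ∑ t ∈ Finset.Ico 1 T, 4 * D ≤ 4 * D * T := by
    rw [Finset.sum_const, nsmul_eq_mul, Nat.card_Ico, mul_comm]
    refine mul_le_mul_of_nonneg_left ?_ (by positivity)
    exact_mod_cast Nat.sub_le T 1
  have hmaps : ∀ t ∈ Finset.Ico 1 T, lastReset δ a x t ∈ starts δ a x T := by
    intro t ht
    have ht := Finset.mem_Ico.mp ht
    exact lastReset_mem_starts ht.1 ht.2.le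
  have h3 : ∑ t ∈ Finset.Ico 1 T, G (lastReset δ a x t) t ≤
      ∑ ρ ∈ starts δ a x T, (15 * K * Real.sqrt (Real.log T) *
        (y * ((Finset.Ico 1 T).filter (fun t => lastReset δ a x t = ρ)).card + 2 / y) +
      17 * K ^ 2 * α * (1 + Real.log T) * (failCount a x m T ρ + 1)) := by
    rw [← Finset.sum_fiberwise_of_maps_to hmaps]
    refine Finset.sum_le_sum fun ρ _ => ?_
    refine le_trans (le_of_eq ?_) (sum_slotBound_le (a := a) (x := x) (m := m) (T := T) hα hy hK
      (ρ := ρ) ((Finset.Ico 1 T).filter (fun t => lastReset δ a x t = ρ)) ?_)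
    · refine Finset.sum_congr rfl fun t ht => ?_
      rw [(Finset.mem_filter.mp ht).2]
    · intro t ht
      have h4 := Finset.mem_Ico.mp (Finset.mem_filter.mp ht).1
      have h5 := lastReset_lt (δ := δ) (a := a) (x := x) h4.1
      rw [(Finset.mem_filter.mp ht).2] at h5
      omega
  have h4 : ∑ ρ ∈ starts δ a x T,
      (((Finset.Ico 1 T).filter (fun t => lastReset δ a x t = ρ)).card : ℝ) ≤ T := by
    rw [← Nat.cast_sum, ← Finset.card_eq_sum_card_fiberwise hmaps, Nat.card_Ico]
    exact_mod_cast Nat.sub_le T 1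
  clear_value G
  rw [Finset.sum_add_distrib, ← Finset.mul_sum, ← Finset.mul_sum, Finset.sum_add_distrib,
    Finset.sum_add_distrib, ← Finset.mul_sum, Finset.sum_const, Finset.sum_const, nsmul_eq_mul,
    nsmul_eq_mul] at h3
  rw [Finset.sum_add_distrib] at h1
  have h5 : 15 * K * Real.sqrt (Real.log T) * (y * ∑ ρ ∈ starts δ a x T,
      (((Finset.Ico 1 T).filter (fun t => lastReset δ a x t = ρ)).card : ℝ) +
        (starts δ a x T).card * (2 / y)) ≤
      15 * K * Real.sqrt (Real.log T) * (y * T + 2 * (starts δ a x T).card / y) := by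
    refine mul_le_mul_of_nonneg_left ?_ (by positivity)
    have : (starts δ a x T).card * (2 / y) = 2 * (starts δ a x T).card / y := by ring
    rw [this]
    gcongr
  linarith

end TrajectoryRegret

/-! ### Probabilistic estimates: concentration and expected failures -/

section Hoeffding

/-! ### Exponential moments of the accumulated noise -/

/-- Hoeffding's lemma for a Bernoulli variable. -/
lemma one_sub_add_mul_exp_le {p : ℝ} (hp : p ∈ Set.Icc (0 : ℝ) 1) (h : ℝ) :
    1 - p + p * Real.exp h ≤ Real.exp (p * h + h ^ 2 / 8) := by
  set ν : Measure ℝ := ENNReal.ofReal (1 - p) • Measure.dirac 0 + ENNReal.ofReal p • Measure.dirac 1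
    with hν
  have hprob : IsProbabilityMeasure ν := by
    constructor
    simp only [hν, Measure.add_apply, Measure.smul_apply, measure_univ, smul_eq_mul, mul_one]
    rw [← ENNReal.ofReal_add (by linarith [hp.2]) hp.1]
    simp
  have hint : ∀ f : ℝ → ℝ, ∫ y, f y ∂ν = (1 - p) * f 0 + p * f 1 := by
    intro f
    have hi : ∀ c : ℝ, Integrable f (Measure.dirac c) := fun c =>
      integrable_dirac (by simp)
    rw [hν, integral_add_measure ((hi 0).smul_measure (by simp)) ((hi 1).smul_measure (by simp)),
      integral_smul_measure, integral_smul_measure, integral_dirac, integral_dirac,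
      ENNReal.toReal_ofReal (by linarith [hp.2]), ENNReal.toReal_ofReal hp.1]
    rfl
  have hae : ∀ᵐ y ∂ν, (id y : ℝ) ∈ Set.Icc (0 : ℝ) 1 := by
    rw [hν, ae_add_measure_iff]
    constructor
    · refine Measure.ae_smul_measure ?_ _
      exact (ae_dirac_iff (p := fun y : ℝ => id y ∈ Set.Icc (0 : ℝ) 1) measurableSet_Icc).mpr
        (by simp)
    · refine Measure.ae_smul_measure ?_ _
      exact (ae_dirac_iff (p := fun y : ℝ => id y ∈ Set.Icc (0 : ℝ) 1) measurableSet_Icc).mpr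
        (by simp)
  have key := (ProbabilityTheory.hasSubgaussianMGF_of_mem_Icc (μ := ν) (X := id)
    measurable_id.aemeasurable hae).mgf_le h
  unfold ProbabilityTheory.mgf at key
  simp only [hint, id] at key
  have e1 : (((‖(1 : ℝ) - 0‖₊ / 2) ^ 2 : NNReal) : ℝ) = 1 / 4 := by
    simp; norm_num
  rw [e1] at key
  have e2 : 1 - p + p * Real.exp h = Real.exp (p * h) *
      ((1 - p) * Real.exp (h * (0 - ((1 - p) * 0 + p * 1))) +
        p * Real.exp (h * (1 - ((1 - p) * 0 + p * 1)))) := by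
    rw [mul_add, mul_left_comm, ← Real.exp_add, mul_left_comm, ← Real.exp_add]
    ring_nf
    simp only [Real.exp_zero, mul_one]
    ring
  rw [e2, Real.exp_add]
  refine mul_le_mul_of_nonneg_left (key.trans (le_of_eq ?_)) (Real.exp_pos _).le
  ring_nf

/-- Convexity of `exp`. The right side is affine in `y`, so taking conditional expectations merely
replaces a reward by its mean. -/
lemma exp_mul_le_chord {α y : ℝ} (hα : 0 < α) (hy : y ∈ Set.Icc 0 α) (l : ℝ) :
    Real.exp (l * y) ≤ 1 - y / α + y / α * Real.exp (l * α) := by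
  have h := convexOn_exp.2 (Set.mem_univ 0) (Set.mem_univ (l * α))
    (show 0 ≤ 1 - y / α by rw [sub_nonneg, div_le_one hα]; exact hy.2)
    (div_nonneg hy.1 hα.le) (by ring)
  simp only [smul_eq_mul, mul_zero, zero_add, Real.exp_zero, mul_one] at h
  have e : y / α * (l * α) = l * y := by field_simp
  rwa [e] at h

variable {Ω : Type*} {mΩ : MeasurableSpace Ω} {K : ℕ} {P : Measure Ω} [IsProbabilityMeasure P]
  {ℱ : Filtration ℕ mΩ} {α : ℝ} {μ X : ℕ → Fin K → Ω → ℝ}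

omit [IsProbabilityMeasure P] in
lemma IsEnv.reward_measurable_le (henv : IsEnv P ℱ α μ X) {u t : ℕ} (hu : 1 ≤ u) (hut : u ≤ t)
    (k : Fin K) : Measurable[ℱ t] (X u k) := by
  obtain ⟨v, rfl⟩ : ∃ v, u = v + 1 := ⟨u - 1, by omega⟩
  exact (henv.reward_measurable v k).mono (ℱ.mono hut) le_rfl

omit [IsProbabilityMeasure P] in
lemma IsEnv.mean_measurable_le (henv : IsEnv P ℱ α μ X) {u t : ℕ} (hu : 1 ≤ u) (hut : u ≤ t + 1)
    (k : Fin K) : Measurable[ℱ t] (μ u k) := by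
  obtain ⟨v, rfl⟩ : ∃ v, u = v + 1 := ⟨u - 1, by omega⟩
  exact (henv.mean_measurable v k).mono (ℱ.mono (by omega)) le_rfl

/-- Compensated exponent of the reward of arm `k` in slot `u`. -/
noncomputable def compExponent (α : ℝ) (μ X : ℕ → Fin K → Ω → ℝ) (l : ℝ) (k : Fin K) (u : ℕ)
    (ω : Ω) : ℝ :=
  l * (X u k ω - μ u k ω) - l ^ 2 * α ^ 2 / 8

/-- Conditional Hoeffding lemma, as one supermartingale step. The exponential is bounded by its
chord, the reward in it is replaced by its conditional mean, and the result is a Bernoulli moment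
generating function, compensated by the quadratic term. `Φ` is the process so far, and `H` decides
from the past whether the slot is sampled. -/
lemma integral_mul_exp_indicator_le (hα : 0 < α) (henv : IsEnv P ℱ α μ X) (t : ℕ) (k : Fin K)
    (l : ℝ) {H : Set Ω} (hH : MeasurableSet[ℱ t] H) {Φ : Ω → ℝ} (hΦ : Measurable[ℱ t] Φ)
    {B : ℝ} (hΦB : ∀ ω, Φ ω ∈ Set.Icc 0 B) :
    ∫ ω, Φ ω * Real.exp (H.indicator (compExponent α μ X l k (t + 1)) ω) ∂P ≤ ∫ ω, Φ ω ∂P := by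
  classical
  have hle := ℱ.le t
  set v := l ^ 2 * α ^ 2 / 8 with hv
  have hv0 : 0 ≤ v := by positivity
  have hμm := henv.mean_measurable t k
  have hXm : Measurable (X (t + 1) k) := (henv.reward_measurable t k).mono (ℱ.le _) le_rfl
  have hXb := henv.reward_mem t k
  have hμb := henv.mean_mem t k
  set Ψ : Ω → ℝ := fun ω => H.indicator Φ ω * Real.exp (-(l * μ (t + 1) k ω) - v) with hΨ
  have hΨm : Measurable[ℱ t] Ψ :=
    (hΦ.indicator hH).mul (Real.measurable_exp.comp (((hμm.const_mul l).neg).sub_const v))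
  have hind : ∀ ω, 0 ≤ H.indicator Φ ω ∧ H.indicator Φ ω ≤ B := by
    intro ω
    by_cases h : ω ∈ H
    · rw [Set.indicator_of_mem h]; exact hΦB ω
    · rw [Set.indicator_of_notMem h]; exact ⟨le_rfl, (hΦB ω).1.trans (hΦB ω).2⟩
  have hΨ0 : ∀ ω, 0 ≤ Ψ ω := fun ω => mul_nonneg (hind ω).1 (Real.exp_pos _).le
  have hΨb : ∀ ω, ‖Ψ ω‖ ≤ B * Real.exp (|l| * α) := by
    intro ω
    rw [Real.norm_of_nonneg (hΨ0 ω)]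
    have h1 : -(l * μ (t + 1) k ω) ≤ |l| * α := by
      refine (neg_le_abs _).trans ?_
      rw [abs_mul, abs_of_nonneg (hμb ω).1]
      exact mul_le_mul_of_nonneg_left (hμb ω).2 (abs_nonneg l)
    exact mul_le_mul (hind ω).2 (Real.exp_le_exp.mpr (by linarith)) (Real.exp_pos _).le
      ((hind ω).1.trans (hind ω).2)
  have hXint : Integrable (X (t + 1) k) P :=
    Integrable.of_bound hXm.aestronglyMeasurable α
      (Eventually.of_forall fun ω => by rw [Real.norm_of_nonneg (hXb ω).1]; exact (hXb ω).2)
  have hΨint : Integrable Ψ P :=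
    Integrable.of_bound (hΨm.mono hle le_rfl).aestronglyMeasurable _ (Eventually.of_forall hΨb)
  have hΨX : Integrable (Ψ * X (t + 1) k) P :=
    hXint.bdd_mul (hΨm.mono hle le_rfl).aestronglyMeasurable (Eventually.of_forall hΨb)
  have hΨμ : Integrable (Ψ * μ (t + 1) k) P := by
    refine hΨint.mul_bdd (c := α) (hμm.mono hle le_rfl).aestronglyMeasurable
      (Eventually.of_forall fun ω => ?_)
    rw [Real.norm_of_nonneg (hμb ω).1]; exact (hμb ω).2
  have hpull : ∫ ω, (Ψ * X (t + 1) k) ω ∂P = ∫ ω, (Ψ * μ (t + 1) k) ω ∂P := by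
    rw [← integral_condExp hle]
    refine integral_congr_ae ?_
    refine (condExp_mul_of_stronglyMeasurable_left hΨm.stronglyMeasurable hΨX hXint).trans ?_
    filter_upwards [henv.mean_eq t k] with ω hω
    rw [Pi.mul_apply, Pi.mul_apply, hω]
  have hΦc : Integrable (Hᶜ.indicator Φ) P := by
    refine Integrable.of_bound ((hΦ.indicator hH.compl).mono hle le_rfl).aestronglyMeasurable B
      (Eventually.of_forall fun ω => ?_)
    by_cases h : ω ∈ Hᶜ
    · rw [Set.indicator_of_mem h, Real.norm_of_nonneg (hΦB ω).1]; exact (hΦB ω).2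
    · rw [Set.indicator_of_notMem h, norm_zero]; exact (hΦB ω).1.trans (hΦB ω).2
  have hΦint : Integrable Φ P :=
    Integrable.of_bound (hΦ.mono hle le_rfl).aestronglyMeasurable B
      (Eventually.of_forall fun ω => by rw [Real.norm_of_nonneg (hΦB ω).1]; exact (hΦB ω).2)
  set E := Real.exp (l * α) with hE
  have hupper : ∀ ω, Φ ω * Real.exp (H.indicator (compExponent α μ X l k (t + 1)) ω) ≤
      Hᶜ.indicator Φ ω + Ψ ω + (E - 1) / α * (Ψ * X (t + 1) k) ω := by
    intro ω
    by_cases h : ω ∈ H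
    · have hc : ω ∉ Hᶜ := fun h' => h' h
      rw [Set.indicator_of_mem h, Set.indicator_of_notMem hc, Pi.mul_apply]
      simp only [hΨ, Set.indicator_of_mem h]
      have h1 := exp_mul_le_chord hα (hXb ω) l
      have h2 : Real.exp (compExponent α μ X l k (t + 1) ω) =
          Real.exp (-(l * μ (t + 1) k ω) - v) * Real.exp (l * X (t + 1) k ω) := by
        rw [← Real.exp_add]; congr 1; unfold compExponent; ring
      rw [h2, zero_add]
      have h3 : 0 ≤ Φ ω * Real.exp (-(l * μ (t + 1) k ω) - v) :=
        mul_nonneg (hΦB ω).1 (Real.exp_pos _).le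
      calc _ = Φ ω * Real.exp (-(l * μ (t + 1) k ω) - v) * Real.exp (l * X (t + 1) k ω) := by ring
        _ ≤ Φ ω * Real.exp (-(l * μ (t + 1) k ω) - v) *
            (1 - X (t + 1) k ω / α + X (t + 1) k ω / α * Real.exp (l * α)) :=
          mul_le_mul_of_nonneg_left h1 h3
        _ = _ := by rw [← hE]; field_simp; ring
    · rw [Set.indicator_of_notMem h, Set.indicator_of_mem (by exact h), Pi.mul_apply]
      simp only [hΨ, Set.indicator_of_notMem h]
      simp
  have hlower : ∀ ω, Hᶜ.indicator Φ ω + Ψ ω + (E - 1) / α * (Ψ * μ (t + 1) k) ω ≤ Φ ω := by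
    intro ω
    by_cases h : ω ∈ H
    · have hc : ω ∉ Hᶜ := fun h' => h' h
      rw [Set.indicator_of_notMem hc, Pi.mul_apply]
      simp only [hΨ, Set.indicator_of_mem h]
      have hp : μ (t + 1) k ω / α ∈ Set.Icc (0 : ℝ) 1 :=
        ⟨div_nonneg (hμb ω).1 hα.le, by rw [div_le_one hα]; exact (hμb ω).2⟩
      have h1 := one_sub_add_mul_exp_le hp (l * α)
      have h2 : μ (t + 1) k ω / α * (l * α) + (l * α) ^ 2 / 8 = l * μ (t + 1) k ω + v := by
        rw [hv]; field_simp
      rw [h2, ← hE] at h1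
      have h3 : 0 ≤ Φ ω * Real.exp (-(l * μ (t + 1) k ω) - v) :=
        mul_nonneg (hΦB ω).1 (Real.exp_pos _).le
      calc _ = Φ ω * Real.exp (-(l * μ (t + 1) k ω) - v) *
            (1 - μ (t + 1) k ω / α + μ (t + 1) k ω / α * E) := by field_simp; ring
        _ ≤ Φ ω * Real.exp (-(l * μ (t + 1) k ω) - v) * Real.exp (l * μ (t + 1) k ω + v) :=
          mul_le_mul_of_nonneg_left h1 h3
        _ = Φ ω := by
          rw [mul_assoc, ← Real.exp_add]
          have : -(l * μ (t + 1) k ω) - v + (l * μ (t + 1) k ω + v) = 0 := by ring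
          rw [this, Real.exp_zero, mul_one]
    · rw [Set.indicator_of_mem (by exact h), Pi.mul_apply]
      simp only [hΨ, Set.indicator_of_notMem h]
      simp
  calc _ ≤ ∫ ω, (Hᶜ.indicator Φ ω + Ψ ω + (E - 1) / α * (Ψ * X (t + 1) k) ω) ∂P := by
        refine integral_mono_of_nonneg (Eventually.of_forall fun ω =>
          mul_nonneg (hΦB ω).1 (Real.exp_pos _).le) ?_ (Eventually.of_forall hupper)
        exact (hΦc.add hΨint).add (hΨX.const_mul _)
    _ = ∫ ω, (Hᶜ.indicator Φ ω + Ψ ω + (E - 1) / α * (Ψ * μ (t + 1) k) ω) ∂P := by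
        change ∫ ω, ((Hᶜ.indicator Φ + Ψ) ω + (E - 1) / α * (Ψ * X (t + 1) k) ω) ∂P =
          ∫ ω, ((Hᶜ.indicator Φ + Ψ) ω + (E - 1) / α * (Ψ * μ (t + 1) k) ω) ∂P
        rw [integral_add (hΦc.add hΨint) (hΨX.const_mul _), integral_const_mul, hpull,
          ← integral_const_mul, ← integral_add (hΦc.add hΨint) (hΨμ.const_mul _)]
    _ ≤ _ := integral_mono ((hΦc.add hΨint).add (hΨμ.const_mul _)) hΦint hlower

/-- The exponential of a predictably sampled compensated sum is, from any past event on, a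
supermartingale. -/
lemma integral_indicator_mul_exp_le (hα : 0 < α) (henv : IsEnv P ℱ α μ X) (k : Fin K) (l : ℝ)
    {s : ℕ} {A : Set Ω} (hA : MeasurableSet[ℱ s] A) {H : ℕ → Set Ω}
    (hH : ∀ u, s < u → MeasurableSet[ℱ (u - 1)] (H u)) (t : ℕ) (hst : s ≤ t) :
    Measurable[ℱ t] (fun ω => A.indicator 1 ω *
      Real.exp (∑ u ∈ Finset.Ioc s t, (H u).indicator (compExponent α μ X l k u) ω)) ∧
    (∃ B, ∀ ω, A.indicator 1 ω *
      Real.exp (∑ u ∈ Finset.Ioc s t, (H u).indicator (compExponent α μ X l k u) ω) ∈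
        Set.Icc 0 B) ∧
    ∫ ω, A.indicator 1 ω *
      Real.exp (∑ u ∈ Finset.Ioc s t, (H u).indicator (compExponent α μ X l k u) ω) ∂P ≤
        P.real A := by
  induction t, hst using Nat.le_induction with
  | base =>
    simp only [Finset.Ioc_self, Finset.sum_empty, Real.exp_zero, mul_one]
    refine ⟨?_, ⟨1, fun ω => ⟨Set.indicator_nonneg (fun _ _ => zero_le_one) _,
      Set.indicator_le_self' (fun _ _ => zero_le_one) _⟩⟩, ?_⟩
    · exact (@measurable_const _ _ _ (ℱ s) (1 : ℝ)).indicator hA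
    · rw [integral_indicator_one (ℱ.le s _ hA)]
  | succ t hst ih =>
    obtain ⟨hm, ⟨B, hB⟩, hint⟩ := ih
    have hH' := hH (t + 1) (by omega)
    rw [Nat.add_sub_cancel] at hH'
    have e : ∀ ω, A.indicator 1 ω *
        Real.exp (∑ u ∈ Finset.Ioc s (t + 1), (H u).indicator (compExponent α μ X l k u) ω) =
        A.indicator 1 ω *
        Real.exp (∑ u ∈ Finset.Ioc s t, (H u).indicator (compExponent α μ X l k u) ω) *
        Real.exp ((H (t + 1)).indicator (compExponent α μ X l k (t + 1)) ω) := by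
      intro ω
      rw [Finset.sum_Ioc_succ_top hst, Real.exp_add, mul_assoc]
    simp only [e]
    refine ⟨?_, ⟨B * Real.exp (|l| * α), fun ω => ⟨mul_nonneg (hB ω).1 (Real.exp_pos _).le, ?_⟩⟩,
      ?_⟩
    · refine (hm.mono (ℱ.mono (Nat.le_succ t)) le_rfl).mul (Real.measurable_exp.comp ?_)
      refine Measurable.indicator ?_ (ℱ.mono (Nat.le_succ t) _ hH')
      unfold compExponent
      exact (((henv.reward_measurable_le (by omega) le_rfl k).sub
        (henv.mean_measurable_le (by omega) (by omega) k)).const_mul l).sub_const _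
    · refine mul_le_mul (hB ω).2 (Real.exp_le_exp.mpr ?_) (Real.exp_pos _).le
        ((hB ω).1.trans (hB ω).2)
      have h0 : 0 ≤ |l| * α := by positivity
      by_cases h : ω ∈ H (t + 1)
      · rw [Set.indicator_of_mem h]
        unfold compExponent
        have h1 : l * (X (t + 1) k ω - μ (t + 1) k ω) ≤ |l| * α := by
          refine (le_abs_self _).trans ?_
          rw [abs_mul]
          refine mul_le_mul_of_nonneg_left ?_ (abs_nonneg l)
          have h2 := henv.reward_mem t k ω
          have h3 := henv.mean_mem t k ω
          rw [abs_le]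
          constructor <;> linarith [h2.1, h2.2, h3.1, h3.2]
        have h2 : 0 ≤ l ^ 2 * α ^ 2 / 8 := by positivity
        linarith
      · rw [Set.indicator_of_notMem h]
        exact h0
    · exact (integral_mul_exp_indicator_le hα henv t k l hH' hm hB).trans hint

/-- Markov's inequality for the exponential. Restriction to the past event `A` keeps the factor `P
A`, which is later the probability of a restart. -/
lemma measure_inter_le_of_le_sum (hα : 0 < α) (henv : IsEnv P ℱ α μ X) (k : Fin K) (l : ℝ)
    {s : ℕ} {A : Set Ω} (hA : MeasurableSet[ℱ s] A) {H : ℕ → Set Ω}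
    (hH : ∀ u, s < u → MeasurableSet[ℱ (u - 1)] (H u)) (t : ℕ) (hst : s ≤ t) (L : ℝ) :
    P (A ∩ {ω | L ≤ ∑ u ∈ Finset.Ioc s t, (H u).indicator (compExponent α μ X l k u) ω}) ≤
      ENNReal.ofReal (Real.exp (-L)) * P A := by
  obtain ⟨hm, ⟨B, hB⟩, hint⟩ := integral_indicator_mul_exp_le hα henv k l hA hH t hst
  set Z : Ω → ℝ := fun ω => A.indicator 1 ω *
      Real.exp (∑ u ∈ Finset.Ioc s t, (H u).indicator (compExponent α μ X l k u) ω) with hZ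
  have hZint : Integrable Z P := Integrable.of_bound (hm.mono (ℱ.le t) le_rfl).aestronglyMeasurable
    B (Eventually.of_forall fun ω => by rw [Real.norm_of_nonneg (hB ω).1]; exact (hB ω).2)
  have h1 := mul_meas_ge_le_integral_of_nonneg (μ := P)
    (Eventually.of_forall fun ω => (hB ω).1) hZint (Real.exp L)
  have h2 : A ∩ {ω | L ≤ ∑ u ∈ Finset.Ioc s t, (H u).indicator (compExponent α μ X l k u) ω} ⊆
      {ω | Real.exp L ≤ Z ω} := by
    rintro ω ⟨hω, hω'⟩
    simp only [Set.mem_ofPred_eq, hZ, Set.indicator_of_mem hω, Pi.one_apply, one_mul] at hω' ⊢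
    exact Real.exp_le_exp.mpr hω'
  refine (measure_mono h2).trans ?_
  have h3 : P.real {ω | Real.exp L ≤ Z ω} ≤ Real.exp (-L) * P.real A := by
    rw [Real.exp_neg, ← div_eq_inv_mul, le_div_iff₀ (Real.exp_pos L), mul_comm]
    exact h1.trans hint
  rw [← ofReal_measureReal (μ := P) (s := A), ← ENNReal.ofReal_mul (Real.exp_pos _).le,
    ← ofReal_measureReal (μ := P)]
  exact ENNReal.ofReal_le_ofReal h3

end Hoeffding

section Concentration

/-! ### Concentration of the observed rewards -/

variable {Ω : Type*} {mΩ : MeasurableSpace Ω} {K : ℕ} {P : Measure Ω} [IsProbabilityMeasure P]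
  {ℱ : Filtration ℕ mΩ} {α : ℝ} {μ X : ℕ → Fin K → Ω → ℝ} {I : ℕ → Ω → Fin K}

lemma measurableSet_pull (hI : ∀ t, Measurable[ℱ t] (I (t + 1))) (k : Fin K) {u t : ℕ} (hu : 1 ≤ u)
    (hut : u ≤ t + 1) : MeasurableSet[ℱ t] {ω | I u ω = k} := by
  obtain ⟨v, rfl⟩ : ∃ v, u = v + 1 := ⟨u - 1, by omega⟩
  exact ℱ.mono (by omega) _ (hI v (measurableSet_singleton k))

lemma sum_indicator_compExponent (k : Fin K) (l : ℝ) (s t : ℕ) (ω : Ω) :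
    ∑ u ∈ Finset.Ioc s t, {ω | I u ω = k}.indicator (compExponent α μ X l k u) ω =
      l * noise (fun s => I s ω) (fun s => X s (I s ω) ω) (fun t k => μ t k ω) k s t -
        l ^ 2 * α ^ 2 / 8 * pulls (fun s => I s ω) k s t := by
  classical
  have h1 : (pulls (fun s => I s ω) k s t : ℝ) =
      ∑ u ∈ (Finset.Ioc s t).filter (fun u => I u ω = k), (1 : ℝ) := by
    simp [pulls]
  rw [h1, noise, Finset.mul_sum, Finset.mul_sum, ← Finset.sum_sub_distrib, Finset.sum_filter]
  refine Finset.sum_congr rfl fun u _ => ?_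
  simp only [Set.indicator_apply, Set.mem_ofPred_eq]
  split_ifs with h
  · rw [compExponent, h, mul_one]
  · rfl

omit [IsProbabilityMeasure P] in
lemma measurable_sum_indicator_compExponent (henv : IsEnv P ℱ α μ X)
    (hI : ∀ t, Measurable[ℱ t] (I (t + 1))) (k : Fin K) (l : ℝ) (s t : ℕ) :
    Measurable[ℱ t] (fun ω =>
      ∑ u ∈ Finset.Ioc s t, {ω | I u ω = k}.indicator (compExponent α μ X l k u) ω) := by
  refine Finset.measurable_sum _ fun u hu => ?_
  have hu := Finset.mem_Ioc.mp hu
  refine Measurable.indicator ?_ (measurableSet_pull hI k (by omega) (by omega))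
  unfold compExponent
  exact (((henv.reward_measurable_le (by omega) hu.2 k).sub
    (henv.mean_measurable_le (by omega) (by omega) k)).const_mul l).sub_const _

/-- Ville's inequality for the exponential supermartingale of an arm. -/
lemma measure_exists_le_sum_le (hα : 0 < α) (henv : IsEnv P ℱ α μ X)
    (hI : ∀ t, Measurable[ℱ t] (I (t + 1))) (k : Fin K) (l : ℝ) (s T : ℕ) (L : ℝ) :
    P {ω | ∃ t, s ≤ t ∧ t ≤ T ∧ L ≤
      ∑ u ∈ Finset.Ioc s t, {ω | I u ω = k}.indicator (compExponent α μ X l k u) ω} ≤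
      ENNReal.ofReal (Real.exp (-L)) := by
  classical
  rcases Nat.lt_or_ge T s with hTs | hsT
  · have : {ω | ∃ t, s ≤ t ∧ t ≤ T ∧ L ≤ ∑ u ∈ Finset.Ioc s t,
        {ω | I u ω = k}.indicator (compExponent α μ X l k u) ω} = ∅ := by
      ext ω
      simp only [Set.mem_ofPred_eq, Set.mem_empty_iff_false, iff_false]
      rintro ⟨t, h1, h2, -⟩
      omega
    rw [this]
    simp
  set W : ℕ → Ω → ℝ := fun t ω =>
    ∑ u ∈ Finset.Ioc s t, {ω | I u ω = k}.indicator (compExponent α μ X l k u) ω with hW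
  -- Sampling stops once the level `L` has been reached. The stopped sum at `T` equals the value at
  -- the first passage, so the estimate at a fixed time covers all times.
  set H : ℕ → Set Ω := fun u =>
    {ω | I u ω = k} ∩ ⋂ t ∈ Finset.Icc s (u - 1), {ω | W t ω < L} with hH
  have hHm : ∀ u, s < u → MeasurableSet[ℱ (u - 1)] (H u) := by
    intro u hu
    refine MeasurableSet.inter (measurableSet_pull hI k (by omega) (by omega)) ?_
    refine Finset.measurableSet_biInter _ fun t ht => ?_
    have ht := Finset.mem_Icc.mp ht
    exact ℱ.mono ht.2 _
      (measurableSet_lt (measurable_sum_indicator_compExponent henv hI k l s t) measurable_const)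
  have key := measure_inter_le_of_le_sum hα henv k l (MeasurableSet.univ (α := Ω)) hHm T hsT L
  rw [measure_univ, mul_one, Set.univ_inter] at key
  refine (measure_mono ?_).trans key
  intro ω hω
  have hex : ∃ t, s ≤ t ∧ t ≤ T ∧ L ≤ W t ω := hω
  obtain ⟨h1, h2, h3⟩ := Nat.find_spec hex
  set t₀ := Nat.find hex with ht₀
  have hmin : ∀ t, s ≤ t → t < t₀ → W t ω < L := by
    intro t hst ht
    by_contra hcon
    push Not at hcon
    exact Nat.find_min hex ht ⟨hst, by omega, hcon⟩
  refine h3.trans (le_of_eq ?_)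
  have e : Finset.Ioc s T = Finset.Ioc s t₀ ∪ Finset.Ioc t₀ T :=
    (Finset.Ioc_union_Ioc_eq_Ioc h1 h2).symm
  rw [e, Finset.sum_union]
  · have z : ∑ u ∈ Finset.Ioc t₀ T, (H u).indicator (compExponent α μ X l k u) ω = 0 := by
      refine Finset.sum_eq_zero fun u hu => Set.indicator_of_notMem ?_ _
      have hu := Finset.mem_Ioc.mp hu
      rintro ⟨-, h⟩
      have := Set.mem_iInter₂.mp h t₀ (Finset.mem_Icc.mpr ⟨h1, by omega⟩)
      exact absurd h3 (not_le.mpr this)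
    rw [z, add_zero]
    refine Finset.sum_congr rfl fun u hu => ?_
    have hu := Finset.mem_Ioc.mp hu
    have hiff : ω ∈ H u ↔ ω ∈ {ω | I u ω = k} := by
      refine ⟨fun h => h.1, fun h => ⟨h, Set.mem_iInter₂.mpr fun t ht => ?_⟩⟩
      have ht := Finset.mem_Icc.mp ht
      exact hmin t ht.1 (by omega)
    simp only [Set.indicator_apply, hiff]
  · rw [Finset.disjoint_left]
    intro u hu hu'
    simp only [Finset.mem_Ioc] at hu hu'
    omega

/-- Scale factors at which the exponential supermartingales are controlled. -/
noncomputable def gridScale (α z : ℝ) (T j : ℕ) : ℝ :=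
  Real.sqrt ((2 + z) * Real.log T / (α ^ 2 / 8)) / (1 + z) ^ j

/-- The concentration factor that is reached with the grid. -/
noncomputable def gridFactor (α z : ℝ) : ℝ :=
  Real.sqrt ((2 + z) ^ 3 * α ^ 2 / 12)

/-- The best scale for `n` pulls is proportional to `1 / √n`. With the grid point `p ≤ √n < (1 + z)
* p` in place of `√n`, the optimal factor 2 becomes `p / √n + √n / p ≤ 2 + z`. -/
lemma le_of_gridScale {z : ℝ} (hα : 0 < α) (hz : 0 < z) {T : ℕ} (hT : 2 ≤ T) {S : ℝ} {n : ℕ}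
    (hn : 1 ≤ n) {j : ℕ} (hj : (1 + z) ^ j ≤ Real.sqrt n) (hj' : Real.sqrt n < (1 + z) ^ (j + 1))
    (h : gridScale α z T j * S - gridScale α z T j ^ 2 * α ^ 2 / 8 * n < (2 + z) * Real.log T) :
    S ≤ gridFactor α z * Real.sqrt (3 / 2 * Real.log T * n) := by
  have hlog : 0 < Real.log T := Real.log_pos (by exact_mod_cast hT)
  set κ := α ^ 2 / 8 with hκ
  have hκ0 : 0 < κ := by positivity
  set L := (2 + z) * Real.log T with hL
  have hL0 : 0 < L := by positivity
  set p := (1 + z) ^ j with hp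
  have hp0 : 0 < p := by positivity
  set q := Real.sqrt n with hq
  have hq2 : q ^ 2 = n := Real.sq_sqrt (by positivity)
  have hq0 : 0 < q := lt_of_lt_of_le hp0 hj
  set g := Real.sqrt (L / κ) with hg
  have hg2 : g ^ 2 = L / κ := Real.sq_sqrt (by positivity)
  have hg0 : 0 < g := Real.sqrt_pos.mpr (by positivity)
  have hscale : gridScale α z T j = g / p := rfl
  rw [hscale] at h
  have hLg : L = κ * g ^ 2 := by rw [hg2]; field_simp
  have h1 : S ≤ κ * g * (p + q ^ 2 / p) := by
    have e1 : (g / p) ^ 2 * α ^ 2 / 8 * n = κ * g ^ 2 * q ^ 2 / p ^ 2 := by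
      rw [hq2, hκ]; field_simp
    rw [e1, hLg] at h
    have h2 : g / p * S < g / p * (κ * g * (p + q ^ 2 / p)) := by
      have : g / p * (κ * g * (p + q ^ 2 / p)) = κ * g ^ 2 + κ * g ^ 2 * q ^ 2 / p ^ 2 := by
        field_simp
      linarith
    exact (lt_of_mul_lt_mul_left h2 (by positivity)).le
  have h2 : p + q ^ 2 / p ≤ (2 + z) * q := by
    rw [pow_succ] at hj'
    have : q ^ 2 / p ≤ (1 + z) * q := by
      rw [div_le_iff₀ hp0]
      nlinarith
    linarith
  have h3 : gridFactor α z * Real.sqrt (3 / 2 * Real.log T * n) = κ * g * ((2 + z) * q) := by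
    rw [gridFactor, ← Real.sqrt_mul (by positivity), Real.sqrt_eq_iff_mul_self_eq
      (by positivity) (by positivity)]
    have e : κ * g * ((2 + z) * q) * (κ * g * ((2 + z) * q)) =
        (κ * g ^ 2) * κ * (2 + z) ^ 2 * q ^ 2 := by ring
    rw [e, ← hLg, hq2, hL, hκ]
    ring
  rw [h3]
  exact h1.trans (mul_le_mul_of_nonneg_left h2 (by positivity))

/-- Union bound over arms, window starts, grid points and signs; Ville's inequality covers the
window ends. There are `T` starts and logarithmically many grid points, the latter absorbed by `T ^
z`, against the probability `T ^ (-(2 + z))`; a factor `1 / T` remains. -/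
lemma measure_not_concentrated_le (hα : 0 < α) (henv : IsEnv P ℱ α μ X)
    (hI : ∀ t, Measurable[ℱ t] (I (t + 1))) {z : ℝ} (hz : 0 < z) {T : ℕ} (hT : 2 ≤ T) :
    P {ω | ¬ Concentrated (gridFactor α z) T (fun s => I s ω) (fun s => X s (I s ω) ω)
      (fun t k => μ t k ω)} ≤
      ENNReal.ofReal (2 * K * (1 / (z * Real.log (1 + z)) + 1) / T) := by
  classical
  have hT0 : (0 : ℝ) < T := by positivity
  have hT1 : (1 : ℝ) ≤ T := by exact_mod_cast (by omega : 1 ≤ T)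
  have hlz : 0 < Real.log (1 + z) := Real.log_pos (by linarith)
  have hlogT : 0 ≤ Real.log T := Real.log_nonneg hT1
  set L := (2 + z) * Real.log T with hL
  set J := ⌊Real.log T / Real.log (1 + z)⌋₊ with hJ
  set V : (Fin K × ℕ × ℕ × Bool) → Set Ω := fun c =>
    {ω | ∃ t, c.2.1 ≤ t ∧ t ≤ T ∧ L ≤ ∑ u ∈ Finset.Ioc c.2.1 t, {ω | I u ω = c.1}.indicator
      (compExponent α μ X ((if c.2.2.2 then 1 else -1) * gridScale α z T c.2.2.1) c.1 u) ω} with hV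
  set Q : Finset (Fin K × ℕ × ℕ × Bool) :=
    Finset.univ ×ˢ Finset.range T ×ˢ Finset.range (J + 1) ×ˢ Finset.univ with hQ
  have hsub : {ω | ¬ Concentrated (gridFactor α z) T (fun s => I s ω) (fun s => X s (I s ω) ω)
      (fun t k => μ t k ω)} ⊆ ⋃ c ∈ Q, V c := by
    intro ω hω
    by_contra hcon
    apply hω
    intro k s t htT
    set n := pulls (fun s => I s ω) k s t with hn
    rcases Nat.eq_zero_or_pos n with h0 | h0
    · have : (Finset.Ioc s t).filter (fun u => I u ω = k) = ∅ := Finset.card_eq_zero.mp h0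
      simp [noise, this, h0]
    have hst : s < t := by
      have := pulls_le (a := fun s => I s ω) (k := k) (s := s) (t := t)
      omega
    have hq1 : 1 ≤ Real.sqrt n := by
      rw [Real.one_le_sqrt]
      exact_mod_cast h0
    obtain ⟨j, hj1, hj2⟩ := exists_nat_pow_near hq1 (by linarith : 1 < 1 + z)
    have hnT : (n : ℝ) ≤ T := by
      have := pulls_le (a := fun s => I s ω) (k := k) (s := s) (t := t)
      exact_mod_cast (by omega : n ≤ T)
    have hjJ : j < J + 1 := by
      rw [Nat.lt_add_one_iff, hJ]
      apply Nat.le_floor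
      rw [le_div_iff₀ hlz, ← Real.log_pow]
      refine Real.log_le_log (by positivity) (hj1.trans ?_)
      rw [Real.sqrt_le_left (by positivity)]
      nlinarith
    have hsign : ∀ β : Bool, ((if β then 1 else -1) * gridScale α z T j) *
        noise (fun s => I s ω) (fun s => X s (I s ω) ω) (fun t k => μ t k ω) k s t -
        ((if β then 1 else -1) * gridScale α z T j) ^ 2 * α ^ 2 / 8 * n < L := by
      intro β
      by_contra hge
      push Not at hge
      apply hcon
      refine Set.mem_iUnion₂.mpr ⟨(k, s, j, β), ?_, t, hst.le, htT, ?_⟩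
      · simp only [hQ, Finset.mem_product, Finset.mem_univ, Finset.mem_range, true_and, and_true]
        exact ⟨by omega, hjJ⟩
      · simp only
        rw [sum_indicator_compExponent]
        exact hge
    have hp := hsign true
    have hm := hsign false
    simp only [if_true, one_mul, Bool.false_eq_true, if_false] at hp hm
    rw [abs_le]
    constructor
    · rw [neg_le]
      refine le_of_gridScale hα hz hT h0 hj1 hj2 (lt_of_le_of_lt (le_of_eq ?_) hm)
      ring
    · exact le_of_gridScale hα hz hT h0 hj1 hj2 hp
  refine (measure_mono hsub).trans ((measure_biUnion_finset_le _ _).trans ?_)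
  refine (Finset.sum_le_sum fun c _ =>
    measure_exists_le_sum_le hα henv hI c.1 _ c.2.1 T L).trans ?_
  rw [Finset.sum_const, nsmul_eq_mul]
  have hcard : (Q.card : ℝ) ≤ 2 * K * T * (T ^ z * (1 / (z * Real.log (1 + z)) + 1)) := by
    have h1 : Q.card = K * (T * ((J + 1) * 2)) := by
      simp [hQ, Finset.card_product]
    rw [h1]
    push_cast
    have h2 : (J : ℝ) ≤ Real.log T / Real.log (1 + z) := Nat.floor_le (by positivity)
    have h3 : Real.log T ≤ T ^ z / z := Real.log_le_rpow_div hT0.le hz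
    have h4 : (1 : ℝ) ≤ T ^ z := Real.one_le_rpow hT1 hz.le
    have h5 : (J : ℝ) ≤ T ^ z * (1 / (z * Real.log (1 + z))) := by
      refine h2.trans ?_
      rw [div_le_iff₀ hlz]
      refine h3.trans (le_of_eq ?_)
      field_simp
    have h6 : (J : ℝ) + 1 ≤ T ^ z * (1 / (z * Real.log (1 + z)) + 1) := by linarith
    calc (K : ℝ) * (T * ((J + 1) * 2)) = 2 * K * T * (J + 1) := by ring
      _ ≤ _ := by gcongr
  have hexp : Real.exp (-L) = (T : ℝ) ^ (-(2 + z)) := by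
    rw [Real.rpow_def_of_pos hT0, hL]; congr 1; ring
  have e : ((Q.card : ℕ) : ℝ≥0∞) = ENNReal.ofReal (Q.card : ℝ) := (ENNReal.ofReal_natCast _).symm
  rw [e, ← ENNReal.ofReal_mul (by positivity)]
  apply ENNReal.ofReal_le_ofReal
  rw [hexp]
  calc (Q.card : ℝ) * (T : ℝ) ^ (-(2 + z)) ≤
        2 * K * T * (T ^ z * (1 / (z * Real.log (1 + z)) + 1)) * (T : ℝ) ^ (-(2 + z)) :=
        mul_le_mul_of_nonneg_right hcard (by positivity)
    _ = 2 * K * (1 / (z * Real.log (1 + z)) + 1) * (T * (T ^ z * (T : ℝ) ^ (-(2 + z)))) := by ring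
    _ = _ := by
      rw [← Real.rpow_add hT0, show z + -(2 + z) = -2 by ring, Real.rpow_neg hT0.le,
        show (2 : ℝ) = ((2 : ℕ) : ℝ) by norm_num, Real.rpow_natCast]
      field_simp

/-- For a fixed pull count the exponent is `4 * log τ / α ^ 2 ≥ 8 / 3 * log τ`. The union over the
at most `τ` counts costs one power, and `τ ^ (-5/3)` is summable. -/
lemma measure_inter_fails_le (hα : 0 < α) (hα' : α ^ 2 < 3 / 2) (henv : IsEnv P ℱ α μ X)
    (hI : ∀ t, Measurable[ℱ t] (I (t + 1))) {ρ τ : ℕ} (hτ : 1 ≤ τ) {A : Set Ω}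
    (hA : MeasurableSet[ℱ ρ] A) :
    P (A ∩ {ω | Fails (fun s => I s ω) (fun s => X s (I s ω) ω) (fun t k => μ t k ω) ρ τ}) ≤
      ENNReal.ofReal (K * (τ : ℝ) ^ (-(5 / 3) : ℝ)) * P A := by
  classical
  have hτ0 : (0 : ℝ) < τ := by exact_mod_cast hτ
  have hlog : 0 ≤ Real.log τ := Real.log_natCast_nonneg τ
  set κ := α ^ 2 / 8 with hκ
  have hκ0 : 0 < κ := by positivity
  -- The maximiser of `l * S - l ^ 2 * κ * n` at the boundary of failure, `S = -√(2 log τ n)`.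
  set l : ℕ → ℝ := fun n => -(Real.sqrt (2 * Real.log τ * n) / (2 * n * κ)) with hl
  set V : Fin K × ℕ → Set Ω := fun c => A ∩ {ω | 8 / 3 * Real.log τ ≤
    ∑ u ∈ Finset.Ioc ρ (ρ + τ - 1),
      {ω | I u ω = c.1}.indicator (compExponent α μ X (l c.2) c.1 u) ω} with hV
  have hsub : A ∩ {ω | Fails (fun s => I s ω) (fun s => X s (I s ω) ω)
      (fun t k => μ t k ω) ρ τ} ⊆
      ⋃ c ∈ (Finset.univ : Finset (Fin K)) ×ˢ Finset.Icc 1 τ, V c := by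
    rintro ω ⟨hωA, k, hn, hS⟩
    set n := pulls (fun s => I s ω) k ρ (ρ + τ - 1) with hnd
    refine Set.mem_iUnion₂.mpr ⟨(k, n), ?_, hωA, ?_⟩
    · simp only [Finset.mem_product, Finset.mem_univ, Finset.mem_Icc, true_and]
      have := pulls_le (a := fun s => I s ω) (k := k) (s := ρ) (t := ρ + τ - 1)
      omega
    · have hn0 : (0 : ℝ) < n := by exact_mod_cast hn
      simp only [Set.mem_ofPred_eq]
      rw [sum_indicator_compExponent, ← hnd]
      set S := noise (fun s => I s ω) (fun s => X s (I s ω) ω) (fun t k => μ t k ω) k ρ (ρ + τ - 1)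
      set r := Real.sqrt (2 * Real.log τ * n) with hr
      have hr2 : r ^ 2 = 2 * Real.log τ * n := Real.sq_sqrt (by positivity)
      have hr0 : 0 ≤ r := Real.sqrt_nonneg _
      have hln : l n = -(r / (2 * n * κ)) := rfl
      have h1 : r / (2 * n * κ) * r ≤ l n * S := by
        rw [hln, neg_mul, ← mul_neg]
        exact mul_le_mul_of_nonneg_left (by linarith) (by positivity)
      have h2 : r / (2 * n * κ) * r = Real.log τ / κ := by
        rw [div_mul_eq_mul_div, ← sq, hr2]; field_simp
      have h3 : l n ^ 2 * α ^ 2 / 8 * n = Real.log τ / κ / 2 := by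
        have : l n ^ 2 * α ^ 2 / 8 * n = r ^ 2 / (4 * n * κ) := by
          rw [hln, mul_div_assoc, ← hκ]; field_simp; ring
        rw [this, hr2]; field_simp; ring
      have h4 : 8 / 3 * Real.log τ ≤ Real.log τ / κ / 2 := by
        rw [div_div, le_div_iff₀ (by positivity)]
        have : 8 / 3 * (κ * 2) ≤ 1 := by rw [hκ]; linarith
        nlinarith
      linarith
  refine (measure_mono hsub).trans ((measure_biUnion_finset_le _ _).trans ?_)
  refine (Finset.sum_le_sum fun c _ => measure_inter_le_of_le_sum hα henv c.1 (l c.2) hA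
    (fun u hu => measurableSet_pull hI c.1 (by omega) (by omega)) (ρ + τ - 1) (by omega)
    (8 / 3 * Real.log τ)).trans ?_
  rw [Finset.sum_const, nsmul_eq_mul, Finset.card_product, Finset.card_univ, Fintype.card_fin,
    Nat.card_Icc, Nat.add_sub_cancel, ← mul_assoc]
  refine mul_le_mul_left ?_ _
  rw [← ENNReal.ofReal_natCast, ← ENNReal.ofReal_mul (by positivity)]
  apply ENNReal.ofReal_le_ofReal
  have hexp : Real.exp (-(8 / 3 * Real.log τ)) = (τ : ℝ) ^ (-(8 / 3) : ℝ) := by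
    rw [Real.rpow_def_of_pos hτ0]; congr 1; ring
  rw [hexp]
  push_cast
  rw [mul_assoc]
  refine mul_le_mul_of_nonneg_left (le_of_eq ?_) (by positivity)
  nth_rewrite 1 [← Real.rpow_one (τ : ℝ)]
  rw [← Real.rpow_add hτ0]
  norm_num

end Concentration

section Measurability

/-! ### Resets are determined by the past -/

variable {Ω : Type*} {mΩ : MeasurableSpace Ω} {K : ℕ} {P : Measure Ω}
  {ℱ : Filtration ℕ mΩ} {α δ : ℝ} {μ X : ℕ → Fin K → Ω → ℝ} {I : ℕ → Ω → Fin K}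

lemma measurable_pulls (hI : ∀ t, Measurable[ℱ t] (I (t + 1))) (k : Fin K) {s t r : ℕ}
    (htr : t ≤ r) : Measurable[ℱ r] (fun ω => pulls (fun u => I u ω) k s t) := by
  classical
  unfold pulls
  simp only [Finset.card_filter]
  refine Finset.measurable_sum _ fun u hu => ?_
  have hu := Finset.mem_Ioc.mp hu
  exact Measurable.ite (measurableSet_pull hI k (by omega) (by omega)) measurable_const
    measurable_const

lemma measurable_empMean (henv : IsEnv P ℱ α μ X) (hI : ∀ t, Measurable[ℱ t] (I (t + 1)))
    (k : Fin K) {s t r : ℕ} (htr : t ≤ r) :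
    Measurable[ℱ r] (fun ω => empMean (fun u => I u ω) (fun u => X u (I u ω) ω) k s t) := by
  classical
  unfold empMean
  refine Measurable.div ?_ (measurable_from_nat.comp (measurable_pulls hI k htr))
  have e : ∀ ω, ∑ u ∈ (Finset.Ioc s t).filter (fun u => I u ω = k), X u (I u ω) ω =
      ∑ u ∈ Finset.Ioc s t, if I u ω = k then X u k ω else 0 := by
    intro ω
    rw [Finset.sum_filter]
    refine Finset.sum_congr rfl fun u _ => ?_
    split_ifs with h
    · rw [h]
    · rfl
  simp only [e]
  refine Finset.measurable_sum _ fun u hu => ?_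
  have hu := Finset.mem_Ioc.mp hu
  exact Measurable.ite (measurableSet_pull hI k (by omega) (by omega))
    (henv.reward_measurable_le (by omega) (by omega) k) measurable_const

lemma measurableSet_detects (henv : IsEnv P ℱ α μ X) (hI : ∀ t, Measurable[ℱ t] (I (t + 1)))
    (s t : ℕ) :
    MeasurableSet[ℱ t] {ω | Detects δ (fun u => I u ω) (fun u => X u (I u ω) ω) s t} := by
  have e : {ω | Detects δ (fun u => I u ω) (fun u => X u (I u ω) ω) s t} =
      ⋃ k : Fin K, ⋃ u ∈ Finset.Ioo s t,
        ({ω | 0 < pulls (fun u => I u ω) k s u} ∩ {ω | 0 < pulls (fun u => I u ω) k u t}) ∩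
        {ω | cut δ (pulls (fun u => I u ω) k s u) (pulls (fun u => I u ω) k u t) ≤
          |empMean (fun u => I u ω) (fun u => X u (I u ω) ω) k s u -
            empMean (fun u => I u ω) (fun u => X u (I u ω) ω) k u t|} := by
    ext ω
    simp only [Detects, Set.mem_ofPred_eq, Set.mem_iUnion, Finset.mem_Ioo, Set.mem_inter_iff,
      exists_prop]
    constructor
    · rintro ⟨k, u, h1, h2, h3, h4, h5⟩
      exact ⟨k, u, ⟨h1, h2⟩, ⟨h3, h4⟩, h5⟩
    · rintro ⟨k, u, ⟨h1, h2⟩, ⟨h3, h4⟩, h5⟩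
      exact ⟨k, u, h1, h2, h3, h4, h5⟩
  rw [e]
  refine MeasurableSet.iUnion fun k => Finset.measurableSet_biUnion _ fun u hu => ?_
  have hu := (Finset.mem_Ioo.mp hu).2.le
  have m1 := measurable_pulls hI k (s := s) hu
  have m2 := measurable_pulls hI k (s := u) (le_refl t)
  have m5 : Measurable[ℱ t]
      (fun ω => cut δ (pulls (fun u => I u ω) k s u) (pulls (fun u => I u ω) k u t)) := by
    have h : Measurable (Function.uncurry (cut δ)) := measurable_of_countable _
    have h' := h.comp (m1.prodMk m2)
    exact h'
  refine MeasurableSet.inter (MeasurableSet.inter (measurableSet_lt measurable_const m1)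
    (measurableSet_lt measurable_const m2)) (measurableSet_le m5 ?_)
  · have m3 := measurable_empMean henv hI k (s := s) hu
    have m4 := measurable_empMean henv hI k (s := u) (le_refl t)
    have m6 := continuous_abs.measurable.comp (m3.sub m4)
    exact m6

lemma measurableSet_isReset_of_lastReset (henv : IsEnv P ℱ α μ X)
    (hI : ∀ t, Measurable[ℱ t] (I (t + 1))) {t : ℕ}
    (h : Measurable[ℱ t] (fun ω => lastReset δ (fun u => I u ω) (fun u => X u (I u ω) ω) t)) :
    MeasurableSet[ℱ t] {ω | IsReset δ (fun u => I u ω) (fun u => X u (I u ω) ω) t} := by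
  have e : {ω | IsReset δ (fun u => I u ω) (fun u => X u (I u ω) ω) t} =
      ⋃ s : ℕ, {ω | lastReset δ (fun u => I u ω) (fun u => X u (I u ω) ω) t = s} ∩
        {ω | Detects δ (fun u => I u ω) (fun u => X u (I u ω) ω) s t} := by
    ext ω
    simp [IsReset]
  rw [e]
  exact MeasurableSet.iUnion fun s => MeasurableSet.inter (h (measurableSet_singleton s))
    (measurableSet_detects henv hI s t)

lemma measurable_lastReset (henv : IsEnv P ℱ α μ X) (hI : ∀ t, Measurable[ℱ t] (I (t + 1)))
    (t : ℕ) :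
    Measurable[ℱ t] (fun ω => lastReset δ (fun u => I u ω) (fun u => X u (I u ω) ω) t) := by
  classical
  induction t with
  | zero => exact measurable_const
  | succ t ih =>
    have h1 := measurableSet_isReset_of_lastReset (δ := δ) henv hI ih
    have h2 : Measurable[ℱ t]
        (fun ω => lastReset δ (fun u => I u ω) (fun u => X u (I u ω) ω) (t + 1)) := by
      simp only [lastReset_succ]
      exact Measurable.ite h1 measurable_const ih
    exact h2.mono (ℱ.mono (Nat.le_succ t)) le_rfl

/-- A restart at `ρ` is decided by the data up to `ρ`, so it may serve as the past event in the
failure estimate. -/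
lemma measurableSet_mem_starts (henv : IsEnv P ℱ α μ X) (hI : ∀ t, Measurable[ℱ t] (I (t + 1)))
    (T ρ : ℕ) :
    MeasurableSet[ℱ ρ] {ω | ρ ∈ starts δ (fun u => I u ω) (fun u => X u (I u ω) ω) T} := by
  have h1 := measurableSet_isReset_of_lastReset (δ := δ) henv hI (measurable_lastReset henv hI ρ)
  simp only [starts, Finset.mem_insert, mem_resets]
  exact (MeasurableSet.const _).union ((MeasurableSet.const _).inter h1)

end Measurability

section FailExpectation

/-! ### Expected number of underestimating indices -/

/-- The sets need not be measurable; replacing them by measurable hulls of equal measure can only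
increase the integral. -/
lemma lintegral_sum_indicator_le {Ω ι : Type*} {mΩ : MeasurableSpace Ω} (P : Measure Ω)
    (s : Finset ι) (S : ι → Set Ω) (c : ι → ℝ≥0∞) :
    ∫⁻ ω, ∑ j ∈ s, (S j).indicator (fun _ => c j) ω ∂P ≤ ∑ j ∈ s, c j * P (S j) := by
  calc _ ≤ ∫⁻ ω, ∑ j ∈ s, (toMeasurable P (S j)).indicator (fun _ => c j) ω ∂P :=
        lintegral_mono fun ω => Finset.sum_le_sum fun j _ =>
          Set.indicator_le_indicator_of_subset (subset_toMeasurable P (S j)) (fun _ => zero_le) ω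
    _ = ∑ j ∈ s, c j * P (S j) := by
        rw [lintegral_finsetSum _ fun j _ =>
          measurable_const.indicator (measurableSet_toMeasurable P (S j))]
        refine Finset.sum_congr rfl fun j _ => ?_
        rw [lintegral_indicator_const (measurableSet_toMeasurable P (S j)), measure_toMeasurable]

variable {Ω : Type*} {mΩ : MeasurableSpace Ω} {K : ℕ} {P : Measure Ω} [IsProbabilityMeasure P]
  {ℱ : Filtration ℕ mΩ} {α δ : ℝ} {μ X : ℕ → Fin K → Ω → ℝ} {I : ℕ → Ω → Fin K}

lemma starts_subset_range {a : ℕ → Fin K} {x : ℕ → ℝ} {T : ℕ} (hT : 1 ≤ T) :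
    starts δ a x T ⊆ Finset.range T := by
  intro ρ hρ
  rcases Finset.mem_insert.mp hρ with rfl | h
  · exact Finset.mem_range.mpr hT
  · exact Finset.mem_range.mpr (mem_resets.mp h).1

/-- The sum is the expected number of restarts: at most `R` on `G`, and at most `T` off `G`, which
has probability at most `CB / T`. -/
lemma sum_measure_mem_starts_le (henv : IsEnv P ℱ α μ X) (hI : ∀ t, Measurable[ℱ t] (I (t + 1)))
    {T : ℕ} (hT : 1 ≤ T) {R CB : ℝ} {G : Set Ω} (hG : P Gᶜ ≤ ENNReal.ofReal (CB / T))
    (h : ∀ᵐ ω ∂P, ω ∈ G →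
      ((starts δ (fun u => I u ω) (fun u => X u (I u ω) ω) T).card : ℝ) ≤ R) :
    ∑ ρ ∈ Finset.range T,
      P {ω | ρ ∈ starts δ (fun u => I u ω) (fun u => X u (I u ω) ω) T} ≤
      ENNReal.ofReal R + ENNReal.ofReal CB := by
  classical
  set A : ℕ → Set Ω := fun ρ => {ω | ρ ∈ starts δ (fun u => I u ω) (fun u => X u (I u ω) ω) T}
    with hA
  have hAm : ∀ ρ, MeasurableSet (A ρ) := fun ρ => ℱ.le ρ _ (measurableSet_mem_starts henv hI T ρ)
  have e : ∑ ρ ∈ Finset.range T, P (A ρ) =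
      ∫⁻ ω, ∑ ρ ∈ Finset.range T, (A ρ).indicator 1 ω ∂P := by
    rw [lintegral_finsetSum _ fun ρ _ => measurable_one.indicator (hAm ρ)]
    exact Finset.sum_congr rfl fun ρ _ => (lintegral_indicator_one (hAm ρ)).symm
  have hcard : ∀ ω, ∑ ρ ∈ Finset.range T, (A ρ).indicator (1 : Ω → ℝ≥0∞) ω =
      ((starts δ (fun u => I u ω) (fun u => X u (I u ω) ω) T).card : ℝ≥0∞) := by
    intro ω
    simp only [hA, Set.indicator_apply, Set.mem_ofPred_eq, Pi.one_apply, Finset.sum_boole]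
    congr 2
    ext ρ
    simp only [Finset.mem_filter, and_iff_right_iff_imp]
    exact fun hρ => starts_subset_range hT hρ
  rw [e]
  have hT0 : (0 : ℝ) < T := by exact_mod_cast hT
  calc _ ≤ ∫⁻ ω, (ENNReal.ofReal R + (toMeasurable P Gᶜ).indicator (fun _ => (T : ℝ≥0∞)) ω) ∂P := by
        refine lintegral_mono_ae ?_
        filter_upwards [h] with ω hω
        rw [hcard]
        by_cases hg : ω ∈ G
        · refine le_add_right ?_
          rw [← ENNReal.ofReal_natCast]
          exact ENNReal.ofReal_le_ofReal (hω hg)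
        · rw [Set.indicator_of_mem (subset_toMeasurable P Gᶜ hg)]
          refine le_add_left ?_
          have := Finset.card_le_card (starts_subset_range (δ := δ) (a := fun u => I u ω)
            (x := fun u => X u (I u ω) ω) hT)
          rw [Finset.card_range] at this
          exact_mod_cast this
    _ = ENNReal.ofReal R + T * P Gᶜ := by
        rw [lintegral_add_left measurable_const, lintegral_const, measure_univ, mul_one,
          lintegral_indicator_const (measurableSet_toMeasurable P _), measure_toMeasurable]
    _ ≤ _ := by
        gcongr
        calc (T : ℝ≥0∞) * P Gᶜ ≤ ENNReal.ofReal T * ENNReal.ofReal (CB / T) := by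
              rw [ENNReal.ofReal_natCast]; gcongr
          _ = ENNReal.ofReal CB := by
              rw [← ENNReal.ofReal_mul hT0.le]; congr 1; field_simp

/-- Given a restart at `ρ`, the failure probabilities are summable in `τ`. Hence each restart causes
a bounded expected number of failures. -/
lemma lintegral_sum_failCount_le (hα : 0 < α) (hα' : α ^ 2 < 3 / 2) (henv : IsEnv P ℱ α μ X)
    (hI : ∀ t, Measurable[ℱ t] (I (t + 1))) {T : ℕ} (hT : 1 ≤ T) {R CB : ℝ} (hR : 0 ≤ R)
    (hCB : 0 ≤ CB) {G : Set Ω} (hG : P Gᶜ ≤ ENNReal.ofReal (CB / T))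
    (h : ∀ᵐ ω ∂P, ω ∈ G →
      ((starts δ (fun u => I u ω) (fun u => X u (I u ω) ω) T).card : ℝ) ≤ R) :
    ∫⁻ ω, ENNReal.ofReal (∑ ρ ∈ starts δ (fun u => I u ω) (fun u => X u (I u ω) ω) T,
      (failCount (fun u => I u ω) (fun u => X u (I u ω) ω) (fun t k => μ t k ω) T ρ : ℝ)) ∂P ≤
      ENNReal.ofReal (K * (∑' τ : ℕ, (τ : ℝ) ^ (-(5 / 3) : ℝ)) * (R + CB)) := by
  classical
  set A : ℕ → Set Ω := fun ρ => {ω | ρ ∈ starts δ (fun u => I u ω) (fun u => X u (I u ω) ω) T}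
    with hA
  set E : ℕ → ℕ → Set Ω := fun ρ τ => {ω | Fails (fun s => I s ω) (fun s => X s (I s ω) ω)
    (fun t k => μ t k ω) ρ τ} with hE
  have hpt : ∀ ω, ENNReal.ofReal (∑ ρ ∈ starts δ (fun u => I u ω) (fun u => X u (I u ω) ω) T,
      (failCount (fun u => I u ω) (fun u => X u (I u ω) ω) (fun t k => μ t k ω) T ρ : ℝ)) =
      ∑ c ∈ Finset.range T ×ˢ Finset.Icc 1 T, (A c.1 ∩ E c.1 c.2).indicator (fun _ => 1) ω := by
    intro ω
    rw [← Nat.cast_sum, ENNReal.ofReal_natCast, Finset.sum_product, Nat.cast_sum,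
      ← Finset.sum_subset (starts_subset_range (δ := δ) (a := fun u => I u ω)
        (x := fun u => X u (I u ω) ω) hT)]
    · refine Finset.sum_congr rfl fun ρ hρ => ?_
      rw [failCount, Finset.card_filter]
      push_cast
      refine Finset.sum_congr rfl fun τ _ => ?_
      simp only [hA, hE, Set.indicator_apply, Set.mem_inter_iff, Set.mem_ofPred_eq, hρ, true_and]
    · intro ρ _ hρ
      refine Finset.sum_eq_zero fun τ _ => Set.indicator_of_notMem ?_ _
      exact fun hω => hρ hω.1
  simp only [hpt]
  refine (lintegral_sum_indicator_le P _ _ _).trans ?_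
  simp only [one_mul]
  rw [Finset.sum_product]
  have hsum : Summable fun τ : ℕ => (τ : ℝ) ^ (-(5 / 3) : ℝ) :=
    Real.summable_nat_rpow.mpr (by norm_num)
  have hS0 : 0 ≤ ∑' τ : ℕ, (τ : ℝ) ^ (-(5 / 3) : ℝ) := tsum_nonneg fun τ => by positivity
  have h1 : ∀ ρ ∈ Finset.range T, ∑ τ ∈ Finset.Icc 1 T, P (A ρ ∩ E ρ τ) ≤
      ENNReal.ofReal (K * ∑' τ : ℕ, (τ : ℝ) ^ (-(5 / 3) : ℝ)) * P (A ρ) := by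
    intro ρ _
    refine (Finset.sum_le_sum fun τ hτ => measure_inter_fails_le hα hα' henv hI
      (Finset.mem_Icc.mp hτ).1 (measurableSet_mem_starts henv hI T ρ)).trans ?_
    rw [← Finset.sum_mul, ← ENNReal.ofReal_sum_of_nonneg fun τ _ => by positivity,
      ← Finset.mul_sum]
    gcongr
    exact hsum.sum_le_tsum _ fun τ _ => by positivity
  refine (Finset.sum_le_sum h1).trans ?_
  rw [← Finset.mul_sum, ENNReal.ofReal_mul (p := K * _) (by positivity), ENNReal.ofReal_add hR hCB]
  gcongr
  exact sum_measure_mem_starts_le henv hI hT hG h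

end FailExpectation

/-! ### Choice of parameters and conclusion -/

section Rates

/-! ### Rates -/

/-- With `w` of order `B⁻²`, the noise `√(log T / w)` is of order `q * B` and the drift `b * K * w`
of order `K * B`. -/
lemma blockVar_le {b c B q : ℝ} {K T w : ℕ} (hc : 0 < c) (hB : 0 < B) (hB1 : B ≤ 1)
    (hb : b = B ^ 3) (hq : 4 / 5 ≤ q) (hlog : Real.log T = q ^ 2) (hw1 : 1 / B ^ 2 ≤ w)
    (hw2 : (w : ℝ) ≤ 2 / B ^ 2) :
    blockVar b c K T w ≤ (12 * K + 2 / c * (10 + 4 * K) + 2) * (q * B) := by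
  have hB2 : 0 < B ^ 2 := by positivity
  have h1 : b * (K * w) ≤ 2 * K * B := by
    have : b * w ≤ 2 * B := by
      rw [hb]
      calc B ^ 3 * w ≤ B ^ 3 * (2 / B ^ 2) := mul_le_mul_of_nonneg_left hw2 (by positivity)
        _ = 2 * B := by field_simp
    have hK : (0 : ℝ) ≤ K := by positivity
    nlinarith
  have hw0 : (0 : ℝ) < w := lt_of_lt_of_le (by positivity) hw1
  have h2 : Real.sqrt (3 / 2 * Real.log T / w) ≤ 2 * (q * B) := by
    rw [Real.sqrt_le_left (by positivity), hlog, div_le_iff₀ hw0]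
    rw [div_le_iff₀ hB2] at hw1
    nlinarith [sq_nonneg q]
  have h3 : b ≤ B := by
    rw [hb]
    calc B ^ 3 ≤ B ^ 1 := pow_le_pow_of_le_one hB.le hB1 (by norm_num)
      _ = B := pow_one B
  have h4 : B ≤ 2 * (q * B) := by nlinarith
  have h5 : (K : ℝ) * B ≤ K * (2 * (q * B)) := mul_le_mul_of_nonneg_left h4 (by positivity)
  unfold blockVar
  have h6 : 2 / c * (5 * Real.sqrt (3 / 2 * Real.log T / w) + b * (K * w)) ≤
      2 / c * ((10 + 4 * K) * (q * B)) := by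
    refine mul_le_mul_of_nonneg_left ?_ (by positivity)
    linarith
  linarith

lemma maxDrift_le {b c B q C_N : ℝ} {K N T w : ℕ} (hc : 0 < c) (hB : 0 < B) (hB1 : B ≤ 1)
    (hb : b = B ^ 3) (hq : 4 / 5 ≤ q) (hlog : Real.log T = q ^ 2) (hw1 : 1 / B ^ 2 ≤ w)
    (hw2 : (w : ℝ) ≤ 2 / B ^ 2) (hN : b * (K * N) ≤ |C_N| * K * B) :
    maxDrift b c K N T w ≤
      (4 * |C_N| * K + 4 * (12 * K + 2 / c * (10 + 4 * K) + 2) + 4) * (B * q ^ 3) := by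
  have h1 := blockVar_le (K := K) hc hB hB1 hb hq hlog hw1 hw2
  set Cb := 12 * K + 2 / c * (10 + 4 * K) + 2 with hCb
  have hCb0 : 0 ≤ Cb := by positivity
  have hq3 : 1 ≤ 2 * q ^ 3 := by
    have : (4 / 5 : ℝ) ^ 3 ≤ q ^ 3 := pow_le_pow_left₀ (by norm_num) hq 3
    norm_num at this
    linarith
  have h3 : b ≤ B := by
    rw [hb]
    calc B ^ 3 ≤ B ^ 1 := pow_le_pow_of_le_one hB.le hB1 (by norm_num)
      _ = B := pow_one B
  have hlog2 : 1 / 2 ≤ Real.log 2 := by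
    have := Real.log_two_gt_d9
    linarith
  have h4 : Real.log T / Real.log 2 ≤ 2 * q ^ 2 := by
    rw [hlog, div_le_iff₀ (by linarith)]
    nlinarith [sq_nonneg q]
  have h5 : Real.log T / Real.log 2 * blockVar b c K T w ≤ 2 * q ^ 2 * (Cb * (q * B)) := by
    refine mul_le_mul h4 h1 (blockVar_nonneg (by rw [hb]; positivity) hc) (by positivity)
  have h6 : B ≤ 2 * (B * q ^ 3) := by nlinarith
  have h7 : |C_N| * K * B ≤ |C_N| * K * (2 * (B * q ^ 3)) :=
    mul_le_mul_of_nonneg_left h6 (by positivity)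
  unfold maxDrift
  calc 2 * (b * (K * N) + Real.log T / Real.log 2 * blockVar b c K T w + b) ≤
      2 * (|C_N| * K * (2 * (B * q ^ 3)) + 2 * q ^ 2 * (Cb * (q * B)) + 2 * (B * q ^ 3)) := by
        linarith
    _ = _ := by ring

/-- The limit on `N` is what keeps the drift in the unmonitored first block at the order `(b * K) ^
(1/3)`. -/
lemma mul_blockLength_le {b B C_N : ℝ} {K N : ℕ} (hK : 1 ≤ K) (hB : 0 < B) (hb : b = B ^ 3)
    (hN : (N : ℝ) ≤ C_N * (b * K) ^ (-(2 / 3) : ℝ)) : b * (K * N) ≤ |C_N| * K * B := by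
  have hK1 : (1 : ℝ) ≤ K := by exact_mod_cast hK
  have hb0 : 0 < b := by rw [hb]; positivity
  have hbK : 0 < b * K := by positivity
  have h1 : b * K * (b * K) ^ (-(2 / 3) : ℝ) = (b * K) ^ (1 / 3 : ℝ) := by
    nth_rewrite 1 [← Real.rpow_one (b * K)]
    rw [← Real.rpow_add hbK]
    norm_num
  have h2 : (b * K) ^ (1 / 3 : ℝ) ≤ K * B := by
    rw [Real.mul_rpow hb0.le (by positivity), mul_comm]
    have e : b ^ (1 / 3 : ℝ) = B := by
      rw [hb, ← Real.rpow_natCast, ← Real.rpow_mul hB.le]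
      norm_num
    rw [e]
    refine mul_le_mul_of_nonneg_right ?_ hB.le
    calc (K : ℝ) ^ (1 / 3 : ℝ) ≤ (K : ℝ) ^ (1 : ℝ) :=
          Real.rpow_le_rpow_of_exponent_le hK1 (by norm_num)
      _ = K := Real.rpow_one _
  calc b * (K * N) = b * K * N := by ring
    _ ≤ b * K * (C_N * (b * K) ^ (-(2 / 3) : ℝ)) := mul_le_mul_of_nonneg_left hN hbK.le
    _ = C_N * (b * K) ^ (1 / 3 : ℝ) := by rw [← h1]; ring
    _ ≤ |C_N| * (b * K) ^ (1 / 3 : ℝ) :=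
        mul_le_mul_of_nonneg_right (le_abs_self _) (by positivity)
    _ ≤ |C_N| * (K * B) := mul_le_mul_of_nonneg_left h2 (abs_nonneg _)
    _ = _ := by ring

/-- The terms of the regret bound are dominated by `σ * q + σ ^ 2 * B * q ^ 3`, where `σ = √T` and
`q = √(log T)`. -/
lemma exists_rate_bound {M₀ M₁ a₁ a₂ a₃ a₄ a₅ g : ℝ} (hM₀ : 0 ≤ M₀) (hM₁ : 0 ≤ M₁) (h₁ : 0 ≤ a₁)
    (h₂ : 0 ≤ a₂) (h₃ : 0 ≤ a₃) (h₄ : 0 ≤ a₄) (h₅ : 0 ≤ a₅) (hg : 0 < g) :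
    ∃ C : ℝ, 0 < C ∧ ∀ B q σ : ℝ, 0 < B → B ≤ 1 → 4 / 5 ≤ q → q ≤ σ → 7 / 5 ≤ σ →
      M₀ * (a₁ * (B * q ^ 3) * σ ^ 2 +
          a₂ * q * ((B + 1 / σ) * σ ^ 2 + 2 * (M₁ + B ^ 2 * σ ^ 2 / g) / (B + 1 / σ)) +
          a₃ * (1 + q ^ 2) * ((M₁ + B ^ 2 * σ ^ 2 / g) +
            a₄ * ((M₁ + B ^ 2 * σ ^ 2 / g) + a₅))) + a₅ ≤
        C * (σ * q + σ ^ 2 * B * q ^ 3) := by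
  set C₃ := 3 * a₃ * (M₁ + 2 / g + a₄ * (M₁ + 2 / g + a₅)) with hC₃
  refine ⟨M₀ * (a₁ + a₂ * (1 + 2 + 2 * M₁ + 4 / g) + C₃) + a₅ + 1, by positivity, ?_⟩
  intro B q σ hB hB1 hq hqσ hσ
  have hσ0 : 0 < σ := by linarith
  have hq0 : 0 < q := by linarith
  set U := σ * q with hU
  set V := σ ^ 2 * B * q ^ 3 with hV
  have hU1 : 1 ≤ U := by nlinarith
  have hV0 : 0 ≤ V := by positivity
  have hq2 : 1 ≤ 2 * q ^ 2 := by nlinarith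
  have e1 : a₁ * (B * q ^ 3) * σ ^ 2 = a₁ * V := by rw [hV]; ring
  have hqB : q * (B * σ ^ 2) ≤ 2 * V := by
    have : 0 ≤ q * (B * σ ^ 2) := by positivity
    calc q * (B * σ ^ 2) ≤ q * (B * σ ^ 2) * (2 * q ^ 2) := le_mul_of_one_le_right this hq2
      _ = 2 * V := by rw [hV]; ring
  have hqqB : q ^ 2 * (B ^ 2 * σ ^ 2) ≤ 2 * V := by
    have h1 : 1 ≤ 2 * q := by linarith
    have h2 : 0 ≤ q ^ 2 * (B * σ ^ 2) := by positivity
    calc q ^ 2 * (B ^ 2 * σ ^ 2) = q ^ 2 * (B * σ ^ 2) * B := by ring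
      _ ≤ q ^ 2 * (B * σ ^ 2) * 1 := mul_le_mul_of_nonneg_left hB1 h2
      _ ≤ q ^ 2 * (B * σ ^ 2) * (2 * q) := mul_le_mul_of_nonneg_left h1 h2
      _ = 2 * V := by rw [hV]; ring
  have hqq : q ^ 2 ≤ U := by nlinarith
  have e2 : q * ((B + 1 / σ) * σ ^ 2 + 2 * (M₁ + B ^ 2 * σ ^ 2 / g) / (B + 1 / σ)) ≤
      (1 + 2 + 2 * M₁ + 4 / g) * (U + V) := by
    have hy : 0 < B + 1 / σ := by positivity
    have s1 : (B + 1 / σ) * σ ^ 2 = B * σ ^ 2 + σ := by field_simp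
    -- The summand `1 / σ` of `y` handles the bounded number `M₁` of restarts, and the summand `B`
    -- those caused by drift.
    have s2 : 2 * (M₁ + B ^ 2 * σ ^ 2 / g) / (B + 1 / σ) ≤ 2 * (M₁ * σ + B * σ ^ 2 / g) := by
      rw [div_le_iff₀ hy]
      have h1 : M₁ ≤ M₁ * σ * (B + 1 / σ) := by
        have : M₁ * σ * (B + 1 / σ) = M₁ * σ * B + M₁ := by field_simp
        have h2 : 0 ≤ M₁ * σ * B := by positivity
        linarith
      have h2 : B ^ 2 * σ ^ 2 / g ≤ B * σ ^ 2 / g * (B + 1 / σ) := by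
        have : B * σ ^ 2 / g * (B + 1 / σ) = B ^ 2 * σ ^ 2 / g + B * σ / g := by field_simp
        have h3 : 0 ≤ B * σ / g := by positivity
        linarith
      linarith
    calc _ ≤ q * (B * σ ^ 2 + σ + 2 * (M₁ * σ + B * σ ^ 2 / g)) := by
          rw [s1]; gcongr
      _ = q * (B * σ ^ 2) * (1 + 2 / g) + U * (1 + 2 * M₁) := by rw [hU]; ring
      _ ≤ 2 * V * (1 + 2 / g) + U * (1 + 2 * M₁) := by gcongr
      _ ≤ _ := by
        have t1 : 0 ≤ U * (2 + 4 / g) := by positivity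
        have t2 : 0 ≤ V * (1 + 2 * M₁) := by positivity
        have e : (1 + 2 + 2 * M₁ + 4 / g) * (U + V) = 2 * V * (1 + 2 / g) + U * (1 + 2 * M₁) +
          (U * (2 + 4 / g) + V * (1 + 2 * M₁)) := by ring
        rw [e]
        linarith
  have e3 : a₃ * (1 + q ^ 2) * ((M₁ + B ^ 2 * σ ^ 2 / g) +
      a₄ * ((M₁ + B ^ 2 * σ ^ 2 / g) + a₅)) ≤ C₃ * (U + V) := by
    have h1 : q ^ 2 * (M₁ + B ^ 2 * σ ^ 2 / g) ≤ (M₁ + 2 / g) * (U + V) := by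
      have s1 : q ^ 2 * M₁ ≤ U * M₁ := mul_le_mul_of_nonneg_right hqq hM₁
      have s2 : q ^ 2 * (B ^ 2 * σ ^ 2) / g ≤ 2 * V / g := by gcongr
      have s3 : 0 ≤ 2 / g * U + M₁ * V := by positivity
      calc _ = q ^ 2 * M₁ + q ^ 2 * (B ^ 2 * σ ^ 2) / g := by ring
        _ ≤ U * M₁ + 2 * V / g + (2 / g * U + M₁ * V) := by linarith
        _ = _ := by ring
    have h2 : q ^ 2 * a₅ ≤ a₅ * (U + V) := by nlinarith
    calc _ ≤ a₃ * (3 * q ^ 2) * ((M₁ + B ^ 2 * σ ^ 2 / g) +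
          a₄ * ((M₁ + B ^ 2 * σ ^ 2 / g) + a₅)) := by gcongr; linarith
      _ = 3 * a₃ * (q ^ 2 * (M₁ + B ^ 2 * σ ^ 2 / g) +
          a₄ * (q ^ 2 * (M₁ + B ^ 2 * σ ^ 2 / g) + q ^ 2 * a₅)) := by ring
      _ ≤ 3 * a₃ * ((M₁ + 2 / g) * (U + V) + a₄ * ((M₁ + 2 / g) * (U + V) + a₅ * (U + V))) := by
          gcongr
      _ = _ := by rw [hC₃]; ring
  have e4 : a₁ * V ≤ a₁ * (U + V) := by
    refine mul_le_mul_of_nonneg_left ?_ h₁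
    linarith
  have e5 : a₅ ≤ a₅ * (U + V) := le_mul_of_one_le_right h₅ (by linarith)
  rw [e1]
  calc _ ≤ M₀ * (a₁ * (U + V) + a₂ * ((1 + 2 + 2 * M₁ + 4 / g) * (U + V)) + C₃ * (U + V)) +
        a₅ * (U + V) := by
        rw [mul_assoc a₂]
        gcongr
    _ ≤ _ := by nlinarith

end Rates

section Trajectory

variable {K : ℕ} {δ b : ℝ} {a : ℕ → Fin K} {x : ℕ → ℝ} {m : ℕ → Fin K → ℝ} {N T : ℕ}
  {i : ℕ → ℕ → Fin K}

/-! ### The regret of one trajectory -/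

lemma reg_le_of_mem_Icc {α : ℝ} (hmα : ∀ t k, m (t + 1) k ∈ Set.Icc 0 α) {t : ℕ} (ht : 1 ≤ t) :
    reg m a t ≤ α := by
  obtain ⟨s, rfl⟩ : ∃ s, t = s + 1 := ⟨t - 1, by omega⟩
  rw [reg_le_iff]
  intro j
  linarith [(hmα s j).2, (hmα s (a (s + 1))).1]

lemma gradualRegret_le_mul {α : ℝ} (hα : 0 ≤ α) (hmα : ∀ t k, m (t + 1) k ∈ Set.Icc 0 α) {M : ℕ}
    (hM : (changePoints b T m).card ≤ M) :
    gradualRegret δ b T m a x ≤ (M + 2) * (T * α) := by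
  classical
  have hsum : ∀ p q, 1 ≤ p → q ≤ T → ∑ t ∈ Finset.Icc p q, reg m a t ≤ T * α := by
    intro p q hp hq
    calc _ ≤ ∑ t ∈ Finset.Icc p q, α := Finset.sum_le_sum fun t ht =>
          reg_le_of_mem_Icc hmα (by have := Finset.mem_Icc.mp ht; omega)
      _ = ((q + 1 - p : ℕ) : ℝ) * α := by rw [Finset.sum_const, Nat.card_Icc, nsmul_eq_mul]
      _ ≤ T * α := mul_le_mul_of_nonneg_right (by exact_mod_cast (by omega)) hα
  have hX : ∀ c, c ≤ T → lastGradual δ b T m a x c ≤ T := by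
    intro c hc
    refine Finset.sup_le fun r hr => ?_
    have := Finset.mem_range.mp (Finset.mem_filter.mp hr).1
    simp only [id]
    omega
  unfold gradualRegret
  have h1 : ∀ c ∈ insert T (changePoints b T m),
      ∑ t ∈ Finset.Icc (max 1 (lastAbrupt δ b T m a x c)) (lastGradual δ b T m a x c),
        reg m a t ≤ T * α := by
    intro c hc
    refine hsum _ _ (le_max_left _ _) (hX c ?_)
    rcases Finset.mem_insert.mp hc with rfl | hc
    · exact le_rfl
    · exact (mem_changePoints.mp hc).1.2.le
  have h2 := Finset.sum_le_sum h1
  rw [Finset.sum_const, nsmul_eq_mul] at h2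
  have h3 : ((insert T (changePoints b T m)).card : ℝ) ≤ M + 1 := by
    exact_mod_cast (Finset.card_insert_le _ _).trans (by omega)
  have h4 := mul_le_mul_of_nonneg_right h3 (by positivity : 0 ≤ (T : ℝ) * α)
  have h5 := hsum (max 1 (max (lastGradual δ b T m a x T) (lastAbrupt δ b T m a x T))) T
    (le_max_left _ _) le_rfl
  linarith

lemma card_starts_le {γ B : ℝ} (hγ0 : 0 ≤ γ) (hγ : γ < 1) (hB : 0 < B)
    (hb : b = B ^ 3) (hT : 2 ≤ T) (hδ : δ = 1 / (T : ℝ) ^ 3) (hconc : Concentrated γ T a x m)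
    {M : ℕ} (hM : (changePoints b T m).card ≤ M) :
    ((starts δ a x T).card : ℝ) ≤ (M + 1) + B ^ 2 * T / (1 - γ) := by
  have h1 := card_resets_le_of_concentrated hγ0 hγ hB hb hT hδ hconc
  have h2 : ((starts δ a x T).card : ℝ) ≤ (resets δ a x T).card + 1 := by
    exact_mod_cast Finset.card_insert_le _ _
  have h3 : ((changePoints b T m).card : ℝ) ≤ M := by exact_mod_cast hM
  linarith

/-- The failure count is kept apart from the deterministic terms, because it is bounded only in
expectation. -/
lemma gradualRegret_le_of_concentrated {γ c α y B R D : ℝ} (hγ0 : 0 ≤ γ) (hγ : γ < 1)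
    (hK : 1 ≤ K) (hN : 1 ≤ N) (hc : 0 < c) (hB : 0 < B) (hb : b = B ^ 3) (hT : 2 ≤ T)
    (hδ : δ = 1 / (T : ℝ) ^ 3)
    (hrun : IsRun N δ a x i) (hconc : Concentrated γ T a x m) (hgg : GloballyGradual b T c m)
    (hdet : DetectedChanges δ b T m a x) {w M : ℕ} (hw : 0 < w)
    (hM : (changePoints b T m).card ≤ M) (hα : 0 ≤ α) (hmα : ∀ t k, m (t + 1) k ∈ Set.Icc 0 α)
    (hy : 0 < y) (hR : R = (M + 1) + B ^ 2 * T / (1 - γ)) (hD : maxDrift b c K N T w ≤ D) :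
    gradualRegret δ b T m a x ≤
      ((M + 2) * (4 * D * T + 15 * K * Real.sqrt (Real.log T) * (y * T + 2 * R / y) +
        17 * K ^ 2 * α * (1 + Real.log T) * R) + (M + 3) * α) +
      (M + 2) * (17 * K ^ 2 * α * (1 + Real.log T)) *
        ∑ ρ ∈ starts δ a x T, (failCount a x m T ρ : ℝ) := by
  have hb0 : 0 ≤ b := by rw [hb]; positivity
  have h1 := gradualRegret_le (δ := δ) (a := a) (x := x) (by omega : 1 ≤ T)
    (fun t ht => reg_le_of_mem_Icc (a := a) hmα ht) hdet
  have h2 := calmRegret_le hγ.le hK hN hc hδ hrun hconc hgg hw hb0 hα hmα hy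
  have h3 := card_starts_le hγ0 hγ hB hb hT hδ hconc hM
  rw [← hR] at h3
  set F := ∑ ρ ∈ starts δ a x T, (failCount a x m T ρ : ℝ) with hF
  have hF0 : 0 ≤ F := Finset.sum_nonneg fun ρ _ => Nat.cast_nonneg _
  have h4 : calmRegret δ b T m a x ≤
      (4 * D * T + 15 * K * Real.sqrt (Real.log T) * (y * T + 2 * R / y) +
        17 * K ^ 2 * α * (1 + Real.log T) * R) + 17 * K ^ 2 * α * (1 + Real.log T) * F := by
    refine h2.trans ?_
    have hlog : 0 ≤ Real.log T := Real.log_natCast_nonneg T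
    calc _ ≤ 4 * D * T + 15 * K * Real.sqrt (Real.log T) * (y * T + 2 * R / y) +
          17 * K ^ 2 * α * (1 + Real.log T) * (R + F) := by gcongr
      _ = _ := by ring
  have hcalm : 0 ≤ calmRegret δ b T m a x :=
    Finset.sum_nonneg fun t _ => by split_ifs; exacts [reg_nonneg t, le_rfl]
  have h5 : ((changePoints b T m).card : ℝ) ≤ M := by exact_mod_cast hM
  calc _ ≤ ((M : ℝ) + 2) * calmRegret δ b T m a x + (M + 3) * α := by
        refine h1.trans ?_
        gcongr
    _ ≤ (M + 2) * ((4 * D * T + 15 * K * Real.sqrt (Real.log T) * (y * T + 2 * R / y) +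
        17 * K ^ 2 * α * (1 + Real.log T) * R) + 17 * K ^ 2 * α * (1 + Real.log T) * F) +
        (M + 3) * α := by gcongr
    _ = _ := by ring

end Trajectory

section Expectation

/-! ### Expected regret -/

/-- At `z = 0` the squared factor is `2 * α ^ 2 / 3`, which is below 1 exactly when `α ^ 2 < 3 / 2`;
continuity leaves room for some `z > 0`. -/
lemma exists_gridFactor_lt_one {α : ℝ} (hα : α ^ 2 < 3 / 2) : ∃ z, 0 < z ∧ gridFactor α z < 1 := by
  have hcont : Continuous fun z : ℝ => (2 + z) ^ 3 * α ^ 2 / 12 := by fun_prop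
  have h0 : (fun z : ℝ => (2 + z) ^ 3 * α ^ 2 / 12) 0 < 1 := by
    simp only
    linarith
  have hev := (hcont.tendsto 0).eventually_lt_const h0
  have hev' : ∀ᶠ z : ℝ in nhdsWithin 0 (Set.Ioi 0), (2 + z) ^ 3 * α ^ 2 / 12 < 1 :=
    hev.filter_mono nhdsWithin_le_nhds
  obtain ⟨z, hz1, hz0⟩ := (hev'.and self_mem_nhdsWithin).exists
  refine ⟨z, hz0, ?_⟩
  rw [gridFactor, Real.sqrt_lt' one_pos, one_pow]
  exact hz1

/-- On `G` the pathwise bound is integrated. Off `G` the trivial bound, linear in `T`, meets a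
probability of order `1 / T` and leaves a constant. As `G` may be non-measurable, its complement is
replaced by a measurable hull. -/
lemma lintegral_gradualRegret_le {K M N T w : ℕ} (hK : 1 ≤ K) (hN : 1 ≤ N) (hT : 2 ≤ T) (hw : 0 < w)
    {α γ δ b B c y R D CB : ℝ} (hα : 0 < α) (hα' : α ^ 2 < 3 / 2) (hγ0 : 0 ≤ γ) (hγ : γ < 1)
    (hc : 0 < c) (hB : 0 < B) (hb : b = B ^ 3) (hδ : δ = 1 / (T : ℝ) ^ 3) (hy : 0 < y)
    (hR : R = (M + 1) + B ^ 2 * T / (1 - γ)) (hD : maxDrift b c K N T w ≤ D) (hCB : 0 ≤ CB)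
    {Ω : Type*} {mΩ : MeasurableSpace Ω} {P : Measure Ω} [IsProbabilityMeasure P]
    {ℱ : Filtration ℕ mΩ} {μ X : ℕ → Fin K → Ω → ℝ} {I : ℕ → Ω → Fin K} {i : Ω → ℕ → ℕ → Fin K}
    (henv : IsEnv P ℱ α μ X)
    (hM : ∀ᵐ ω ∂P, (changePoints b T (fun t k => μ t k ω)).card ≤ M)
    (hgg : ∀ᵐ ω ∂P, GloballyGradual b T c (fun t k => μ t k ω))
    (hI : ∀ t, Measurable[ℱ t] (I (t + 1)))
    (hrun : ∀ ω, IsRun N δ (fun s => I s ω) (fun s => X s (I s ω) ω) (i ω))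
    {G : Set Ω} (hG : P Gᶜ ≤ ENNReal.ofReal (CB / T))
    (hconc : ∀ ω ∈ G, Concentrated γ T (fun s => I s ω) (fun s => X s (I s ω) ω)
      (fun t k => μ t k ω))
    (hdet : ∀ ω ∈ G, DetectedChanges δ b T (fun t k => μ t k ω) (fun s => I s ω)
      (fun s => X s (I s ω) ω)) :
    ∫⁻ ω, ENNReal.ofReal (gradualRegret δ b T (fun t k => μ t k ω) (fun s => I s ω)
      (fun s => X s (I s ω) ω)) ∂P ≤
    ENNReal.ofReal (((M + 2) * (4 * D * T + 15 * K * Real.sqrt (Real.log T) * (y * T + 2 * R / y) +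
        17 * K ^ 2 * α * (1 + Real.log T) * R) + (M + 3) * α) +
      (M + 2) * (17 * K ^ 2 * α * (1 + Real.log T)) *
        (K * (∑' τ : ℕ, (τ : ℝ) ^ (-(5 / 3) : ℝ)) * (R + CB)) + (M + 2) * α * CB) := by
  have hT0 : (0 : ℝ) < T := by positivity
  have hlog : 0 ≤ Real.log T := Real.log_natCast_nonneg T
  have hb0 : 0 ≤ b := by rw [hb]; positivity
  have hD0 : 0 ≤ D := (maxDrift_nonneg hb0 hc).trans hD
  have hg : 0 < 1 - γ := by linarith
  have hR0 : 0 ≤ R := by rw [hR]; positivity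
  have hS0 : 0 ≤ ∑' τ : ℕ, (τ : ℝ) ^ (-(5 / 3) : ℝ) := tsum_nonneg fun τ => by positivity
  set A₀ := (M + 2) * (4 * D * T + 15 * K * Real.sqrt (Real.log T) * (y * T + 2 * R / y) +
        17 * K ^ 2 * α * (1 + Real.log T) * R) + (M + 3) * α with hA₀
  set A₁ := (M + 2) * (17 * K ^ 2 * α * (1 + Real.log T)) with hA₁
  have hA₀0 : 0 ≤ A₀ := by positivity
  have hA₁0 : 0 ≤ A₁ := by positivity
  set F : Ω → ℝ := fun ω => ∑ ρ ∈ starts δ (fun u => I u ω) (fun u => X u (I u ω) ω) T,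
    (failCount (fun u => I u ω) (fun u => X u (I u ω) ω) (fun t k => μ t k ω) T ρ : ℝ) with hF
  have hFint := lintegral_sum_failCount_le (δ := δ) hα hα' henv hI (by omega : 1 ≤ T) hR0 hCB hG (by
    filter_upwards [hM] with ω hω hg
    rw [hR]
    exact card_starts_le hγ0 hγ hB hb hT hδ (hconc ω hg) hω)
  calc _ ≤ ∫⁻ ω, (ENNReal.ofReal A₀ + (ENNReal.ofReal A₁ * ENNReal.ofReal (F ω) +
        (toMeasurable P Gᶜ).indicator (fun _ => ENNReal.ofReal ((M + 2) * (T * α))) ω)) ∂P := by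
        refine lintegral_mono_ae ?_
        filter_upwards [hM, hgg] with ω h1 h2
        by_cases h3 : ω ∈ G
        · have h4 := gradualRegret_le_of_concentrated (α := α) hγ0 hγ hK hN hc hB hb hT hδ (hrun ω)
            (hconc ω h3) h2 (hdet ω h3) hw h1 hα.le (fun t k => henv.mean_mem t k ω) hy hR hD
          rw [← add_assoc]
          refine le_add_right ?_
          rw [← ENNReal.ofReal_mul hA₁0, ← ENNReal.ofReal_add hA₀0
            (mul_nonneg hA₁0 (Finset.sum_nonneg fun ρ _ => Nat.cast_nonneg _))]
          exact ENNReal.ofReal_le_ofReal h4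
        · rw [Set.indicator_of_mem (subset_toMeasurable P Gᶜ h3), ← add_assoc]
          exact le_add_left (ENNReal.ofReal_le_ofReal
            (gradualRegret_le_mul hα.le (fun t k => henv.mean_mem t k ω) h1))
    _ = ENNReal.ofReal A₀ + (ENNReal.ofReal A₁ * ∫⁻ ω, ENNReal.ofReal (F ω) ∂P +
        ENNReal.ofReal ((M + 2) * (T * α)) * P Gᶜ) := by
        rw [lintegral_add_left measurable_const, lintegral_const, measure_univ, mul_one,
          lintegral_add_right _ (measurable_const.indicator (measurableSet_toMeasurable P _)),
          lintegral_const_mul' _ _ ENNReal.ofReal_ne_top,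
          lintegral_indicator_const (measurableSet_toMeasurable P _), measure_toMeasurable]
    _ ≤ ENNReal.ofReal A₀ + (ENNReal.ofReal A₁ *
        ENNReal.ofReal (K * (∑' τ : ℕ, (τ : ℝ) ^ (-(5 / 3) : ℝ)) * (R + CB)) +
        ENNReal.ofReal ((M + 2) * (T * α)) * ENNReal.ofReal (CB / T)) := by
        gcongr
    _ = _ := by
        rw [← ENNReal.ofReal_mul hA₁0, ← ENNReal.ofReal_mul (by positivity),
          ← ENNReal.ofReal_add (by positivity) (by positivity),
          ← ENNReal.ofReal_add hA₀0 (by positivity)]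
        congr 1
        field_simp
        ring

end Expectation

end ABAR

theorem theorem2 (K M : ℕ) (hK : 1 ≤ K) (α d c_g C_N c₀ : ℝ)
    (hα : 0 < α) (hα' : α ^ 2 < 3 / 2) (hd : 0 < d) (hcg : 0 < c_g) (hcg' : c_g ≤ 1)
    (hUCB : ABAR.UCBLogDriftTolerant.{u} K α) :
    ∃ C : ℝ, 0 < C ∧
      ∀ (T N : ℕ) (δ b : ℝ), 2 ≤ T → 1 ≤ N →
        δ = 1 / (T : ℝ) ^ 3 → b = (T : ℝ) ^ (-d) →
        (N : ℝ) ≤ C_N * (b * K) ^ (-(2 / 3) : ℝ) →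
        ∀ (Ω : Type u) (mΩ : MeasurableSpace Ω) (P : Measure Ω) (_ : IsProbabilityMeasure P)
          (ℱ : Filtration ℕ mΩ) (μ X : ℕ → Fin K → Ω → ℝ) (I : ℕ → Ω → Fin K)
          (i : Ω → ℕ → ℕ → Fin K),
          -- the environment
          ABAR.IsEnv P ℱ α μ X →
          (∀ᵐ ω ∂P, (ABAR.changePoints b T (fun t k => μ t k ω)).card ≤ M) →
          (∀ᵐ ω ∂P, ABAR.GloballyGradual b T c_g (fun t k => μ t k ω)) →
          -- the arms `I` are pulled by ABAR, without anticipating the future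
          (∀ t, Measurable[ℱ t] (I (t + 1))) →
          (∀ ω, ABAR.IsRun N δ (fun s => I s ω) (fun s => X s (I s ω) ω) (i ω)) →
          -- monitoring-arm assumption, and detection of the abrupt changes
          P {ω | ¬ ABAR.MonitoredChanges N δ b T (fun t k => μ t k ω) (fun s => I s ω)
              (fun s => X s (I s ω) ω) (i ω)} ≤ ENNReal.ofReal (c₀ / T) →
          P {ω | ¬ ABAR.DetectedChanges δ b T (fun t k => μ t k ω) (fun s => I s ω)
              (fun s => X s (I s ω) ω)} ≤ ENNReal.ofReal (c₀ / T) →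
          ∫⁻ ω, ENNReal.ofReal (ABAR.gradualRegret δ b T (fun t k => μ t k ω) (fun s => I s ω)
              (fun s => X s (I s ω) ω)) ∂P ≤
            ENNReal.ofReal
              (C * Real.sqrt ((Real.log T) ^ (2 / 3 : ℝ) * (T : ℝ) ^ (2 - 2 / 3 * d) +
                  T * Real.log T) +
                C * ((T : ℝ) ^ (1 - d / 3) * (Real.log T) ^ (3 / 2 : ℝ))) := by
  obtain ⟨z, hz, hγ⟩ := ABAR.exists_gridFactor_lt_one hα'
  set γ := ABAR.gridFactor α z with hγd
  have hγ0 : 0 ≤ γ := Real.sqrt_nonneg _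
  have hlz : 0 < Real.log (1 + z) := Real.log_pos (by linarith)
  set CB := 2 * K * (1 / (z * Real.log (1 + z)) + 1) + max c₀ 0 with hCB
  have hCB0 : 0 ≤ CB := by positivity
  set S := ∑' τ : ℕ, (τ : ℝ) ^ (-(5 / 3) : ℝ) with hS
  have hS0 : 0 ≤ S := tsum_nonneg fun τ => by positivity
  set CD := 4 * |C_N| * K + 4 * (12 * K + 2 / c_g * (10 + 4 * K) + 2) + 4 with hCD
  -- One constant serving twice: it dominates the additive constants of the final bound and also
  -- `CB`, which occurs next to `R`.
  set a₅ := CB + (M + 3) * α + (M + 2) * α * CB with ha₅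
  obtain ⟨C, hC0, hC⟩ := ABAR.exists_rate_bound (M₀ := M + 2) (M₁ := M + 1) (a₁ := 4 * CD)
    (a₂ := 15 * K) (a₃ := 17 * K ^ 2 * α) (a₄ := K * S) (a₅ := a₅) (g := 1 - γ) (by positivity)
    (by positivity) (by positivity) (by positivity) (by positivity) (by positivity) (by positivity)
    (by linarith)
  refine ⟨C, hC0, ?_⟩
  intro T N δ b hT hN hδ hb hNb Ω mΩ P hP ℱ μ X I i henv hM hgg hI hrun _ hdet
  have hT2 : (2 : ℝ) ≤ T := by exact_mod_cast hT
  have hT0 : (0 : ℝ) < T := by linarith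
  have hlog0 : 0 ≤ Real.log T := Real.log_natCast_nonneg T
  set B := (T : ℝ) ^ (-(d / 3)) with hB
  have hB0 : 0 < B := by positivity
  have hB1 : B ≤ 1 := Real.rpow_le_one_of_one_le_of_nonpos (by linarith) (by linarith)
  have hbB : b = B ^ 3 := by
    rw [hb, hB, ← Real.rpow_natCast, ← Real.rpow_mul hT0.le]
    congr 1
    push_cast
    ring
  set q := Real.sqrt (Real.log T) with hq
  have hq2 : q ^ 2 = Real.log T := Real.sq_sqrt hlog0
  set σ := Real.sqrt T with hσ
  have hσ2 : σ ^ 2 = T := Real.sq_sqrt hT0.le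
  have hq1 : 4 / 5 ≤ q := by
    apply Real.le_sqrt_of_sq_le
    have h1 := Real.log_two_gt_d9
    have h2 : Real.log 2 ≤ Real.log T := Real.log_le_log (by norm_num) hT2
    norm_num
    linarith
  have hqσ : q ≤ σ := Real.sqrt_le_sqrt (Real.log_le_self hT0.le)
  have hσ1 : 7 / 5 ≤ σ := by
    apply Real.le_sqrt_of_sq_le
    norm_num
    linarith
  -- The window parameter of order `b ^ (-2/3)` that balances noise against drift.
  set w := ⌈1 / B ^ 2⌉₊ with hw
  have hw1 : 1 / B ^ 2 ≤ w := Nat.le_ceil _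
  have hw2 : (w : ℝ) ≤ 2 / B ^ 2 := by
    have h1 : (w : ℝ) < 1 / B ^ 2 + 1 := Nat.ceil_lt_add_one (by positivity)
    have h2 : 1 ≤ 1 / B ^ 2 := one_le_one_div (by positivity) (pow_le_one₀ hB0.le hB1)
    have h3 : 2 / B ^ 2 = 1 / B ^ 2 + 1 / B ^ 2 := by ring
    linarith
  have hw0 : 0 < w := Nat.ceil_pos.mpr (by positivity)
  have hD : ABAR.maxDrift b c_g K N T w ≤ CD * (B * q ^ 3) :=
    ABAR.maxDrift_le hcg hB0 hB1 hbB hq1 hq2.symm hw1 hw2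
      (ABAR.mul_blockLength_le hK hB0 hbB hNb)
  set R : ℝ := (M + 1) + B ^ 2 * T / (1 - γ) with hR
  set G : Set Ω := {ω | ABAR.Concentrated γ T (fun s => I s ω) (fun s => X s (I s ω) ω)
      (fun t k => μ t k ω)} ∩ {ω | ABAR.DetectedChanges δ b T (fun t k => μ t k ω)
      (fun s => I s ω) (fun s => X s (I s ω) ω)} with hG
  have hPG : P Gᶜ ≤ ENNReal.ofReal (CB / T) := by
    rw [hG, Set.compl_inter]
    refine (measure_union_le _ _).trans ?_
    refine (add_le_add (ABAR.measure_not_concentrated_le hα henv hI hz hT) hdet).trans ?_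
    have h1 : ENNReal.ofReal (c₀ / T) ≤ ENNReal.ofReal (max c₀ 0 / T) :=
      ENNReal.ofReal_le_ofReal (div_le_div_of_nonneg_right (le_max_left _ _) hT0.le)
    refine (add_le_add le_rfl h1).trans (le_of_eq ?_)
    rw [← ENNReal.ofReal_add (by positivity) (by positivity), hCB, add_div]
  refine (ABAR.lintegral_gradualRegret_le (y := B + 1 / σ) hK hN hT hw0 hα hα' hγ0 hγ hcg hB0 hbB hδ
    (by positivity) hR hD hCB0 henv hM hgg hI hrun hPG (fun ω hω => hω.1)
    (fun ω hω => hω.2)).trans ?_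
  apply ENNReal.ofReal_le_ofReal
  have hmain := hC B q σ hB0 hB1 hq1 hqσ hσ1
  rw [hσ2, ← hR] at hmain
  have hle : C * (σ * q + T * B * q ^ 3) ≤
      C * Real.sqrt ((Real.log T) ^ (2 / 3 : ℝ) * (T : ℝ) ^ (2 - 2 / 3 * d) + T * Real.log T) +
        C * ((T : ℝ) ^ (1 - d / 3) * (Real.log T) ^ (3 / 2 : ℝ)) := by
    rw [mul_add]
    have h1 : σ * q ≤
        Real.sqrt ((Real.log T) ^ (2 / 3 : ℝ) * (T : ℝ) ^ (2 - 2 / 3 * d) + T * Real.log T) := by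
      rw [hσ, hq, ← Real.sqrt_mul hT0.le]
      apply Real.sqrt_le_sqrt
      have : 0 ≤ (Real.log T) ^ (2 / 3 : ℝ) * (T : ℝ) ^ (2 - 2 / 3 * d) := by positivity
      linarith
    have h2 : T * B = (T : ℝ) ^ (1 - d / 3) := by
      rw [sub_eq_add_neg, Real.rpow_add hT0, Real.rpow_one]
    have h3 : q ^ 3 = (Real.log T) ^ (3 / 2 : ℝ) := by
      rw [hq, Real.sqrt_eq_rpow, ← Real.rpow_natCast, ← Real.rpow_mul hlog0]
      norm_num
    rw [h2, h3]
    have := mul_le_mul_of_nonneg_left h1 hC0.le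
    linarith
  refine le_trans ?_ (hmain.trans hle)
  have hR0 : 0 ≤ R := by
    have : 0 < 1 - γ := by linarith
    positivity
  have hCBa : CB ≤ a₅ := by
    have : 0 ≤ (M + 3) * α + (M + 2) * α * CB := by positivity
    linarith
  rw [← hq2]
  have hX : ((M : ℝ) + 2) * (17 * K ^ 2 * α * (1 + q ^ 2)) * (K * S * (R + CB)) ≤
      (M + 2) * (17 * K ^ 2 * α * (1 + q ^ 2)) * (K * S * (R + a₅)) := by gcongr
  have hY : Real.sqrt (q ^ 2) = q := Real.sqrt_sq (by linarith)
  rw [hY]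
  linarith
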